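/- **Setting.** Let $n\ge 1$ and let $[n+1]$ consist of $n$ parties $[n]$ and a purifier $n+1$. An entropy vector is a real vector $S=(S(I))_{\emptyset\ne I\subseteq[n]}\in\mathbb R^{2^n-1}$; put $S(\emptyset)=0$ and extend $S$ to subsets $K$ of $[n+1]$ that contain the purifier by $S(K)=S([n+1]\setminus K)$. The symmetric group of $[n+1]$ acts on entropy space by $(\sigma S)(I)=S(\sigma(I))$ (permutation and purification symmetry). *Hypergraph cone.* Take a finite vertex set $V$, a set of hyperedges (subsets of $V$ with at least two elements) with nonnegative weights, a set $\partial V\subseteq V$ of boundary vertices (the other vertices are called bulk vertices) and a coloring $b:\partial V\to[n+1]$. A cut $W\subseteq V$ has as its weight the total weight of the hyperedges that meet both $W$ and $V\setminus W$, and $S(I)$ is the minimum weight of a cut $W$ with $W\cap\partial V=b^{-1}(I)$. The $n$-party hypergraph entropy cone is the set of all entropy vectors that arise in this way. *Quantum linear rank (QLR) cone.* A linear rank inequality is a linear inequality $\sum_I Q_I S(I)\ge 0$ that holds for $S(I)=\dim\sum_{i\in I}U_i$ whenever $U_1,\dots,U_n$ are subspaces of a finite-dimensional vector space over any field; it is balanced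 if $\sum_{I\ni i}Q_I=0$ for every $i\in[n]$. The QLR cone is the set of all $S$ that satisfy subadditivity $S(I)+S(J)\ge S(I\cup J)$ and weak monotonicity $S(I\cup J)+S(J\cup K)\ge S(I)+S(K)$ for pairwise disjoint subsets of $[n+1]$, together with the symmetry orbits of all balanced linear rank inequalities. *Stabilizer cone.* A stabilizer state of finitely many qudits of dimension $d\ge2$ is a unit vector that is, up to scalars, the unique common eigenvector of eigenvalue one of a set of (phases times) tensor products of generalized Pauli matrices $X^aZ^b$. Distribute the qudits in any way over the parties in $[n+1]$, and let $S(I)$ be the von Neumann entropy of the reduced state on the qudits held by $I\subseteq[n]$. The qubit stabilizer cone is the set of all conical combinations of the resulting entropy vectors for $d=2$; the qudit stabilizer cone is the set of all conical combinations of the entropy vectors for all $d\ge 2$ together. **Theorem.** Let $n=4$, with parties $A,B,C,D$ and purifier $O$. 1. The 4-party hypergraph entropy cone is exactly the set of entropy vectors that satisfy the symmetry orbits of - (SA) $S(A)+S(B)\ge S(AB)$, - (SSA) $S(AB)+S(BC)\ge S(ABC)+S(B)$, - (Ingleton) $S(AB)+S(AC)+S(AD)+S(BC)+S(BD)\ge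 S(A)+S(B)+S(CD)+S(ABC)+S(ABD)$, that is, $I(A\!:\!B|C)+I(A\!:\!B|D)+I(C\!:\!D)-I(A\!:\!B)\ge 0$. 2. It coincides with the 4-party QLR cone, and with the 4-party stabilizer cone, both for qubits and for qudits of arbitrary dimension. 3. Each of SA, SSA and Ingleton, written as $\sum_{l=1}^L\alpha_lS(I_l)\ge\sum_{r=1}^R\beta_rS(J_r)$ as above, has a contraction map valid for all ranks: a map $f:\{0,1\}^L\to\{0,1\}^R$ that sends $(\mathbf 1[i\in I_l])_l$ to $(\mathbf 1[i\in J_r])_r$ for every $i\in\{A,B,C,D,O\}$ and satisfies $i^k_\alpha(x^1,\dots,x^k)\ge i^k_\beta(f(x^1),\dots,f(x^k))$ for all $k\ge2$ and all $x^1,\dots,x^k\in\{0,1\}^L$. Here $i^k_\alpha(x^1,\dots,x^k)$ is the sum of $\alpha_l$ over those positions $l$ at which $x^1,\dots,x^k$ do not all agree, and $i^k_\beta$ is defined likewise. 4. Every vector that spans an extreme ray of this cone is the entropy vector of a hypergraph with at most one bulk vertex. -/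

import Mathlib

namespace EntropyCone

/-! ### Entropy space -/

/-- Entropy space on `n` parties: one real coordinate for each nonempty set of parties. -/
abbrev EntropyVector (n : ℕ) : Type := {I : Finset (Fin n) // I.Nonempty} → ℝ

/-- The parties of the purified system are `Fin (n + 1)`, the last one being the purifier.
The `n` original parties are embedded as the first `n` ones. -/
def withPurifier {n : ℕ} (I : Finset (Fin n)) : Finset (Fin (n + 1)) :=
  I.map Fin.castSuccEmb

/-- The original parties that occur in a set of parties of the purified system. -/
def withoutPurifier {n : ℕ} (K : Finset (Fin (n + 1))) : Finset (Fin n) :=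
  Finset.univ.filter fun i => i.castSucc ∈ K

/-- The value of an entropy vector on a set of original parties, with `S(∅) = 0`. -/
def value {n : ℕ} (S : EntropyVector n) (I : Finset (Fin n)) : ℝ :=
  if h : I.Nonempty then S ⟨I, h⟩ else 0

/-- The value of an entropy vector on a set of parties of the purified (pure, total) system:
a set that contains the purifier has the entropy of its complement. -/
def purifiedValue {n : ℕ} (S : EntropyVector n) (K : Finset (Fin (n + 1))) : ℝ :=
  if Fin.last n ∈ K then value S (withoutPurifier Kᶜ) else value S (withoutPurifier K)

/-- Permutation and purification symmetry: a permutation of the `n + 1` parties (purifier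
included) acts on entropy space by relabelling. -/
def relabel {n : ℕ} (σ : Equiv.Perm (Fin (n + 1))) (S : EntropyVector n) : EntropyVector n :=
  fun I => purifiedValue S ((withPurifier I.1).map σ.toEmbedding)

/-! ### Linear entropy inequalities, their orbits, contraction maps -/

/-- A linear entropy inequality `∑ₗ αₗ S(Iₗ) ≥ ∑ᵣ βᵣ S(Jᵣ)` on `n` parties. -/
structure EntropyInequality (n : ℕ) where
  L : ℕ
  R : ℕ
  α : Fin L → ℝ
  β : Fin R → ℝ
  I : Fin L → Finset (Fin n)
  J : Fin R → Finset (Fin n)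
  α_pos : ∀ l, 0 < α l
  β_pos : ∀ r, 0 < β r

/-- The entropy vector `S` satisfies the inequality. -/
def EntropyInequality.Holds {n : ℕ} (q : EntropyInequality n) (S : EntropyVector n) : Prop :=
  ∑ r, q.β r * value S (q.J r) ≤ ∑ l, q.α l * value S (q.I l)

/-- `S` satisfies the whole symmetry orbit of the inequality. -/
def EntropyInequality.OrbitHolds {n : ℕ} (q : EntropyInequality n) (S : EntropyVector n) : Prop :=
  ∀ σ : Equiv.Perm (Fin (n + 1)), q.Holds (relabel σ S)

/-- The weighted indicator function `i^k_α` of `k` bit strings of length `m`: the total weight of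
the positions at which the `k` bit strings are not all equal. -/
def weightedIndicator {k m : ℕ} (α : Fin m → ℝ) (x : Fin k → Fin m → Bool) : ℝ :=
  ∑ l, if ∃ i j, x i l ≠ x j l then α l else 0

/-- The occurrence vector of party `i` (possibly the purifier) in a list of subsystems. -/
def occurrence {n m : ℕ} (I : Fin m → Finset (Fin n)) (i : Fin (n + 1)) : Fin m → Bool :=
  fun l => decide (i ∈ withPurifier (I l))

/-- `f` is a contraction map for the inequality on hypergraphs of every finite rank: it sends
left occurrence vectors to right ones, and is an `i^k_α`-`i^k_β` contraction for all `k ≥ 2`. -/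
def EntropyInequality.IsContractionMap {n : ℕ} (q : EntropyInequality n)
    (f : (Fin q.L → Bool) → (Fin q.R → Bool)) : Prop :=
  (∀ i : Fin (n + 1), f (occurrence q.I i) = occurrence q.J i) ∧
    ∀ k : ℕ, 2 ≤ k → ∀ x : Fin k → Fin q.L → Bool,
      weightedIndicator q.β (fun i => f (x i)) ≤ weightedIndicator q.α x

/-- Subadditivity `S(A) + S(B) ≥ S(AB)`, with parties `A, B, C, D = 0, 1, 2, 3`. -/
def SA : EntropyInequality 4 where
  L := 2
  R := 1
  α := fun _ => 1
  β := fun _ => 1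
  I := ![{0}, {1}]
  J := ![{0, 1}]
  α_pos := fun _ => one_pos
  β_pos := fun _ => one_pos

/-- Strong subadditivity `S(AB) + S(BC) ≥ S(ABC) + S(B)`. -/
def SSA : EntropyInequality 4 where
  L := 2
  R := 2
  α := fun _ => 1
  β := fun _ => 1
  I := ![{0, 1}, {1, 2}]
  J := ![{0, 1, 2}, {1}]
  α_pos := fun _ => one_pos
  β_pos := fun _ => one_pos

/-- The Ingleton inequality `I(A:B|C) + I(A:B|D) + I(C:D) - I(A:B) ≥ 0`, written out as
`S(AB) + S(AC) + S(AD) + S(BC) + S(BD) ≥ S(A) + S(B) + S(CD) + S(ABC) + S(ABD)`. -/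
def Ingleton : EntropyInequality 4 where
  L := 5
  R := 5
  α := fun _ => 1
  β := fun _ => 1
  I := ![{0, 1}, {0, 2}, {0, 3}, {1, 2}, {1, 3}]
  J := ![{0}, {1}, {2, 3}, {0, 1, 2}, {0, 1, 3}]
  α_pos := fun _ => one_pos
  β_pos := fun _ => one_pos

/-- The cone cut out by the symmetry orbits of SA, SSA and Ingleton. -/
def ingletonCone : Set (EntropyVector 4) :=
  {S | SA.OrbitHolds S ∧ SSA.OrbitHolds S ∧ Ingleton.OrbitHolds S}

/-! ### Hypergraphs and discrete entropies -/

/-- A hypergraph on the vertex set `V` with nonnegative hyperedge weights and a coloring of its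
boundary vertices by the `n + 1` parties (`color v = none` for a bulk vertex `v`). -/
structure Hypergraph (V : Type) (n : ℕ) where
  edges : Finset (Finset V)
  two_le_card : ∀ e ∈ edges, 2 ≤ e.card
  weight : Finset V → ℝ
  weight_nonneg : ∀ e ∈ edges, 0 ≤ weight e
  color : V → Option (Fin (n + 1))

namespace Hypergraph

variable {V : Type} [Fintype V] [DecidableEq V] {n : ℕ}

/-- The total weight of the hyperedges that meet both `W` and its complement. -/
def cutWeight (H : Hypergraph V n) (W : Finset V) : ℝ :=
  ∑ e ∈ H.edges.filter (fun e => (e ∩ W).Nonempty ∧ (e ∩ Wᶜ).Nonempty), H.weight e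

/-- The cuts `W` whose boundary vertices are precisely those colored by `I`. -/
def cuts (H : Hypergraph V n) (I : Finset (Fin n)) : Finset (Finset V) :=
  Finset.univ.filter fun W => ∀ v i, H.color v = some i → (v ∈ W ↔ i ∈ withPurifier I)

theorem cuts_nonempty (H : Hypergraph V n) (I : Finset (Fin n)) : (H.cuts I).Nonempty := by
  refine ⟨Finset.univ.filter fun v => ∃ i ∈ withPurifier I, H.color v = some i, ?_⟩
  simp only [cuts, Finset.mem_filter, Finset.mem_univ, true_and]
  intro v i hv
  constructor
  · rintro ⟨j, hj, hvj⟩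
    rw [hv, Option.some.injEq] at hvj
    exact hvj ▸ hj
  · intro hi
    exact ⟨i, hi, hv⟩

/-- The discrete entropies of a hypergraph, by the min-cut prescription. -/
def entropy (H : Hypergraph V n) : EntropyVector n :=
  fun I => (H.cuts I.1).inf' (H.cuts_nonempty I.1) H.cutWeight

/-- The number of bulk vertices. -/
def bulkCard (H : Hypergraph V n) : ℕ := (Finset.univ.filter fun v => H.color v = none).card

end Hypergraph

/-- The `n`-party hypergraph entropy cone: all entropy vectors of finite hypergraphs. -/
def hypergraphCone (n : ℕ) : Set (EntropyVector n) :=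
  {S | ∃ (V : Type) (_ : Fintype V) (_ : DecidableEq V) (H : Hypergraph V n), H.entropy = S}

/-- `S` spans an extreme ray of the cone `C`. -/
def IsExtremeRay {n : ℕ} (C : Set (EntropyVector n)) (S : EntropyVector n) : Prop :=
  S ∈ C ∧ S ≠ 0 ∧ ∀ T ∈ C, ∀ U ∈ C, T + U = S → ∃ t : ℝ, 0 ≤ t ∧ T = t • S

/-! ### Linear ranks -/

/-- The rank vector of `n` linear subspaces: the dimension of the sum of each subfamily. -/
noncomputable def rankVector {n : ℕ} {K E : Type} [Field K] [AddCommGroup E] [Module K E]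
    (U : Fin n → Submodule K E) : EntropyVector n :=
  fun I => (Module.finrank K (⨆ i ∈ I.1, U i : Submodule K E) : ℝ)

/-- `∑_I Q_I S(I) ≥ 0` is a linear rank inequality: it holds for the ranks of any `n` subspaces of
any finite-dimensional vector space over any field. -/
def IsLinearRankInequality {n : ℕ} (Q : EntropyVector n) : Prop :=
  ∀ (K E : Type) [Field K] [AddCommGroup E] [Module K E] [FiniteDimensional K E]
    (U : Fin n → Submodule K E), 0 ≤ ∑ I, Q I * rankVector U I

/-- For every party, the coefficients of the subsystems that contain it sum to zero. -/
def IsBalanced {n : ℕ} (Q : EntropyVector n) : Prop :=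
  ∀ i : Fin n, ∑ I, (if i ∈ I.1 then Q I else 0) = 0

/-- The `n`-party quantum linear rank cone, cut out by subadditivity, weak monotonicity, and the
symmetry orbits of all balanced linear rank inequalities. In SA and weak monotonicity the
subsystems are arbitrary disjoint sets of parties, purifier included. -/
def quantumLinearRankCone (n : ℕ) : Set (EntropyVector n) :=
  {S | (∀ I J : Finset (Fin (n + 1)), Disjoint I J →
          purifiedValue S (I ∪ J) ≤ purifiedValue S I + purifiedValue S J) ∧
       (∀ I J K : Finset (Fin (n + 1)), Disjoint I J → Disjoint J K → Disjoint I K →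
          purifiedValue S I + purifiedValue S K ≤
            purifiedValue S (I ∪ J) + purifiedValue S (J ∪ K)) ∧
       ∀ Q : EntropyVector n, IsLinearRankInequality Q → IsBalanced Q →
          ∀ σ : Equiv.Perm (Fin (n + 1)), 0 ≤ ∑ I, Q I * relabel σ S I}

/-! ### Stabilizer states -/

section Stabilizer

variable {d : ℕ} [NeZero d] {ι : Type} [Fintype ι] [DecidableEq ι]

/-- The single-qudit Pauli matrix `X^a Z^b`, i.e. `|y⟩ ↦ exp(2πi b y / d) |y + a⟩`. -/
noncomputable def pauli (a b : ZMod d) : Matrix (ZMod d) (ZMod d) ℂ :=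
  Matrix.of fun x y => if x = y + a then ZMod.stdAddChar (b * y) else 0

/-- The tensor product over the qudits `q : ι` of the Pauli matrices `X^(a q) Z^(b q)`. -/
noncomputable def pauliString (a b : ι → ZMod d) : Matrix (ι → ZMod d) (ι → ZMod d) ℂ :=
  Matrix.of fun x y => ∏ q, pauli (a q) (b q) (x q) (y q)

/-- A (pure) stabilizer state of the qudits `ι`: a unit vector that is, up to scalars, the unique
common eigenvector of eigenvalue one of some set of Pauli operators (with phases). -/
def IsStabilizerState (ψ : (ι → ZMod d) → ℂ) : Prop :=
  ∑ x, ‖ψ x‖ ^ 2 = 1 ∧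
    ∃ G : Set (Matrix (ι → ZMod d) (ι → ZMod d) ℂ),
      (∀ M ∈ G, ∃ (c : ℂ) (a b : ι → ZMod d), ‖c‖ = 1 ∧ M = c • pauliString a b) ∧
      ∀ φ : (ι → ZMod d) → ℂ, (∀ M ∈ G, M.mulVec φ = φ) ↔ ∃ z : ℂ, φ = z • ψ

/-- The computational basis label that is `x` on the qudits in `s` and `y` on the others. -/
def glue (s : Finset ι) (x : {q // q ∈ s} → ZMod d) (y : {q // q ∉ s} → ZMod d) : ι → ZMod d :=
  fun q => if h : q ∈ s then x ⟨q, h⟩ else y ⟨q, h⟩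

/-- The reduced density matrix of the qudits in `s`: the partial trace of `|ψ⟩⟨ψ|`. -/
noncomputable def reducedDensity (ψ : (ι → ZMod d) → ℂ) (s : Finset ι) :
    Matrix ({q // q ∈ s} → ZMod d) ({q // q ∈ s} → ZMod d) ℂ :=
  Matrix.of fun x x' => ∑ y : {q // q ∉ s} → ZMod d,
    ψ (glue s x y) * (starRingEnd ℂ) (ψ (glue s x' y))

theorem reducedDensity_isHermitian (ψ : (ι → ZMod d) → ℂ) (s : Finset ι) :
    (reducedDensity ψ s).IsHermitian := by
  ext x x'
  simp [reducedDensity, Matrix.conjTranspose_apply, mul_comm]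

/-- The von Neumann entropy `-tr(ρ log ρ) = -∑ λ log λ` of the reduced state on `s`. -/
noncomputable def vonNeumannEntropy (ψ : (ι → ZMod d) → ℂ) (s : Finset ι) : ℝ :=
  ∑ j, Real.negMulLog ((reducedDensity_isHermitian ψ s).eigenvalues j)

end Stabilizer

/-- The entropy vectors of `n`-party stabilizer states of qudits of dimension `d`: the qudits of a
pure stabilizer state are distributed in any way over the `n` parties and the purifier. -/
def stabilizerEntropyVectors (d : ℕ) [NeZero d] (n : ℕ) : Set (EntropyVector n) :=
  {S | ∃ (m : ℕ) (owner : Fin m → Fin (n + 1)) (ψ : (Fin m → ZMod d) → ℂ),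
      IsStabilizerState ψ ∧
      ∀ I, S I = vonNeumannEntropy ψ (Finset.univ.filter fun q => owner q ∈ withPurifier I.1)}

/-- The `n`-party stabilizer entropy cone of qubits: all conical combinations of entropy vectors
of qubit stabilizer states. -/
def qubitStabilizerCone (n : ℕ) : Set (EntropyVector n) :=
  PointedCone.hull ℝ (stabilizerEntropyVectors 2 n)

/-- The `n`-party stabilizer entropy cone of qudits of arbitrary local dimensions `d ≥ 2`. -/
def quditStabilizerCone (n : ℕ) : Set (EntropyVector n) :=
  PointedCone.hull ℝ (⋃ d : ℕ, stabilizerEntropyVectors (d + 2) n)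

end EntropyCone

set_option linter.unusedSectionVars false

namespace EntropyCone

/-! ### Purified values and relabelling -/

section Relabel

variable {n : ℕ}

/-! Every cone is compared with `ingletonCone`. On five parties the orbits amount to 70
inequalities: 10 of the form I(i:j) ≥ 0, 30 of the form I(i:j|k) ≥ 0 and 30 Ingleton inequalities.

Generation. `ingletonCone` is generated by the orbits `ray` of seven explicit vectors. Subtract rays
from a vector greedily until no positive multiple of any ray can be removed (`exists_reduction`).
For such an irreducible remainder R, every ray is slack at some inequality tight at R
(`Irreducible.exists_tight`). Linear identities between sums of the 70 nonnegative expressions show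
moreover that tightness of one side forces tightness of the other. Finally, not all 70 can be tight
unless R = 0. These facts form a propositional problem about which inequalities are tight: Horn
clauses from identities and positive clauses from rays. A verified unit-propagation search, run in
the kernel, refutes it together with I(0:1) = 0; by symmetry no I(i:j) vanishes at R. But the
five-party GHZ ray is slack only at the inequalities I(i:j) ≥ 0, so one of them is tight at R; hence
R = 0 (`Irreducible.eq_zero`). The same lemma shows that an extreme ray is a multiple of some `ray
k`.

Realization. Each of the seven vectors is the entropy of a hypergraph on the five parties with one
bulk vertex, and a positive multiple of the entropy vector of a qubit graph state. Hence
`ingletonCone` lies in the hypergraph cone and in the qubit stabilizer cone.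

Validity for hypergraphs. Label each vertex by the bit string recording on which side of each
left-hand minimal cut it lies. A contraction map turns these strings into right-hand cuts, and the
contraction property for k = |e| strings compares the two sides hyperedge by hyperedge
(`Hypergraph.holds_entropy`).

Validity for stabilizer states. Up to a term additive in the parties, the entropy of K is the
logarithm of the index of the subgroup of stabilizers trivial on K. The log-index is monotone and
modular on the order dual of the subgroup lattice, and a monotone modular function satisfies
Ingleton because the meet of two elements plays the role of their common information
(`modular_ingleton`). The additive terms cancel because the inequalities are balanced. For qubits
the stabilizer group is a vector space over the field with two elements, and passing to annihilators
turns log-indices into dimensions; so qubit vectors lie in the quantum linear rank cone, which is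
contained in `ingletonCone` since SSA and Ingleton are balanced linear rank inequalities. -/

theorem value_nonempty (S : EntropyVector n) {I : Finset (Fin n)} (h : I.Nonempty) :
    value S I = S ⟨I, h⟩ := dif_pos h

@[simp] theorem value_coe (S : EntropyVector n) (I : {I : Finset (Fin n) // I.Nonempty}) :
    value S I.1 = S I := dif_pos I.2

@[simp] theorem value_empty (S : EntropyVector n) : value S ∅ = 0 := by simp [value]

@[simp] theorem value_add (S T : EntropyVector n) (I : Finset (Fin n)) :
    value (S + T) I = value S I + value T I := by
  unfold value; split_ifs <;> simp

@[simp] theorem value_smul (c : ℝ) (S : EntropyVector n) (I : Finset (Fin n)) :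
    value (c • S) I = c * value S I := by
  unfold value; split_ifs <;> simp

theorem mem_withPurifier {I : Finset (Fin n)} {i : Fin n} :
    i.castSucc ∈ withPurifier I ↔ i ∈ I := by
  simp [withPurifier]

theorem last_notMem_withPurifier (I : Finset (Fin n)) : Fin.last n ∉ withPurifier I := by
  simp [withPurifier, Fin.castSucc_ne_last]

@[simp] theorem withoutPurifier_withPurifier (I : Finset (Fin n)) :
    withoutPurifier (withPurifier I) = I := by
  ext i; simp [withoutPurifier, mem_withPurifier]

theorem withPurifier_withoutPurifier {K : Finset (Fin (n + 1))} (h : Fin.last n ∉ K) :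
    withPurifier (withoutPurifier K) = K := by
  ext i
  induction i using Fin.lastCases with
  | last => simp [h, last_notMem_withPurifier]
  | cast i => simp [mem_withPurifier, withoutPurifier]

@[simp] theorem purifiedValue_withPurifier (S : EntropyVector n) (I : Finset (Fin n)) :
    purifiedValue S (withPurifier I) = value S I := by
  simp [purifiedValue, last_notMem_withPurifier]

@[simp] theorem purifiedValue_compl (S : EntropyVector n) (K : Finset (Fin (n + 1))) :
    purifiedValue S Kᶜ = purifiedValue S K := by
  by_cases h : Fin.last n ∈ K <;> simp [purifiedValue, h]

/-- A property of all sets of parties follows from its validity for sets without the purifier,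
if it is invariant under complements. -/
theorem compl_induction {p : Finset (Fin (n + 1)) → Prop} (h : ∀ I, p (withPurifier I))
    (hc : ∀ K, p K → p Kᶜ) (K : Finset (Fin (n + 1))) : p K := by
  by_cases hK : Fin.last n ∈ K
  · have h' : Fin.last n ∉ Kᶜ := by simpa using hK
    have := hc _ (h (withoutPurifier Kᶜ))
    rwa [withPurifier_withoutPurifier h', compl_compl] at this
  · rw [← withPurifier_withoutPurifier hK]
    exact h _

theorem value_relabel (σ : Equiv.Perm (Fin (n + 1))) (S : EntropyVector n) (I : Finset (Fin n)) :
    value (relabel σ S) I = purifiedValue S ((withPurifier I).map σ.toEmbedding) := by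
  by_cases h : I.Nonempty
  · rw [value_nonempty _ h]; rfl
  · rw [Finset.not_nonempty_iff_eq_empty.1 h]
    simp [withPurifier, purifiedValue, withoutPurifier]

@[simp] theorem purifiedValue_relabel (σ : Equiv.Perm (Fin (n + 1))) (S : EntropyVector n)
    (K : Finset (Fin (n + 1))) :
    purifiedValue (relabel σ S) K = purifiedValue S (K.map σ.toEmbedding) := by
  induction K using compl_induction with
  | h I => rw [purifiedValue_withPurifier, value_relabel]
  | hc K ih =>
    have : Kᶜ.map σ.toEmbedding = (K.map σ.toEmbedding)ᶜ := by
      ext i; simp [Finset.mem_map_equiv]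
    rw [purifiedValue_compl, ih, this, purifiedValue_compl]

theorem eq_of_purifiedValue_eq {S T : EntropyVector n}
    (h : ∀ K, purifiedValue S K = purifiedValue T K) : S = T := by
  funext I
  simpa using h (withPurifier I.1)

/-- The product is reversed because relabelling acts by precomposition on sets of parties. -/
theorem relabel_relabel (σ τ : Equiv.Perm (Fin (n + 1))) (S : EntropyVector n) :
    relabel σ (relabel τ S) = relabel (τ * σ) S := by
  refine eq_of_purifiedValue_eq fun K => ?_
  simp only [purifiedValue_relabel, Finset.map_map]
  rfl

@[simp] theorem relabel_one (S : EntropyVector n) : relabel 1 S = S := by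
  refine eq_of_purifiedValue_eq fun K => ?_
  rw [purifiedValue_relabel]
  congr 1
  exact Finset.map_refl

@[simp] theorem purifiedValue_add (S T : EntropyVector n) (K : Finset (Fin (n + 1))) :
    purifiedValue (S + T) K = purifiedValue S K + purifiedValue T K := by
  unfold purifiedValue; split_ifs <;> simp

@[simp] theorem purifiedValue_smul (c : ℝ) (S : EntropyVector n) (K : Finset (Fin (n + 1))) :
    purifiedValue (c • S) K = c * purifiedValue S K := by
  unfold purifiedValue; split_ifs <;> simp

@[simp] theorem relabel_add (σ : Equiv.Perm (Fin (n + 1))) (S T : EntropyVector n) :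
    relabel σ (S + T) = relabel σ S + relabel σ T := funext fun _ => purifiedValue_add S T _

@[simp] theorem relabel_smul (σ : Equiv.Perm (Fin (n + 1))) (c : ℝ) (S : EntropyVector n) :
    relabel σ (c • S) = c • relabel σ S := funext fun _ => purifiedValue_smul c S _

/-- Used to recognize the purified extension: any complement-invariant set function that vanishes at
the empty set is determined by its values on sets without the purifier. -/
theorem purifiedValue_eq_of_value {S : EntropyVector n} {p : Finset (Fin (n + 1)) → ℝ}
    (h0 : p ∅ = 0) (hc : ∀ K, p Kᶜ = p K) (h : ∀ I, S I = p (withPurifier I.1)) (K) :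
    purifiedValue S K = p K := by
  induction K using compl_induction with
  | h I =>
    rw [purifiedValue_withPurifier]
    by_cases hI : I.Nonempty
    · rw [value_nonempty _ hI, h]
    · rw [Finset.not_nonempty_iff_eq_empty.1 hI]
      simp [withPurifier, h0]
  | hc K ih => rw [purifiedValue_compl, ih, hc]

theorem EntropyInequality.OrbitHolds.relabel {q : EntropyInequality n} {S : EntropyVector n}
    (h : q.OrbitHolds S) (τ : Equiv.Perm (Fin (n + 1))) :
    q.OrbitHolds (EntropyCone.relabel τ S) := fun σ => by
  rw [relabel_relabel]; exact h _

theorem EntropyInequality.OrbitHolds.add {q : EntropyInequality n} {S T : EntropyVector n}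
    (hS : q.OrbitHolds S) (hT : q.OrbitHolds T) : q.OrbitHolds (S + T) := by
  intro σ
  have h1 := hS σ
  have h2 := hT σ
  simp only [Holds, relabel_add, value_add, mul_add, Finset.sum_add_distrib] at *
  exact add_le_add h1 h2

theorem EntropyInequality.OrbitHolds.smul {q : EntropyInequality n} {S : EntropyVector n}
    (hS : q.OrbitHolds S) {c : ℝ} (hc : 0 ≤ c) : q.OrbitHolds (c • S) := by
  intro σ
  have h1 := mul_le_mul_of_nonneg_left (hS σ) hc
  simpa only [Holds, relabel_smul, value_smul, Finset.mul_sum, mul_left_comm c] using h1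

end Relabel

/-! ### The Ingleton cone in terms of distinct parties -/

section IngletonCone

theorem ingletonCone_relabel {S : EntropyVector 4} (h : S ∈ ingletonCone)
    (σ : Equiv.Perm (Fin 5)) : relabel σ S ∈ ingletonCone :=
  ⟨h.1.relabel σ, h.2.1.relabel σ, h.2.2.relabel σ⟩

theorem ingletonCone_add {S T : EntropyVector 4} (hS : S ∈ ingletonCone)
    (hT : T ∈ ingletonCone) : S + T ∈ ingletonCone :=
  ⟨hS.1.add hT.1, hS.2.1.add hT.2.1, hS.2.2.add hT.2.2⟩

theorem ingletonCone_smul {S : EntropyVector 4} (hS : S ∈ ingletonCone) {c : ℝ} (hc : 0 ≤ c) :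
    c • S ∈ ingletonCone :=
  ⟨hS.1.smul hc, hS.2.1.smul hc, hS.2.2.smul hc⟩

/-- The symmetric group on five points is 4-transitive, so any four distinct parties can play the
roles of A, B, C, D. -/
theorem exists_perm_of_injective {f : Fin 4 → Fin 5} (hf : Function.Injective f) :
    ∃ σ : Equiv.Perm (Fin 5), ∀ i : Fin 4, σ i.castSucc = f i := by
  obtain ⟨σ, h⟩ := (Equiv.Perm.isMultiplyPretransitive (Fin 5) 4).exists_smul_eq
    (Fin.castSuccEmb : Fin 4 ↪ Fin 5) ⟨f, hf⟩
  exact ⟨σ, fun i => DFunLike.congr_fun h i⟩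

theorem SA_holds_iff (S : EntropyVector 4) :
    SA.Holds S ↔ value S {0, 1} ≤ value S {0} + value S {1} := by
  change (∑ r : Fin 1, (1 : ℝ) * value S (![{0, 1}] r)) ≤
    ∑ l : Fin 2, (1 : ℝ) * value S (![{0}, {1}] l) ↔ _
  simp [Fin.sum_univ_succ]

theorem SSA_holds_iff (S : EntropyVector 4) :
    SSA.Holds S ↔
      value S {0, 1, 2} + value S {1} ≤ value S {0, 1} + value S {1, 2} := by
  change (∑ r : Fin 2, (1 : ℝ) * value S (![{0, 1, 2}, {1}] r)) ≤
    ∑ l : Fin 2, (1 : ℝ) * value S (![{0, 1}, {1, 2}] l) ↔ _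
  simp [Fin.sum_univ_succ]

theorem Ingleton_holds_iff (S : EntropyVector 4) :
    Ingleton.Holds S ↔
      value S {0} + value S {1} + value S {2, 3} + value S {0, 1, 2} + value S {0, 1, 3} ≤
        value S {0, 1} + value S {0, 2} + value S {0, 3} + value S {1, 2} + value S {1, 3} := by
  change (∑ r : Fin 5, (1 : ℝ) * value S (![{0}, {1}, {2, 3}, {0, 1, 2}, {0, 1, 3}] r)) ≤
    ∑ l : Fin 5, (1 : ℝ) * value S (![{0, 1}, {0, 2}, {0, 3}, {1, 2}, {1, 3}] l) ↔ _
  simp [Fin.sum_univ_succ, add_assoc]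

/-- Each inequality mentions at most four parties, so running over permutations amounts to running
over ordered choices of four distinct parties; the purifier is treated like any other. -/
theorem mem_ingletonCone_iff {S : EntropyVector 4} :
    S ∈ ingletonCone ↔ ∀ i j k l : Fin 5, i ≠ j → i ≠ k → i ≠ l → j ≠ k → j ≠ l → k ≠ l →
      (purifiedValue S {i, j} ≤ purifiedValue S {i} + purifiedValue S {j}) ∧
      (purifiedValue S {i, j, k} + purifiedValue S {j} ≤
        purifiedValue S {i, j} + purifiedValue S {j, k}) ∧
      (purifiedValue S {i} + purifiedValue S {j} + purifiedValue S {k, l} +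
          purifiedValue S {i, j, k} + purifiedValue S {i, j, l} ≤
        purifiedValue S {i, j} + purifiedValue S {i, k} + purifiedValue S {i, l} +
          purifiedValue S {j, k} + purifiedValue S {j, l}) := by
  have key : ∀ (σ : Equiv.Perm (Fin 5)),
      (SA.Holds (relabel σ S) ↔ purifiedValue S {σ 0, σ 1} ≤
        purifiedValue S {σ 0} + purifiedValue S {σ 1}) ∧
      (SSA.Holds (relabel σ S) ↔ (purifiedValue S {σ 0, σ 1, σ 2} + purifiedValue S {σ 1} ≤
        purifiedValue S {σ 0, σ 1} + purifiedValue S {σ 1, σ 2})) ∧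
      (Ingleton.Holds (relabel σ S) ↔
      (purifiedValue S {σ 0} + purifiedValue S {σ 1} + purifiedValue S {σ 2, σ 3} +
          purifiedValue S {σ 0, σ 1, σ 2} + purifiedValue S {σ 0, σ 1, σ 3} ≤
        purifiedValue S {σ 0, σ 1} + purifiedValue S {σ 0, σ 2} + purifiedValue S {σ 0, σ 3} +
          purifiedValue S {σ 1, σ 2} + purifiedValue S {σ 1, σ 3})) := by
    intro σ
    simp [SA_holds_iff, SSA_holds_iff, Ingleton_holds_iff, value_relabel, withPurifier,
      Finset.map_insert]
  constructor
  · intro h i j k l hij hik hil hjk hjl hkl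
    obtain ⟨σ, hσ⟩ := exists_perm_of_injective (f := ![i, j, k, l]) (by
      intro x y; fin_cases x <;> fin_cases y <;> simp [*, Ne.symm])
    have h0 : σ 0 = i := hσ 0
    have h1 : σ 1 = j := hσ 1
    have h2 : σ 2 = k := hσ 2
    have h3 : σ 3 = l := hσ 3
    obtain ⟨a, b, c⟩ := key σ
    rw [h0, h1] at a
    rw [h0, h1, h2] at b
    rw [h0, h1, h2, h3] at c
    exact ⟨a.1 (h.1 σ), b.1 (h.2.1 σ), c.1 (h.2.2 σ)⟩
  · intro h
    have hh := fun σ : Equiv.Perm (Fin 5) => h (σ 0) (σ 1) (σ 2) (σ 3) (by simp) (by simp)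
      (by simp) (by simp) (by simp) (by simp)
    exact ⟨fun σ => (key σ).1.2 (hh σ).1, fun σ => (key σ).2.1.2 (hh σ).2.1,
      fun σ => (key σ).2.2.2 (hh σ).2.2⟩

end IngletonCone

/-! ### A refutation procedure for Horn clauses -/

section Refutation

/-- `k n`, arranged so that the kernel evaluates `n` to a numeral first. -/
def forceNat {α : Type} (n : ℕ) (k : ℕ → α) : α :=
  Nat.rec (k 0) (fun m _ => k (Nat.succ m)) n

theorem forceNat_eq {α : Type} (n : ℕ) (k : ℕ → α) : forceNat n k = k n := by
  cases n <;> rfl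

/-- `k l`, arranged so that the kernel evaluates the entries of `l` first. -/
def forcePairs {α : Type} (l : List (ℕ × ℕ)) : (List (ℕ × ℕ) → α) → α :=
  List.rec (fun k => k []) (fun r _ ih k =>
    forceNat r.1 fun a => forceNat r.2 fun b => ih fun l => k ((a, b) :: l)) l

theorem forcePairs_eq {α : Type} (l : List (ℕ × ℕ)) (k : List (ℕ × ℕ) → α) :
    forcePairs l k = k l := by
  induction l generalizing k with
  | nil => rfl
  | cons r l ih =>
    change forceNat r.1 (fun a => forceNat r.2 fun b => forcePairs l fun l => k ((a, b) :: l)) = _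
    simp only [forceNat_eq, ih]

/-- `k l`, arranged so that the kernel evaluates the entries of `l` first. -/
def forceNats {α : Type} (l : List ℕ) : (List ℕ → α) → α :=
  List.rec (fun k => k []) (fun r _ ih k => forceNat r fun a => ih fun l => k (a :: l)) l

theorem forceNats_eq {α : Type} (l : List ℕ) (k : List ℕ → α) : forceNats l k = k l := by
  induction l generalizing k with
  | nil => rfl
  | cons r l ih =>
    change forceNat r (fun a => forceNats l fun l => k (a :: l)) = _
    simp only [forceNat_eq, ih]

/-- The bit mask `n` has at most one bit. -/
def atMostOneBit (n : ℕ) : Bool := Nat.beq (Nat.land n (Nat.pred n)) 0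

/-- One pass of unit propagation for Horn clauses `l ⇒ r`. The atoms outside of `U` are known to be
true, those in `N` are known to be false; a contradiction yields `true`. -/
def applyRules (rules : List (ℕ × ℕ)) (k : ℕ → ℕ → Bool) : ℕ → ℕ → Bool :=
  List.rec k (fun r _ ih U N => Prod.rec (fun l r =>
    cond (Nat.beq (Nat.land r N) 0)
      (cond (Nat.beq (Nat.land l U) 0)
        (cond (Nat.beq (Nat.land r U) 0) (ih U N)
          (forceNat (Nat.xor U (Nat.land r U)) fun U => ih U N))
        (ih U N))
      (cond (Nat.beq (Nat.land l U) 0) true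
        (cond (atMostOneBit (Nat.land l U))
          (forceNat (Nat.lor N (Nat.land l U)) fun N => ih U N)
          (ih U N)))) r) rules

/-- One pass of unit propagation for clauses: every `r ∈ clauses` contains a true atom. -/
def applyClauses (clauses : List ℕ) (k : ℕ → ℕ → Bool) : ℕ → ℕ → Bool :=
  List.rec k (fun r _ ih U N =>
    cond (Nat.beq (Nat.land r U) r)
      (forceNat (Nat.xor r (Nat.land r N)) fun c =>
        cond (Nat.beq c 0) true
          (cond (atMostOneBit c) (forceNat (Nat.xor U (Nat.land U c)) fun U => ih U N) (ih U N)))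
      (ih U N)) clauses

/-- At most `n` passes of unit propagation. -/
def propagate (rules : List (ℕ × ℕ)) (clauses : List ℕ) (k : ℕ → ℕ → Bool) (n : ℕ) :
    ℕ → ℕ → Bool :=
  Nat.rec k (fun _ ih U N => applyRules rules (applyClauses clauses fun U' N' =>
    cond (Nat.beq (Nat.land U' N') N')
      (cond (Nat.beq U U') (cond (Nat.beq N N') (k U N) (ih U' N')) (ih U' N')) true) U N) n

/-- Branch on the lowest possible atom of the first clause without a known true atom. -/
def branch (clauses : List ℕ) (k : ℕ → ℕ → Bool) (U N : ℕ) : Bool :=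
  List.rec false (fun r _ ih => cond (Nat.beq (Nat.land r U) r)
    (forceNat (Nat.xor r (Nat.land r N)) fun c =>
      forceNat (Nat.xor c (Nat.land c (Nat.pred c))) fun h =>
        cond (atMostOneBit h)
          (cond (forceNat (Nat.xor U (Nat.land U h)) fun U => k U N)
            (forceNat (Nat.lor N h) fun N => k U N) false) false) ih) clauses

/-- Search for a refutation of the Horn clauses `rules` and the positive clauses `clauses`. -/
def refute (rules : List (ℕ × ℕ)) (clauses : List ℕ) (n : ℕ) : ℕ → ℕ → Bool :=
  Nat.rec (fun _ _ => false) (fun _ ih U N =>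
    propagate rules clauses (fun U N => branch clauses ih U N) 30 U N) n

variable (T : ℕ → Prop)

/-- All atoms outside of `U` are true and all atoms in `N` are false. -/
def Known (U N : ℕ) : Prop := (∀ c, U.testBit c = false → T c) ∧ ∀ c, N.testBit c → ¬ T c

/-- The procedure `k` answers `true` only for contradictory states. -/
def Sound (k : ℕ → ℕ → Bool) : Prop := ∀ U N, Known T U N → k U N ≠ true

/-- The Horn clause `l ⇒ r`. -/
def HornValid (r : ℕ × ℕ) : Prop := (∀ c, r.1.testBit c → T c) → ∀ c, r.2.testBit c → T c

/-- The clause `r` contains a true atom. -/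
def ClauseValid (r : ℕ) : Prop := ∃ c, r.testBit c ∧ T c

variable {T}

theorem testBit_unique_of_atMostOneBit {n : ℕ} (h : atMostOneBit n = true) {c d : ℕ}
    (hc : n.testBit c) (hd : n.testBit d) : c = d := by
  have hn : n ≠ 0 := by rintro rfl; simp at hc
  have h' : n &&& (n - 1) = 0 := Nat.eq_of_beq_eq_true h
  obtain ⟨k, rfl⟩ := (Nat.and_sub_one_eq_zero_iff_isPowerOfTwo hn).1 h'
  rw [Nat.testBit_two_pow] at hc hd
  simp_all

theorem testBit_of_land_eq_zero {a b c : ℕ} (h : Nat.beq (Nat.land a b) 0 = true)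
    (ha : a.testBit c) : b.testBit c = false := by
  have h' : a &&& b = 0 := Nat.eq_of_beq_eq_true h
  have := congrArg (fun n => Nat.testBit n c) h'
  simpa [Nat.testBit_and, ha] using this

theorem testBit_xor_land (a b c : ℕ) :
    (Nat.xor a (Nat.land a b)).testBit c = (a.testBit c && !b.testBit c) := by
  change (a ^^^ (a &&& b)).testBit c = _
  rw [Nat.testBit_xor, Nat.testBit_and]
  cases a.testBit c <;> simp

theorem Known.diff {U N m : ℕ} (h : Known T U N) (hm : ∀ c, m.testBit c → T c) :
    Known T (Nat.xor U (Nat.land U m)) N := by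
  refine ⟨fun c hc => ?_, h.2⟩
  rw [testBit_xor_land] at hc
  by_cases hmc : m.testBit c = true
  · exact hm c hmc
  · exact h.1 c (by simpa [hmc] using hc)

theorem Known.union {U N m : ℕ} (h : Known T U N) (hm : ∀ c, m.testBit c → ¬ T c) :
    Known T U (Nat.lor N m) := by
  refine ⟨h.1, fun c hc => ?_⟩
  have hc' : (N ||| m).testBit c = true := hc
  rw [Nat.testBit_or, Bool.or_eq_true] at hc'
  exact hc'.elim (h.2 c) (hm c)

theorem Sound.applyRules {rules : List (ℕ × ℕ)} (hr : ∀ r ∈ rules, HornValid T r)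
    {k : ℕ → ℕ → Bool} (hk : Sound T k) : Sound T (applyRules rules k) := by
  induction rules with
  | nil => exact hk
  | cons r rules ih =>
    obtain ⟨l, r⟩ := r
    specialize ih fun r h => hr r (List.mem_cons_of_mem _ h)
    intro U N hs
    have hl : Nat.beq (Nat.land l U) 0 = true → ∀ c, r.testBit c → T c := fun h =>
      hr (l, r) List.mem_cons_self fun c hc => hs.1 c (testBit_of_land_eq_zero h hc)
    change cond (Nat.beq (Nat.land r N) 0)
      (cond (Nat.beq (Nat.land l U) 0)
        (cond (Nat.beq (Nat.land r U) 0) (EntropyCone.applyRules rules k U N)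
          (forceNat (Nat.xor U (Nat.land r U)) fun U => EntropyCone.applyRules rules k U N))
        (EntropyCone.applyRules rules k U N))
      (cond (Nat.beq (Nat.land l U) 0) true
        (cond (atMostOneBit (Nat.land l U))
          (forceNat (Nat.lor N (Nat.land l U)) fun N => EntropyCone.applyRules rules k U N)
          (EntropyCone.applyRules rules k U N))) ≠ true
    simp only [forceNat_eq]
    cases h1 : Nat.beq (Nat.land r N) 0 with
    | true =>
      simp only [cond_true]
      cases h2 : Nat.beq (Nat.land l U) 0 with
      | true =>
        simp only [cond_true]
        cases h3 : Nat.beq (Nat.land r U) 0 with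
        | true => exact ih _ _ hs
        | false =>
          have : Nat.land r U = Nat.land U r := Nat.land_comm r U
          simp only [cond_false]
          rw [this]
          exact ih _ _ (hs.diff (hl h2))
      | false => exact ih _ _ hs
    | false =>
      simp only [cond_false]
      have h1' : ∃ c, r.testBit c ∧ N.testBit c := by
        by_contra hcon
        push Not at hcon
        have : r &&& N = 0 := by
          refine Nat.eq_of_testBit_eq fun c => ?_
          rw [Nat.testBit_and, Nat.zero_testBit]
          by_cases hc : r.testBit c = true
          · simp [hcon c hc]
          · simp [hc]
        have h1'' : Nat.beq (r &&& N) 0 = false := h1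
        rw [this] at h1''
        exact absurd h1'' (by decide)
      obtain ⟨d, hd, hdN⟩ := h1'
      cases h2 : Nat.beq (Nat.land l U) 0 with
      | true => exact fun _ => hs.2 d hdN (hl h2 d hd)
      | false =>
        simp only [cond_false]
        cases h3 : atMostOneBit (Nat.land l U) with
        | true =>
          -- Exactly one atom of `l` is not known to be true. If it were true, the clause would make
          -- `d` true, although `d` is known to be false; so it is false.
          refine ih _ _ (hs.union fun c hc hT => hs.2 d hdN ?_)
          refine hr (l, r) List.mem_cons_self (fun e he => ?_) d hd
          by_cases heU : U.testBit e = true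
          · have : (Nat.land l U).testBit e := by
              change (l &&& U).testBit e = true
              rw [Nat.testBit_and, heU, Bool.and_true]; exact he
            rwa [testBit_unique_of_atMostOneBit h3 this hc]
          · exact hs.1 e (by simpa using heU)
        | false => exact ih _ _ hs

theorem Sound.applyClauses {clauses : List ℕ} (hr : ∀ r ∈ clauses, ClauseValid T r)
    {k : ℕ → ℕ → Bool} (hk : Sound T k) : Sound T (applyClauses clauses k) := by
  induction clauses with
  | nil => exact hk
  | cons r clauses ih =>
    specialize ih fun r h => hr r (List.mem_cons_of_mem _ h)
    intro U N hs
    change cond (Nat.beq (Nat.land r U) r)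
      (forceNat (Nat.xor r (Nat.land r N)) fun c =>
        cond (Nat.beq c 0) true
          (cond (atMostOneBit c)
            (forceNat (Nat.xor U (Nat.land U c)) fun U => EntropyCone.applyClauses clauses k U N)
            (EntropyCone.applyClauses clauses k U N)))
      (EntropyCone.applyClauses clauses k U N) ≠ true
    simp only [forceNat_eq]
    obtain ⟨d, hd, hdT⟩ := hr r List.mem_cons_self
    have hdN : (Nat.xor r (Nat.land r N)).testBit d = true := by
      rw [testBit_xor_land]
      have : ¬ N.testBit d = true := fun h => hs.2 d h hdT
      simp [hd, this]
    cases h1 : Nat.beq (Nat.land r U) r with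
    | false => exact ih _ _ hs
    | true =>
      simp only [cond_true]
      cases h2 : Nat.beq (Nat.xor r (Nat.land r N)) 0 with
      | true =>
        rw [Nat.eq_of_beq_eq_true h2] at hdN
        simp at hdN
      | false =>
        simp only [cond_false]
        cases h3 : atMostOneBit (Nat.xor r (Nat.land r N)) with
        | false => exact ih _ _ hs
        | true =>
          refine ih _ _ (hs.diff fun c hc => ?_)
          rwa [testBit_unique_of_atMostOneBit h3 hc hdN]

theorem Sound.propagate {rules : List (ℕ × ℕ)} (hr : ∀ r ∈ rules, HornValid T r)
    {clauses : List ℕ} (hc : ∀ r ∈ clauses, ClauseValid T r)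
    {k : ℕ → ℕ → Bool} (hk : Sound T k) (n : ℕ) : Sound T (propagate rules clauses k n) := by
  induction n with
  | zero => exact hk
  | succ n ih =>
    intro U N hs
    refine Sound.applyRules hr (Sound.applyClauses hc ?_) U N hs
    intro U' N' hs'
    change cond (Nat.beq (Nat.land U' N') N')
      (cond (Nat.beq U U') (cond (Nat.beq N N') (k U N)
        (EntropyCone.propagate rules clauses k n U' N'))
        (EntropyCone.propagate rules clauses k n U' N')) true ≠ true
    cases h1 : Nat.beq (Nat.land U' N') N' with
    | false =>
      refine absurd ?_ (Bool.eq_false_iff.1 h1)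
      -- In a consistent state no false atom is known to be true, that is, N' is contained in U';
      -- failure of this test is a contradiction.
      have : U' &&& N' = N' := by
        refine Nat.eq_of_testBit_eq fun c => ?_
        rw [Nat.testBit_and]
        by_cases hN : N'.testBit c = true
        · by_cases hU : U'.testBit c = true
          · simp [hU]
          · exact absurd (hs'.1 c (by simpa using hU)) (hs'.2 c hN)
        · simp [hN]
      exact Nat.beq_eq ▸ this
    | true =>
      simp only [cond_true]
      cases Nat.beq U U' with
      | false => exact ih _ _ hs'
      | true => cases Nat.beq N N' with
        | false => exact ih _ _ hs'
        | true => exact hk _ _ hs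

theorem Sound.branch (clauses : List ℕ) {k : ℕ → ℕ → Bool} (hk : Sound T k) :
    Sound T (branch clauses k) := by
  intro U N hs
  induction clauses with
  | nil => exact Bool.false_ne_true
  | cons r clauses ih =>
    change cond (Nat.beq (Nat.land r U) r)
      (forceNat (Nat.xor r (Nat.land r N)) fun c =>
        forceNat (Nat.xor c (Nat.land c (Nat.pred c))) fun h =>
          cond (atMostOneBit h)
            (cond (forceNat (Nat.xor U (Nat.land U h)) fun U => k U N)
              (forceNat (Nat.lor N h) fun N => k U N) false) false)
      (EntropyCone.branch clauses k U N) ≠ true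
    simp only [forceNat_eq]
    -- Which atom is chosen is irrelevant to soundness: all that matters is that the mask has at
    -- most one bit, so that its atom is either true or false.
    generalize Nat.xor (Nat.xor r (Nat.land r N)) (Nat.land (Nat.xor r (Nat.land r N))
      (Nat.pred (Nat.xor r (Nat.land r N)))) = h
    cases Nat.beq (Nat.land r U) r with
    | false => exact ih
    | true =>
      simp only [cond_true]
      cases h1 : atMostOneBit h with
      | false => exact Bool.false_ne_true
      | true =>
        simp only [cond_true]
        by_cases hT : ∀ c, h.testBit c → T c
        · rw [Bool.eq_false_iff.2 (hk _ _ (hs.diff hT))]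
          exact Bool.false_ne_true
        · push Not at hT
          obtain ⟨c, hc, hTc⟩ := hT
          have := hk _ _ (hs.union (m := h) fun d hd => by
            rwa [testBit_unique_of_atMostOneBit h1 hd hc])
          rw [Bool.eq_false_iff.2 this]
          cases k (Nat.xor U (Nat.land U h)) N <;> exact Bool.false_ne_true

/-- The answer `true` certifies inconsistency. The bounds on passes and depth only limit
completeness: when the passes run out the search moves on to branching, and when the depth runs out
the answer is `false`. -/
theorem Sound.refute {rules : List (ℕ × ℕ)} (hr : ∀ r ∈ rules, HornValid T r)
    {clauses : List ℕ} (hc : ∀ r ∈ clauses, ClauseValid T r) (n : ℕ) :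
    Sound T (refute rules clauses n) := by
  induction n with
  | zero => exact fun _ _ _ => Bool.false_ne_true
  | succ n ih => exact Sound.propagate hr hc (Sound.branch clauses ih) 30

end Refutation

/-! ### Numerical encoding of facets and rays

A set of parties of the purified system is encoded by a bit mask below `32`; masks that contain
the purifier are replaced by those of their complements. -/

section Encoding

/-- The mask of the complement for masks that contain the purifier. -/
def canonMask (k : ℕ) : ℕ := cond (Nat.ble 16 k) (Nat.sub 31 k) k

/-- The two parties with a given index. -/
def pairParties (c : ℕ) : ℕ × ℕ :=
  [(0, 1), (0, 2), (1, 2), (0, 3), (1, 3), (2, 3), (0, 4), (1, 4), (2, 4), (3, 4)].getD c (0, 0)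

/-- The index of a pair of parties. -/
def pairCode (i j : ℕ) : ℕ :=
  cond (Nat.blt i j) (Nat.add (Nat.div (Nat.mul j (Nat.pred j)) 2) i)
    (Nat.add (Nat.div (Nat.mul i (Nat.pred i)) 2) j)

/-- The parties different from `i` and `j`. -/
def otherParties (i j : ℕ) : List ℕ :=
  [0, 1, 2, 3, 4].filter fun k => !(Nat.beq i k || Nat.beq j k)

/-- The position of `k` among the parties different from `i` and `j`. -/
def otherRank (i j k : ℕ) : ℕ :=
  Nat.sub (Nat.sub k (cond (Nat.blt i k) 1 0)) (cond (Nat.blt j k) 1 0)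

/-- The index of the facet `I(i : j) ≥ 0`. -/
def saCode (i j : ℕ) : ℕ := pairCode i j

/-- The index of the facet `I(i : j | k) ≥ 0`. -/
def ssaCode (i j k : ℕ) : ℕ :=
  Nat.add 10 (Nat.add (Nat.mul 3 (pairCode i j)) (otherRank i j k))

/-- The index of the facet `I(i : j | k) + I(i : j | l) + I(k : l) - I(i : j) ≥ 0`. -/
def ingCode (i j k l : ℕ) : ℕ :=
  Nat.add 40 (Nat.add (Nat.mul 3 (pairCode i j))
    (otherRank i j (Nat.sub 10 (Nat.add (Nat.add i j) (Nat.add k l)))))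

/-- The mask of a set of one party. -/
def mask1 (i : ℕ) : ℕ := Nat.shiftLeft 1 i

/-- The mask of a set of two parties. -/
def mask2 (i j : ℕ) : ℕ := Nat.lor (mask1 i) (mask1 j)

/-- The mask of a set of three parties. -/
def mask3 (i j k : ℕ) : ℕ := Nat.lor (mask2 i j) (mask1 k)

/-- The masks with positive and with negative coefficients in `I(i : j)`. -/
def saMasks (i j : ℕ) : List ℕ × List ℕ := ([mask1 i, mask1 j], [mask2 i j])

/-- The masks with positive and with negative coefficients in `I(i : j | k)`. -/
def ssaMasks (i j k : ℕ) : List ℕ × List ℕ := ([mask2 i k, mask2 j k], [mask3 i j k, mask1 k])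

/-- The masks with positive and with negative coefficients in Ingleton's expression. -/
def ingMasks (i j k l : ℕ) : List ℕ × List ℕ :=
  ([mask2 i j, mask2 i k, mask2 i l, mask2 j k, mask2 j l],
   [mask1 i, mask1 j, mask2 k l, mask3 i j k, mask3 i j l])

/-- The parties that occur in the facet with index `c`, in order, and one more party. -/
def facetParties (c : ℕ) : ℕ × ℕ × ℕ × ℕ :=
  let e := cond (Nat.blt c 10) (Nat.mul 3 c) (cond (Nat.blt c 40) (Nat.sub c 10) (Nat.sub c 40))
  let p := pairParties (Nat.div e 3)
  let o := otherParties p.1 p.2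
  let r := Nat.mod e 3
  let q := o.eraseIdx r
  cond (Nat.blt c 40) (p.1, p.2, o.getD r 0, q.getD 0 0) (p.1, p.2, q.getD 0 0, q.getD 1 0)

/-- The masks with positive and with negative coefficients in the facet with index `c`. -/
def facetMasks (c : ℕ) : List ℕ × List ℕ :=
  let p := facetParties c
  cond (Nat.blt c 10) (saMasks p.1 p.2.1)
    (cond (Nat.blt c 40) (ssaMasks p.1 p.2.1 p.2.2.1) (ingMasks p.1 p.2.1 p.2.2.1 p.2.2.2))

/-- The masks of the facet with index `c`, in canonical form. -/
def facet (c : ℕ) : List ℕ × List ℕ :=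
  ((facetMasks c).1.map canonMask, (facetMasks c).2.map canonMask)

/-- The concatenation of the lists `f a b c d e`, for all orderings of the five parties. -/
def forOrderings {α : Type} (f : ℕ → ℕ → ℕ → ℕ → ℕ → List α) : List α :=
  let P := [0, 1, 2, 3, 4]
  P.flatMap fun a => P.flatMap fun b => bif Nat.beq a b then [] else
  P.flatMap fun c => bif Nat.beq a c || Nat.beq b c then [] else
  P.flatMap fun d => bif Nat.beq a d || (Nat.beq b d || Nat.beq c d) then [] else
  P.flatMap fun e => bif Nat.beq a e || (Nat.beq b e || (Nat.beq c e || Nat.beq d e)) then []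
    else f a b c d e

/-- Pairs of lists of facets with equal sums. -/
def identitiesOf (a b c d e : ℕ) : List (List ℕ × List ℕ) :=
  (bif Nat.blt d e then
    [([saCode a b, ssaCode a c b], [saCode a c, ssaCode a b c])] else []) ++
  ((bif Nat.blt b d then
    [([ssaCode a c b, ssaCode a e d], [ssaCode a e b, ssaCode a c d])] else []) ++
  ((bif Nat.blt a b && Nat.blt c d then
    [([saCode a b, ingCode a b c d], [saCode c d, ssaCode a b c, ssaCode a b d])] else []) ++
  ((bif Nat.blt a c && Nat.blt d e then
    [([ssaCode a c b, ingCode d e a c], [ssaCode a c d, ssaCode a c e, ssaCode d e b])] else []) ++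
  ((bif Nat.blt c d then
    [([ingCode a b c d, ingCode c d a e], [ssaCode a e b, ssaCode c d a, ingCode c d a b])]
    else []) ++
   [([ssaCode a c b, ingCode b d a e], [ssaCode a e b, ingCode b d a c]),
    ([saCode a b, ssaCode a d c, ssaCode c d b], [saCode a d, ingCode c d a b]),
    ([saCode a b, ingCode a c b d], [saCode b d, ssaCode a b c, ssaCode a c d]),
    ([ssaCode a c b, ingCode a d b c], [ssaCode a d b, ssaCode a c d, ssaCode b c a]),
    ([ssaCode a c b, ingCode a d b e], [ssaCode a d b, ssaCode a c d, ssaCode b e a]),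
    ([ssaCode a c b, ingCode a d c e], [ssaCode a d b, ssaCode a c d, ssaCode c e a]),
    ([ingCode a b c d, ingCode c e a d], [ssaCode a d b, ssaCode c d a, ingCode c e a b]),
    ([saCode a b, ssaCode a d c, ssaCode c e b], [saCode a d, ssaCode a b c, ssaCode c e d])]))))

/-- Identities between sums of facets. -/
def identities : List (List ℕ × List ℕ) := forOrderings identitiesOf

/-- Whether the facets in `r.1` and those in `r.2` have the same sum. -/
def isIdentity (r : List ℕ × List ℕ) : Bool :=
  (r.1 ++ r.2).all (fun c => Nat.blt c 70) && List.isPerm (r.1.flatMap (fun c => (facet c).1) ++ r.2.flatMap (fun c => (facet c).2))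
    (r.2.flatMap (fun c => (facet c).1) ++ r.1.flatMap (fun c => (facet c).2))

/-- The digit of `v` in base 16 at place `m`. -/
def digit (v m : ℕ) : ℕ := Nat.land (Nat.shiftRight v (Nat.mul 4 m)) 15

/-- The entropy vectors of seven hypergraphs, with the entropy of the mask `m` as the digit at
place `m`: the Bell pair, the four-party GHZ state, the five-party GHZ state, two rays with two
special parties and two stars. -/
def baseRay : ℕ → ℕ
  | 0 => 0x0110011001100110
  | 1 => 0x1111111111111100
  | 2 => 0x1111111111111110
  | 3 => 0x1222222122212220
  | 4 => 0x1322223122313120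
  | 5 => 0x1122221122111100
  | _ => 0x2332233223322110

/-- The image of the mask `m` under the map of parties with values `a, b, c, d, e`. -/
def permMask (a b c d e m : ℕ) : ℕ :=
  Nat.lor (cond (Nat.testBit m 0) (mask1 a) 0) (Nat.lor (cond (Nat.testBit m 1) (mask1 b) 0)
    (Nat.lor (cond (Nat.testBit m 2) (mask1 c) 0) (Nat.lor (cond (Nat.testBit m 3) (mask1 d) 0)
      (cond (Nat.testBit m 4) (mask1 e) 0))))

/-- The digits of a ray after the relabelling of parties with values `a, b, c, d, e`. -/
def permRay (a b c d e v : ℕ) : ℕ :=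
  (List.range 16).foldr (fun m s => Nat.lor s
    (Nat.shiftLeft (digit v m) (Nat.mul 4 (canonMask (permMask a b c d e m))))) 0

/-- The relabellings that produce the orbit of the `k`-th ray. -/
def orderingsFor (k : ℕ) : List (ℕ × ℕ × ℕ × ℕ × ℕ) :=
  forOrderings fun a b c d e =>
    bif Nat.blt c d && (Nat.blt d e &&
      (bif Nat.beq k 0 || (Nat.beq k 3 || Nat.beq k 6) then Nat.blt a b
        else Nat.blt b c && (Nat.beq a 0 || !Nat.beq k 2)))
    then [(a, b, c, d, e)] else []

/-- All rays, each with its base ray and a relabelling. -/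
def rayData : List (ℕ × (ℕ × ℕ × ℕ × ℕ × ℕ) × ℕ) :=
  (List.range 7).flatMap fun k => (orderingsFor k).map fun t =>
    (k, t, permRay t.1 t.2.1 t.2.2.1 t.2.2.2.1 t.2.2.2.2 (baseRay k))

/-- The sum of the digits of `v` at the places in `l`. -/
def digitSum (v : ℕ) (l : List ℕ) : ℕ := l.foldr (fun m s => Nat.add (digit v m) s) 0

/-- The bit mask of a list of numbers. -/
def maskOf (l : List ℕ) : ℕ := l.foldr (fun c m => Nat.lor m (Nat.shiftLeft 1 c)) 0

/-- The facets that are not tight at the ray `v`. -/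
def slackFacets (v : ℕ) : List ℕ :=
  (List.range 70).filter fun c => Nat.blt (digitSum v (facet c).2) (digitSum v (facet c).1)

/-- The ray `v` satisfies all facets. -/
def isFeasible (v : ℕ) : Bool :=
  (List.range 70).all fun c => Nat.ble (digitSum v (facet c).2) (digitSum v (facet c).1)

/-- The Horn clauses from the identities, and the clause that not all facets are tight. -/
def hornClauses : List (ℕ × ℕ) :=
  (maskOf (List.range 70), maskOf [70]) :: identities.map fun r => (maskOf r.1, maskOf r.2)

/-- The positive clauses from the rays. -/
def rayClauses : List ℕ := rayData.map fun r => maskOf (slackFacets r.2.2)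

/-- There is no nonzero face with `I(0 : 1) = 0` which contains none of the rays. -/
def checkFaces : Bool :=
  forcePairs hornClauses fun R => forceNats rayClauses fun V =>
    forceNat (maskOf ((List.range 71).drop 1)) fun U => forceNat (maskOf [70]) fun N =>
      refute R V 1000 U N

/-- All identities are valid, all rays satisfy all facets, and `checkFaces`. -/
def checkAll : Bool :=
  identities.all isIdentity && (rayData.all (fun r => isFeasible r.2.2) && checkFaces)

/-- The computational core of the generation theorem, evaluated by the kernel. It replaces an
enumeration of the extreme rays by a refutation of a set of clauses. -/
theorem checkAll_eq_true : checkAll = true := by decide +kernel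

end Encoding
-- From masks and codes to real inequalities
section Encoding

/-- The set of parties with mask `m`. -/
def partySet (m : ℕ) : Finset (Fin 5) := Finset.univ.filter fun i => m.testBit i

/-- The mask of a set of parties. -/
def maskOfSet (K : Finset (Fin 5)) : ℕ := ∑ i ∈ K, 2 ^ (i : ℕ)

theorem partySet_canonMask {m : ℕ} (hm : m < 32) :
    partySet (canonMask m) = partySet m ∨ partySet (canonMask m) = (partySet m)ᶜ := by
  revert m; decide +kernel

theorem canonMask_maskOfSet_compl : ∀ K : Finset (Fin 5),
    canonMask (maskOfSet Kᶜ) = canonMask (maskOfSet K) := by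
  decide +kernel

theorem maskOfSet_partySet {m : ℕ} (hm : m < 32) : maskOfSet (partySet m) = m := by
  revert m; decide +kernel

theorem canonMask_maskOfSet_withPurifier : ∀ I : Finset (Fin 4),
    canonMask (maskOfSet (withPurifier I)) = maskOfSet (withPurifier I) := by
  decide +kernel

theorem partySet_mask1 : ∀ i : Fin 5, partySet (mask1 i) = {i} := by decide +kernel

theorem partySet_mask2 : ∀ i j : Fin 5, partySet (mask2 i j) = {i, j} := by decide +kernel

theorem partySet_mask3 : ∀ i j k : Fin 5, partySet (mask3 i j k) = {i, j, k} := by decide +kernel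

theorem facetMasks_lt {c : ℕ} (hc : c < 70) :
    (∀ m ∈ (facetMasks c).1, m < 32) ∧ ∀ m ∈ (facetMasks c).2, m < 32 := by
  revert c; decide +kernel

theorem facetParties_distinct {c : ℕ} (hc : c < 70) : ∃ i j k l : Fin 5,
    facetParties c = (↑i, ↑j, ↑k, ↑l) ∧
    i ≠ j ∧ i ≠ k ∧ i ≠ l ∧ j ≠ k ∧ j ≠ l ∧ k ≠ l := by
  have key : ∀ c < 70, (facetParties c).1 < 5 ∧ (facetParties c).2.1 < 5 ∧
      (facetParties c).2.2.1 < 5 ∧ (facetParties c).2.2.2 < 5 ∧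
      (facetParties c).1 ≠ (facetParties c).2.1 ∧ (facetParties c).1 ≠ (facetParties c).2.2.1 ∧
      (facetParties c).1 ≠ (facetParties c).2.2.2 ∧
      (facetParties c).2.1 ≠ (facetParties c).2.2.1 ∧
      (facetParties c).2.1 ≠ (facetParties c).2.2.2 ∧
      (facetParties c).2.2.1 ≠ (facetParties c).2.2.2 := by
    decide +kernel
  obtain ⟨h1, h2, h3, h4, h⟩ := key c hc
  exact ⟨⟨_, h1⟩, ⟨_, h2⟩, ⟨_, h3⟩, ⟨_, h4⟩, rfl, by simpa [Fin.ext_iff] using h⟩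

/-- Codes are symmetric in the first two parties (and Ingleton codes also in the last two), whereas
the mask lists are not; hence agreement only up to reordering. -/
theorem facetMasks_code : ∀ i j k l : Fin 5, [i, j, k, l].Nodup →
    (saCode i j < 70 ∧ List.isPerm (facetMasks (saCode i j)).1 (saMasks i j).1 ∧
      List.isPerm (facetMasks (saCode i j)).2 (saMasks i j).2) ∧
    (ssaCode i j k < 70 ∧ List.isPerm (facetMasks (ssaCode i j k)).1 (ssaMasks i j k).1 ∧
      List.isPerm (facetMasks (ssaCode i j k)).2 (ssaMasks i j k).2) ∧
    (ingCode i j k l < 70 ∧ List.isPerm (facetMasks (ingCode i j k l)).1 (ingMasks i j k l).1 ∧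
      List.isPerm (facetMasks (ingCode i j k l)).2 (ingMasks i j k l).2) := by
  decide +kernel

/-- The entropy of the set of parties with mask `m`. -/
noncomputable def maskValue (S : EntropyVector 4) (m : ℕ) : ℝ := purifiedValue S (partySet m)

theorem maskValue_canonMask (S : EntropyVector 4) {m : ℕ} (hm : m < 32) :
    maskValue S (canonMask m) = maskValue S m := by
  unfold maskValue
  rcases partySet_canonMask hm with h | h <;> rw [h]
  rw [purifiedValue_compl]

/-- The difference of the sums of `P` over two lists. -/
noncomputable def listGap (P : ℕ → ℝ) (f : List ℕ × List ℕ) : ℝ :=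
  (f.1.map P).sum - (f.2.map P).sum

/-- The value of the facet with index `c`. -/
noncomputable def facetValue (S : EntropyVector 4) (c : ℕ) : ℝ := listGap (maskValue S) (facet c)

theorem map_canonMask_eq (S : EntropyVector 4) {l : List ℕ} (h : ∀ m ∈ l, m < 32) :
    (l.map canonMask).map (maskValue S) = l.map (maskValue S) := by
  rw [List.map_map]
  exact List.map_congr_left fun m hm => maskValue_canonMask S (h m hm)

theorem facetValue_eq (S : EntropyVector 4) {c : ℕ} (hc : c < 70) :
    facetValue S c = listGap (maskValue S) (facetMasks c) := by
  simp only [facetValue, listGap, facet, map_canonMask_eq S (facetMasks_lt hc).1,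
    map_canonMask_eq S (facetMasks_lt hc).2]

theorem listGap_saMasks (S : EntropyVector 4) (i j : Fin 5) :
    listGap (maskValue S) (saMasks i j) =
      purifiedValue S {i} + purifiedValue S {j} - purifiedValue S {i, j} := by
  simp [listGap, saMasks, maskValue, partySet_mask1, partySet_mask2]

theorem listGap_ssaMasks (S : EntropyVector 4) (i j k : Fin 5) :
    listGap (maskValue S) (ssaMasks i j k) =
      purifiedValue S {i, k} + purifiedValue S {j, k} -
        (purifiedValue S {i, j, k} + purifiedValue S {k}) := by
  simp [listGap, ssaMasks, maskValue, partySet_mask1, partySet_mask2, partySet_mask3]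

theorem listGap_ingMasks (S : EntropyVector 4) (i j k l : Fin 5) :
    listGap (maskValue S) (ingMasks i j k l) =
      purifiedValue S {i, j} + purifiedValue S {i, k} + purifiedValue S {i, l} +
          purifiedValue S {j, k} + purifiedValue S {j, l} -
        (purifiedValue S {i} + purifiedValue S {j} + purifiedValue S {k, l} +
          purifiedValue S {i, j, k} + purifiedValue S {i, j, l}) := by
  simp [listGap, ingMasks, maskValue, partySet_mask1, partySet_mask2, partySet_mask3, add_assoc]

theorem listGap_congr (P : ℕ → ℝ) {f g : List ℕ × List ℕ} (h1 : List.isPerm f.1 g.1)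
    (h2 : List.isPerm f.2 g.2) : listGap P f = listGap P g := by
  unfold listGap
  rw [((List.isPerm_iff.1 h1).map P).sum_eq, ((List.isPerm_iff.1 h2).map P).sum_eq]

theorem facetValue_saCode (S : EntropyVector 4) {i j : Fin 5} (hij : i ≠ j) :
    saCode i j < 70 ∧ facetValue S (saCode i j) =
      purifiedValue S {i} + purifiedValue S {j} - purifiedValue S {i, j} := by
  obtain ⟨k, l, h⟩ : ∃ k l : Fin 5, i ≠ k ∧ i ≠ l ∧ j ≠ k ∧ j ≠ l ∧ k ≠ l := by
    revert i j; decide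
  obtain ⟨⟨h0, h1, h2⟩, -⟩ := facetMasks_code i j k l (by simp [*])
  exact ⟨h0, by rw [facetValue_eq S h0, listGap_congr _ h1 h2, listGap_saMasks]⟩

theorem facetValue_ssaCode (S : EntropyVector 4) {i j k : Fin 5} (hij : i ≠ j) (hik : i ≠ k)
    (hjk : j ≠ k) : ssaCode i j k < 70 ∧ facetValue S (ssaCode i j k) =
      purifiedValue S {i, k} + purifiedValue S {j, k} -
        (purifiedValue S {i, j, k} + purifiedValue S {k}) := by
  obtain ⟨l, h⟩ : ∃ l : Fin 5, i ≠ l ∧ j ≠ l ∧ k ≠ l := by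
    revert i j k; decide
  obtain ⟨-, ⟨h0, h1, h2⟩, -⟩ := facetMasks_code i j k l (by simp [*])
  exact ⟨h0, by rw [facetValue_eq S h0, listGap_congr _ h1 h2, listGap_ssaMasks]⟩

theorem mem_ingletonCone_iff_facetValue {S : EntropyVector 4} :
    S ∈ ingletonCone ↔ ∀ c < 70, 0 ≤ facetValue S c := by
  rw [mem_ingletonCone_iff]
  constructor
  · intro h c hc
    obtain ⟨i, j, k, l, hp, h1, h2, h3, h4, h5, h6⟩ := facetParties_distinct hc
    obtain ⟨a, -, b⟩ := h i j k l h1 h2 h3 h4 h5 h6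
    -- SSA is stated with the conditioning party in the middle, the facet codes put it last; hence
    -- the exchange of `j` and `k`.
    have d := (h i k j l h2 h1 h3 h4.symm h6 h5).2.1
    rw [facetValue_eq S hc, facetMasks, hp]
    dsimp only
    cases Nat.blt c 10
    · cases Nat.blt c 40
      · simp only [cond_false, listGap_ingMasks]; linarith
      · simp only [cond_false, cond_true, listGap_ssaMasks]
        rw [Finset.pair_comm k j] at d
        linarith
    · simp only [cond_true, listGap_saMasks]; linarith
  · intro h i j k l h1 h2 h3 h4 h5 h6
    obtain ⟨a0, a⟩ := facetValue_saCode S h1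
    obtain ⟨b0, b⟩ := facetValue_ssaCode S h2 h1 h4.symm
    obtain ⟨-, -, ⟨c0, c1, c2⟩⟩ := facetMasks_code i j k l (by simp [*])
    have c := h _ c0
    rw [facetValue_eq S c0, listGap_congr _ c1 c2, listGap_ingMasks] at c
    have a' := h _ a0
    have b' := h _ b0
    rw [a] at a'
    rw [b, Finset.pair_comm k j] at b'
    exact ⟨by linarith, by linarith, by linarith⟩

@[simp] theorem facetValue_add (S T : EntropyVector 4) (c : ℕ) :
    facetValue (S + T) c = facetValue S c + facetValue T c := by
  have (l : List ℕ) : (l.map (maskValue (S + T))).sum =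
      (l.map (maskValue S)).sum + (l.map (maskValue T)).sum := by
    rw [← List.sum_map_add]
    exact congrArg List.sum (List.map_congr_left fun m _ => purifiedValue_add S T _)
  simp only [facetValue, listGap, this]; ring

@[simp] theorem facetValue_smul (a : ℝ) (S : EntropyVector 4) (c : ℕ) :
    facetValue (a • S) c = a * facetValue S c := by
  have (l : List ℕ) : (l.map (maskValue (a • S))).sum = a * (l.map (maskValue S)).sum := by
    rw [← List.sum_map_mul_left]
    exact congrArg List.sum (List.map_congr_left fun m _ => purifiedValue_smul a S _)
  simp only [facetValue, listGap, this]; ring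

/-- The cone is pointed. If all mutual and conditional informations vanish, entropies are additive
on sets of up to three parties. Purity then equates the sum over a pair with the sum over the
complementary triple, and five such equations force all one-party entropies to be zero. -/
theorem eq_zero_of_facetValue_eq_zero {S : EntropyVector 4} (h : ∀ c < 70, facetValue S c = 0) :
    S = 0 := by
  have h2 : ∀ {i j : Fin 5}, i ≠ j →
      purifiedValue S {i, j} = purifiedValue S {i} + purifiedValue S {j} := fun {i j} hij => by
    obtain ⟨a0, a⟩ := facetValue_saCode S hij
    linarith [h _ a0]
  have h3 : ∀ {i j k : Fin 5}, i ≠ j → i ≠ k → j ≠ k → purifiedValue S {i, j, k} =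
      purifiedValue S {i} + purifiedValue S {j} + purifiedValue S {k} :=
    fun {i j k} hij hik hjk => by
      obtain ⟨a0, a⟩ := facetValue_ssaCode S hij hik hjk
      linarith [h _ a0, h2 hik, h2 hjk]
  have hc : ∀ K L : Finset (Fin 5), L = Kᶜ → purifiedValue S L = purifiedValue S K := by
    rintro K L rfl; exact purifiedValue_compl S K
  have h1 : ∀ i : Fin 5, purifiedValue S {i} = 0 := by
    have e1 := hc {0, 1} {2, 3, 4} (by decide)
    have e2 := hc {0, 2} {1, 3, 4} (by decide)
    have e3 := hc {0, 3} {1, 2, 4} (by decide)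
    have e4 := hc {0, 4} {1, 2, 3} (by decide)
    have e5 := hc {1, 2} {0, 3, 4} (by decide)
    rw [h2 (by decide), h3 (by decide) (by decide) (by decide)] at e1 e2 e3 e4 e5
    intro i; fin_cases i <;> simp <;> linarith
  funext I
  rw [← value_coe S I, ← purifiedValue_withPurifier, Pi.zero_apply]
  generalize withPurifier I.1 = K
  have cases5 : ∀ K : Finset (Fin 5), (∃ i, K = {i}) ∨ (∃ i, K = {i}ᶜ) ∨ (∃ i j, i ≠ j ∧ K = {i, j}) ∨
      (∃ i j, i ≠ j ∧ K = {i, j}ᶜ) ∨ K = ∅ ∨ K = ∅ᶜ := by decide +kernel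
  have h0 : purifiedValue S ∅ = 0 := by simp [purifiedValue, withoutPurifier]
  rcases cases5 K with ⟨i, rfl⟩ | ⟨i, rfl⟩ | ⟨i, j, hij, rfl⟩ | ⟨i, j, hij, rfl⟩ | rfl | rfl
  · exact h1 i
  · rw [purifiedValue_compl, h1]
  · rw [h2 hij, h1, h1, add_zero]
  · rw [purifiedValue_compl, h2 hij, h1, h1, add_zero]
  · exact h0
  · rw [purifiedValue_compl, h0]

end Encoding

/-! ### Generators of the cone -/

section Rays

/-- The entropy vector with the given digits. -/
noncomputable def vectorOf (v : ℕ) : EntropyVector 4 :=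
  fun I => (digit v (maskOfSet (withPurifier I.1)) : ℝ)

/-- The orbits of the seven base rays. -/
noncomputable def ray (k : Fin 7 × Equiv.Perm (Fin 5)) : EntropyVector 4 :=
  relabel k.2 (vectorOf (baseRay k.1))

theorem purifiedValue_vectorOf {v : ℕ} (hv : digit v 0 = 0) (K : Finset (Fin 5)) :
    purifiedValue (vectorOf v) K = digit v (canonMask (maskOfSet K)) := by
  refine purifiedValue_eq_of_value (p := fun K => (digit v (canonMask (maskOfSet K)) : ℝ))
    ?_ (fun K => ?_) (fun I => ?_) K
  · rw [show canonMask (maskOfSet ∅) = 0 by decide, hv, Nat.cast_zero]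
  · rw [canonMask_maskOfSet_compl]
  · rw [canonMask_maskOfSet_withPurifier]; rfl

theorem maskValue_vectorOf {v : ℕ} (hv : digit v 0 = 0) {m : ℕ} (hm : m < 32) :
    maskValue (vectorOf v) m = digit v (canonMask m) := by
  rw [maskValue, purifiedValue_vectorOf hv, maskOfSet_partySet hm]

theorem sum_digits (v : ℕ) (l : List ℕ) :
    (l.map fun m => (digit v m : ℝ)).sum = digitSum v l := by
  induction l with
  | nil => simp [digitSum]
  | cons m l ih =>
    rw [List.map_cons, List.sum_cons, ih]
    exact (Nat.cast_add _ _).symm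

theorem facetValue_vectorOf {v : ℕ} (hv : digit v 0 = 0) {c : ℕ} (hc : c < 70) :
    facetValue (vectorOf v) c = digitSum v (facet c).1 - digitSum v (facet c).2 := by
  have (l : List ℕ) (hl : ∀ m ∈ l, m < 32) :
      (l.map (maskValue (vectorOf v))).sum = digitSum v (l.map canonMask) := by
    rw [← sum_digits, List.map_map]
    exact congrArg List.sum (List.map_congr_left fun m hm => maskValue_vectorOf hv (hl m hm))
  rw [facetValue_eq _ hc, listGap, this _ (facetMasks_lt hc).1, this _ (facetMasks_lt hc).2]
  rfl

theorem digit_rayData : ∀ r ∈ rayData, digit r.2.2 0 = 0 := by decide +kernel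

theorem digit_baseRay : ∀ k : Fin 7, digit (baseRay k) 0 = 0 := by decide

/-- The map of parties with the given values. -/
def tupleMap (t : ℕ × ℕ × ℕ × ℕ × ℕ) : Fin 5 → Fin 5 :=
  ![Fin.ofNat 5 t.1, Fin.ofNat 5 t.2.1, Fin.ofNat 5 t.2.2.1, Fin.ofNat 5 t.2.2.2.1,
    Fin.ofNat 5 t.2.2.2.2]

theorem tupleMap_injective : ∀ r ∈ rayData, Function.Injective (tupleMap r.2.1) := by
  decide +kernel

theorem digit_tupleMap : ∀ r ∈ rayData, r.1 < 7 ∧ ∀ I : Finset (Fin 4),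
    digit r.2.2 (canonMask (maskOfSet ((withPurifier I).image (tupleMap r.2.1)))) =
      digit (baseRay r.1) (maskOfSet (withPurifier I)) := by
  decide +kernel

/-- Ties the tabulated digits, which feed the search, to the orbits. The table is checked by pulling
it back to the base ray, so the relabelling that produces the ray is the inverse one. -/
theorem exists_ray_eq {r : ℕ × (ℕ × ℕ × ℕ × ℕ × ℕ) × ℕ} (hr : r ∈ rayData) :
    ∃ k, ray k = vectorOf r.2.2 := by
  obtain ⟨hk, h⟩ := digit_tupleMap r hr
  let σ := Equiv.ofBijective (tupleMap r.2.1) (Finite.injective_iff_bijective.1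
    (tupleMap_injective r hr))
  refine ⟨(⟨r.1, hk⟩, σ⁻¹), ?_⟩
  have : relabel σ (vectorOf r.2.2) = vectorOf (baseRay r.1) := by
    funext I
    change purifiedValue _ _ = _
    rw [purifiedValue_vectorOf (digit_rayData r hr), Finset.map_eq_image]
    exact congrArg Nat.cast (h I.1)
  rw [ray, ← this, relabel_relabel, mul_inv_cancel, relabel_one]

theorem isFeasible_iff {v : ℕ} : isFeasible v ↔
    ∀ c < 70, digitSum v (facet c).2 ≤ digitSum v (facet c).1 := by
  simp [isFeasible, List.all_eq_true]

theorem isFeasible_baseRay : ∀ k : Fin 7, isFeasible (baseRay k) = true := by decide +kernel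

theorem ray_mem_ingletonCone (k) : ray k ∈ ingletonCone := by
  refine ingletonCone_relabel (mem_ingletonCone_iff_facetValue.2 fun c hc => ?_) _
  rw [facetValue_vectorOf (digit_baseRay _) hc, sub_nonneg]
  exact_mod_cast isFeasible_iff.1 (isFeasible_baseRay k.1) c hc

theorem mem_slackFacets {v c : ℕ} (hv : digit v 0 = 0) :
    c ∈ slackFacets v ↔ c < 70 ∧ 0 < facetValue (vectorOf v) c := by
  simp only [slackFacets, List.mem_filter, List.mem_range]
  refine and_congr_right fun hc => ?_
  rw [facetValue_vectorOf hv hc, sub_pos, Nat.cast_lt]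
  exact iff_of_eq Nat.blt_eq

theorem relabel_zero (σ : Equiv.Perm (Fin 5)) : relabel σ (0 : EntropyVector 4) = 0 := by
  simpa using relabel_smul σ 0 (0 : EntropyVector 4)

theorem ray_ne_zero (k) : ray k ≠ 0 := by
  have h : ∀ k : Fin 7, slackFacets (baseRay k) ≠ [] := by decide +kernel
  intro h0
  have h1 : vectorOf (baseRay k.1) = 0 := by
    have := congrArg (relabel k.2⁻¹) h0
    rwa [ray, relabel_relabel, relabel_zero, mul_inv_cancel, relabel_one] at this
  obtain ⟨c, hc⟩ := List.exists_mem_of_ne_nil _ (h k.1)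
  have hc := ((mem_slackFacets (digit_baseRay k.1)).1 hc).2
  rw [h1, ← zero_smul ℝ (0 : EntropyVector 4), facetValue_smul, zero_mul] at hc
  exact lt_irrefl _ hc

/-- No positive multiple of a ray can be subtracted without leaving the cone. -/
def Irreducible (S : EntropyVector 4) : Prop :=
  S ∈ ingletonCone ∧ ∀ k, ∀ t : ℝ, 0 < t → S - t • ray k ∉ ingletonCone

theorem Irreducible.relabel {S : EntropyVector 4} (h : Irreducible S) (σ : Equiv.Perm (Fin 5)) :
    Irreducible (relabel σ S) := by
  refine ⟨ingletonCone_relabel h.1 σ, fun k t ht hk => h.2 (k.1, k.2 * σ⁻¹) t ht ?_⟩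
  have := ingletonCone_relabel hk σ⁻¹
  rw [sub_eq_add_neg, ← neg_smul] at this ⊢
  simpa only [relabel_add, relabel_smul, ray, relabel_relabel, mul_inv_cancel, relabel_one]
    using this

/-- A multiple of `V` can be subtracted from `S` such that a facet becomes tight that is not
tight at `V`. -/
theorem exists_sub_smul {S V : EntropyVector 4} (hS : S ∈ ingletonCone) (hV : V ∈ ingletonCone)
    (hV0 : V ≠ 0) : ∃ t : ℝ, 0 ≤ t ∧ S - t • V ∈ ingletonCone ∧
      ∃ c < 70, 0 < facetValue V c ∧ facetValue (S - t • V) c = 0 := by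
  rw [mem_ingletonCone_iff_facetValue] at hS hV
  let F := (Finset.range 70).filter fun c => 0 < facetValue V c
  have hF : F.Nonempty := by
    rw [Finset.nonempty_iff_ne_empty]
    intro hF
    refine hV0 (eq_zero_of_facetValue_eq_zero fun c hc => le_antisymm ?_ (hV c hc))
    by_contra hlt
    have : c ∈ F := Finset.mem_filter.2 ⟨Finset.mem_range.2 hc, not_le.1 hlt⟩
    simp [hF] at this
  -- Ratio test: moving from S in the direction -V, the first inequality to become tight is one with
  -- the least quotient; `F` is nonempty because the cone is pointed.
  obtain ⟨c, hcF, hmin⟩ := F.exists_min_image (fun c => facetValue S c / facetValue V c) hF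
  obtain ⟨hc, hcV⟩ := Finset.mem_filter.1 hcF
  rw [Finset.mem_range] at hc
  have hsub (t : ℝ) (d : ℕ) : facetValue (S - t • V) d = facetValue S d - t * facetValue V d := by
    rw [sub_eq_add_neg, ← neg_smul, facetValue_add, facetValue_smul]; ring
  refine ⟨facetValue S c / facetValue V c, div_nonneg (hS c hc) hcV.le, ?_, c, hc, hcV, ?_⟩
  · rw [mem_ingletonCone_iff_facetValue]
    intro d hd
    rw [hsub, sub_nonneg]
    rcases (hV d hd).eq_or_lt with h0 | hpos
    · rw [← h0, mul_zero]; exact hS d hd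
    · have := hmin d (Finset.mem_filter.2 ⟨Finset.mem_range.2 hd, hpos⟩)
      rwa [le_div_iff₀ hpos] at this
  · rw [hsub, div_mul_cancel₀ _ hcV.ne', sub_self]

/-- The largest multiple of the ray that can be subtracted is zero, so the inequality that blocks
the subtraction is already tight at S. -/
theorem Irreducible.exists_tight {S : EntropyVector 4} (h : Irreducible S) (k) :
    ∃ c < 70, 0 < facetValue (ray k) c ∧ facetValue S c = 0 := by
  obtain ⟨t, ht, hmem, c, hc, hcV, h0⟩ :=
    exists_sub_smul h.1 (ray_mem_ingletonCone k) (ray_ne_zero k)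
  rcases ht.eq_or_lt with rfl | ht
  · exact ⟨c, hc, hcV, by simpa using h0⟩
  · exact absurd hmem (h.2 k t ht)

theorem testBit_maskOf {l : List ℕ} {c : ℕ} : (maskOf l).testBit c = true ↔ c ∈ l := by
  induction l with
  | nil => simp [maskOf]
  | cons d l ih =>
    change (maskOf l ||| 1 <<< d).testBit c = true ↔ _
    rw [Nat.testBit_or, Bool.or_eq_true, ih, Nat.one_shiftLeft, Nat.testBit_two_pow,
      decide_eq_true_eq, List.mem_cons, or_comm, eq_comm]

theorem facetValue_sum_eq {S : EntropyVector 4} {r : List ℕ × List ℕ} (hr : isIdentity r) :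
    (∀ c ∈ r.1 ++ r.2, c < 70) ∧
      (r.1.map (facetValue S)).sum = (r.2.map (facetValue S)).sum := by
  rw [isIdentity, Bool.and_eq_true] at hr
  refine ⟨fun c hc => Nat.blt_eq.mp (List.all_eq_true.1 hr.1 c hc), ?_⟩
  have key (L : List ℕ) : (L.map (facetValue S)).sum =
      ((L.flatMap fun c => (facet c).1).map (maskValue S)).sum -
        ((L.flatMap fun c => (facet c).2).map (maskValue S)).sum := by
    induction L with
    | nil => simp
    | cons c L ih =>
      simp only [List.map_cons, List.sum_cons, ih, facetValue, listGap, List.flatMap_cons,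
        List.map_append, List.sum_append]
      ring
  have h := ((List.isPerm_iff.1 hr.2).map (maskValue S)).sum_eq
  simp only [List.map_append, List.sum_append] at h
  rw [key, key]
  linarith

/-- Index 0 encodes I(0:1). If it were tight, the tight inequalities of S would be a model of the
clauses refuted by `checkFaces`. -/
theorem Irreducible.facetValue_zero_ne {S : EntropyVector 4} (h : Irreducible S) (h0 : S ≠ 0) :
    facetValue S 0 ≠ 0 := by
  intro hS
  have hcheck := checkAll_eq_true
  simp only [checkAll, Bool.and_eq_true, List.all_eq_true] at hcheck
  obtain ⟨hid, -, hfaces⟩ := hcheck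
  have hpos := mem_ingletonCone_iff_facetValue.1 h.1
  -- Atom c says that inequality c is tight. Atom 70 stands for falsehood; atoms beyond 70 hold
  -- vacuously, in accordance with the convention that everything outside `U` is true.
  let T : ℕ → Prop := fun c => c ≠ 70 ∧ (c < 70 → facetValue S c = 0)
  rw [checkFaces, forcePairs_eq, forceNats_eq, forceNat_eq, forceNat_eq] at hfaces
  refine Sound.refute (T := T) ?_ ?_ 1000 _ _ ⟨?_, ?_⟩ hfaces
  · intro r hr
    rcases List.mem_cons.1 hr with rfl | hr
    · intro hall
      refine absurd (eq_zero_of_facetValue_eq_zero fun c hc => ?_) h0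
      exact (hall c (testBit_maskOf.2 (List.mem_range.2 hc))).2 hc
    · obtain ⟨q, hq, rfl⟩ := List.mem_map.1 hr
      obtain ⟨hlt, hsum⟩ := facetValue_sum_eq (S := S) (hid q hq)
      intro hall c hc
      have hc := testBit_maskOf.1 hc
      have hc70 := hlt c (List.mem_append_right _ hc)
      refine ⟨hc70.ne, fun _ => ?_⟩
      -- One side of the identity vanishes, so the other side is a sum of nonnegative terms equal to
      -- zero, and each term vanishes.
      have hzero : (q.1.map (facetValue S)).sum = 0 := by
        refine List.sum_eq_zero fun x hx => ?_
        obtain ⟨d, hd, rfl⟩ := List.mem_map.1 hx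
        exact (hall d (testBit_maskOf.2 hd)).2 (hlt d (List.mem_append_left _ hd))
      rw [hzero] at hsum
      refine le_antisymm ?_ (hpos c hc70)
      rw [hsum]
      refine List.single_le_sum (fun x hx => ?_) _ (List.mem_map_of_mem hc)
      obtain ⟨d, hd, rfl⟩ := List.mem_map.1 hx
      exact hpos d (hlt d (List.mem_append_right _ hd))
  · intro r hr
    obtain ⟨q, hq, rfl⟩ := List.mem_map.1 hr
    obtain ⟨k, hk⟩ := exists_ray_eq hq
    obtain ⟨c, hc, hcV, hcS⟩ := h.exists_tight k
    rw [hk] at hcV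
    exact ⟨c, testBit_maskOf.2 ((mem_slackFacets (digit_rayData q hq)).2 ⟨hc, hcV⟩),
      hc.ne, fun _ => hcS⟩
  · intro c hc
    have hc' : c ∉ (List.range 71).drop 1 := fun hm => by
      rw [testBit_maskOf.2 hm] at hc; exact Bool.noConfusion hc
    -- The initial mask of undecided atoms consists of the bits 1 to 70.
    have : c = 0 ∨ 70 < c := by
      by_contra hcon
      push Not at hcon
      refine hc' (List.mem_iff_getElem.2 ⟨c - 1, by simp; omega, ?_⟩)
      simp; omega
    rcases this with rfl | hlt
    · exact ⟨by decide, fun _ => hS⟩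
    · exact ⟨by omega, fun h => by omega⟩
  · intro c hc hT
    exact hT.1 (by simpa using testBit_maskOf.1 hc)

/-- By symmetry no I(i:j) vanishes at a nonzero irreducible S. The five-party GHZ vector, however,
is slack only at inequalities I(i:j) ≥ 0, and one of these must be tight at S. -/
theorem Irreducible.eq_zero {S : EntropyVector 4} (h : Irreducible S) : S = 0 := by
  by_contra h0
  have hsa : ∀ i j : Fin 5, i ≠ j → facetValue S (saCode i j) ≠ 0 := by
    intro i j hij
    obtain ⟨k, l, hk⟩ : ∃ k l : Fin 5, [i, j, k, l].Nodup := by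
      revert i j; decide
    obtain ⟨σ, hσ⟩ := exists_perm_of_injective (f := ![i, j, k, l])
      (List.nodup_ofFn.1 (by simpa using hk))
    have hσ0 : σ 0 = i := hσ 0
    have hσ1 : σ 1 = j := hσ 1
    have h1 := (h.relabel σ).facetValue_zero_ne fun hz => h0 (by
      have := congrArg (EntropyCone.relabel σ⁻¹) hz
      rwa [relabel_relabel, relabel_zero, mul_inv_cancel, relabel_one] at this)
    have e := (facetValue_saCode (EntropyCone.relabel σ S) (i := 0) (j := 1) (by decide)).2
    rw [show saCode ((0 : Fin 5) : ℕ) ((1 : Fin 5) : ℕ) = 0 by decide] at e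
    rw [e] at h1
    rw [(facetValue_saCode S hij).2]
    simpa [hσ0, hσ1] using h1
  obtain ⟨c, hc, hcV, hcS⟩ := h.exists_tight (2, 1)
  rw [ray, relabel_one] at hcV
  have hmem := (mem_slackFacets (digit_baseRay 2)).2 ⟨hc, hcV⟩
  have key : ∀ c ∈ slackFacets (baseRay (2 : Fin 7)), ∃ i j : Fin 5, i ≠ j ∧ c = saCode i j := by
    decide +kernel
  obtain ⟨i, j, hij, rfl⟩ := key c hmem
  exact hsa i j hij hcS

/-- Subtract rays from `S` greedily. -/
theorem exists_reduction {S : EntropyVector 4} (hS : S ∈ ingletonCone)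
    (l : List (Fin 7 × Equiv.Perm (Fin 5))) : ∃ R ∈ ingletonCone,
      S - R ∈ PointedCone.hull ℝ (Set.range ray) ∧
      ∀ k ∈ l, ∀ t : ℝ, 0 < t → R - t • ray k ∉ ingletonCone := by
  induction l with
  | nil => exact ⟨S, hS, by simp, by simp⟩
  | cons k l ih =>
    obtain ⟨R, hR, hSR, hl⟩ := ih
    obtain ⟨t, ht, hmem, c, hc, hcV, h0⟩ :=
      exists_sub_smul hR (ray_mem_ingletonCone k) (ray_ne_zero k)
    refine ⟨R - t • ray k, hmem, ?_, fun k' hk' u hu hcon => ?_⟩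
    · have : S - (R - t • ray k) = (S - R) + (⟨t, ht⟩ : {c : ℝ // 0 ≤ c}) • ray k := by
        change S - (R - t • ray k) = (S - R) + t • ray k
        abel
      rw [this]
      exact add_mem hSR (Submodule.smul_mem _ _ (Submodule.subset_span ⟨k, rfl⟩))
    · rcases List.mem_cons.1 hk' with rfl | hk'
      · have := mem_ingletonCone_iff_facetValue.1 hcon c hc
        rw [sub_eq_add_neg, ← neg_smul, facetValue_add, facetValue_smul, h0, zero_add] at this
        have := mul_pos hu hcV
        linarith
      -- Rays handled earlier stay blocked: adding the multiple of `ray k` back would otherwise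
      -- allow a multiple of `ray k'` to be subtracted from R.
      · refine hl k' hk' u hu ?_
        have := ingletonCone_add hcon (ingletonCone_smul (ray_mem_ingletonCone k) ht)
        convert this using 1
        abel

theorem ingletonCone_subset_hull : ingletonCone ⊆ PointedCone.hull ℝ (Set.range ray) := by
  intro S hS
  obtain ⟨R, hR, hSR, hl⟩ := exists_reduction hS Finset.univ.toList
  have : Irreducible R := ⟨hR, fun k => hl k (by simp)⟩
  rwa [this.eq_zero, sub_zero] at hSR

/-- Being nonzero, S is not irreducible, so it splits off a positive multiple of some ray;
extremality makes that summand proportional to S. -/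
theorem IsExtremeRay.exists_eq_smul_ray {S : EntropyVector 4} (h : IsExtremeRay ingletonCone S) :
    ∃ k, ∃ t : ℝ, 0 ≤ t ∧ S = t • ray k := by
  obtain ⟨hS, h0, hext⟩ := h
  have : ¬ Irreducible S := fun hI => h0 hI.eq_zero
  simp only [Irreducible, hS, true_and] at this
  push Not at this
  obtain ⟨k, t, ht, hmem⟩ := this
  obtain ⟨s, hs, he⟩ := hext _ (ingletonCone_smul (ray_mem_ingletonCone k) ht.le) _ hmem
    (add_sub_cancel _ _)
  have hs0 : s ≠ 0 := by
    rintro rfl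
    rw [zero_smul, smul_eq_zero] at he
    exact he.elim ht.ne' (ray_ne_zero k)
  refine ⟨k, s⁻¹ * t, mul_nonneg (inv_nonneg.2 hs) ht.le, ?_⟩
  rw [mul_smul, he, inv_smul_smul₀ hs0]

end Rays

/-! ### Contraction maps -/

section Contraction

variable {n : ℕ}

/-- Makes the condition for all k a finite check. If D is the set of positions where the k strings
disagree, all of them lie in the subcube through the first string with directions D, and an output
position that varies among them varies on that subcube. -/
theorem EntropyInequality.isContractionMap_of_subcubes (q : EntropyInequality n)
    (f : (Fin q.L → Bool) → (Fin q.R → Bool))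
    (hocc : ∀ i, f (occurrence q.I i) = occurrence q.J i)
    (hcube : ∀ (D : Finset (Fin q.L)) (x : Fin q.L → Bool),
      ∑ r, (if ∃ y, (∀ l ∉ D, y l = x l) ∧ f y r ≠ f x r then q.β r else 0) ≤
        ∑ l ∈ D, q.α l) : q.IsContractionMap f := by
  classical
  refine ⟨hocc, fun k hk x => ?_⟩
  let D : Finset (Fin q.L) := Finset.univ.filter fun l => ∃ i j, x i l ≠ x j l
  let i₀ : Fin k := ⟨0, by omega⟩
  have hα : weightedIndicator q.α x = ∑ l ∈ D, q.α l := by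
    rw [weightedIndicator, Finset.sum_filter]
  rw [hα]
  refine le_trans (Finset.sum_le_sum fun r _ => ?_) (hcube D (x i₀))
  have hβ := (q.β_pos r).le
  split_ifs with h1 h2 h2
  · exact le_rfl
  · exfalso
    obtain ⟨i, j, hij⟩ := h1
    have hall : ∀ i, f (x i) r = f (x i₀) r := by
      intro i
      by_contra hne
      refine h2 ⟨x i, fun l hl => ?_, hne⟩
      by_contra hl'
      exact hl (Finset.mem_filter.2 ⟨Finset.mem_univ _, i, i₀, hl'⟩)
    exact hij ((hall i).trans (hall j).symm)
  · exact hβ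
  · exact le_rfl

theorem isContractionMap_of_unit {L R : ℕ} (I : Fin L → Finset (Fin n)) (J : Fin R → Finset (Fin n))
    (f : (Fin L → Bool) → (Fin R → Bool))
    (hocc : ∀ i r, f (fun l => decide (i ∈ withPurifier (I l))) r = decide (i ∈ withPurifier (J r)))
    (hcube : ∀ (D : Finset (Fin L)) (x : Fin L → Bool),
      (Finset.univ.filter fun r => ∃ y, (∀ l ∉ D, y l = x l) ∧ f y r ≠ f x r).card ≤ D.card) :
    EntropyInequality.IsContractionMap
      ⟨L, R, fun _ => 1, fun _ => 1, I, J, fun _ => one_pos, fun _ => one_pos⟩ f := by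
  refine EntropyInequality.isContractionMap_of_subcubes
    ⟨L, R, fun _ => 1, fun _ => 1, I, J, fun _ => one_pos, fun _ => one_pos⟩ f
    (fun i => funext (hocc i)) fun D x => ?_
  have := (Nat.cast_le (α := ℝ)).2 (hcube D x)
  rw [Finset.card_filter, Nat.cast_sum] at this
  simpa using this

theorem exists_contractionMap_SA : ∃ f, SA.IsContractionMap f :=
  ⟨_, isContractionMap_of_unit ![{0}, {1}] ![{0, 1}] (fun x _ => x 0 || x 1)
    (by decide +kernel) (by decide +kernel)⟩

/-- Disjunction and conjunction correspond to the union and intersection of the two cuts, as in the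
usual proof that cut functions are submodular. -/
theorem exists_contractionMap_SSA : ∃ f, SSA.IsContractionMap f :=
  ⟨_, isContractionMap_of_unit ![{0, 1}, {1, 2}] ![{0, 1, 2}, {1}]
    (fun x => ![x 0 || x 1, x 0 && x 1]) (by decide +kernel) (by decide +kernel)⟩

/-- A bit string of length five as a number. -/
def bitsToNat (x : Fin 5 → Bool) : ℕ :=
  (x 0).toNat + 2 * (x 1).toNat + 4 * (x 2).toNat + 8 * (x 3).toNat + 16 * (x 4).toNat

/-- The contraction map for Ingleton's inequality: position `r` of the image of the bit string
with number `m` is the bit `m` of the table at `r`. -/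
def ingletonTable : Fin 5 → ℕ :=
  ![2 ^ 7, 2 ^ 25, 2 ^ 10 + 2 ^ 20, 0xaf8aefee, 0x3bf382f8]

theorem ingletonTable_cube : ∀ D < 32, ∀ m < 32,
    (Finset.univ.filter fun r : Fin 5 => (List.range 32).any (fun y =>
      Nat.beq (Nat.land (Nat.xor y m) (Nat.sub 31 D)) 0 &&
        ((ingletonTable r).testBit y != (ingletonTable r).testBit m)) = true).card ≤
      (Finset.univ.filter fun l : Fin 5 => D.testBit l).card := by
  decide +kernel

/-- The strings of A, B, C, D, O have numbers 7, 25, 10, 20, 0. The first three outputs are 1 only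
where these occurrence strings demand it; the tables of the last two complete the map so that all
subcube checks succeed. -/
theorem exists_contractionMap_Ingleton : ∃ f, Ingleton.IsContractionMap f := by
  refine ⟨_, isContractionMap_of_unit ![{0, 1}, {0, 2}, {0, 3}, {1, 2}, {1, 3}]
    ![{0}, {1}, {2, 3}, {0, 1, 2}, {0, 1, 3}]
    (fun x r => (ingletonTable r).testBit (bitsToNat x)) (by decide +kernel) fun D x => ?_⟩
  have hlt : ∀ x, bitsToNat x < 32 := by decide +kernel
  have hbit : ∀ (x : Fin 5 → Bool) (l : Fin 5), (bitsToNat x).testBit l = x l := by decide +kernel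
  have hD : ∀ D : Finset (Fin 5), ∃ d < 32, D = Finset.univ.filter fun l : Fin 5 => d.testBit l := by
    decide +kernel
  obtain ⟨d, hd, rfl⟩ := hD D
  refine le_trans (Finset.card_le_card fun r hr => ?_) (ingletonTable_cube d hd _ (hlt x))
  simp only [Finset.mem_filter, Finset.mem_univ, true_and] at hr ⊢
  obtain ⟨y, hy, hne⟩ := hr
  rw [List.any_eq_true]
  refine ⟨bitsToNat y, List.mem_range.2 (hlt y), ?_⟩
  have key : ∀ d < 32, ∀ y x : Fin 5 → Bool, (∀ l, d.testBit (l : Fin 5) = false → y l = x l) →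
      Nat.land (Nat.xor (bitsToNat y) (bitsToNat x)) (Nat.sub 31 d) = 0 := by
    intro d hd y x h
    have hsub : ∀ d < 32, ∀ l < 5, (Nat.sub 31 d).testBit l = !d.testBit l := by decide +kernel
    have hlt' := hlt y
    refine Nat.eq_of_testBit_eq fun i => ?_
    change ((bitsToNat y ^^^ bitsToNat x) &&& _).testBit i = _
    rw [Nat.testBit_and, Nat.testBit_xor, Nat.zero_testBit]
    by_cases hi : i < 5
    · rw [hsub d hd i hi]
      cases hdi : d.testBit i with
      | true => simp
      | false =>
        have := h ⟨i, hi⟩ hdi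
        rw [← hbit y, ← hbit x] at this
        simp only at this
        simp [this]
    · have hz : ∀ x, (bitsToNat x).testBit i = false := fun x =>
        Nat.testBit_lt_two_pow ((hlt x).trans_le (Nat.pow_le_pow_right (n := 2) (by omega)
          (by omega : 5 ≤ i)))
      simp [hz]
  rw [key d hd y x fun l hl => hy l (by simpa using hl)]
  simpa using hne

end Contraction

/-! ### The hypergraph cone -/

namespace Hypergraph

variable {V : Type} [Fintype V] [DecidableEq V] {n : ℕ}

/-- The cut `W` contains precisely those boundary vertices that are colored by `K`. -/
def Separates (H : Hypergraph V n) (K : Finset (Fin (n + 1))) (W : Finset V) : Prop :=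
  ∀ v i, H.color v = some i → (v ∈ W ↔ i ∈ K)

theorem mem_cuts (H : Hypergraph V n) {I : Finset (Fin n)} {W : Finset V} :
    W ∈ H.cuts I ↔ H.Separates (withPurifier I) W := by
  simp [cuts, Separates]

theorem cutWeight_nonneg (H : Hypergraph V n) (W : Finset V) : 0 ≤ H.cutWeight W :=
  Finset.sum_nonneg fun e he => H.weight_nonneg e (Finset.mem_filter.1 he).1

theorem cutWeight_compl (H : Hypergraph V n) (W : Finset V) :
    H.cutWeight Wᶜ = H.cutWeight W := by
  simp only [cutWeight, compl_compl, and_comm]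

theorem cutWeight_empty (H : Hypergraph V n) : H.cutWeight ∅ = 0 := by
  simp [cutWeight]

theorem Separates.compl {H : Hypergraph V n} {K : Finset (Fin (n + 1))} {W : Finset V}
    (h : H.Separates K W) : H.Separates Kᶜ Wᶜ := fun v i hv => by
  rw [Finset.mem_compl, Finset.mem_compl, h v i hv]

/-- The min-cut prescription extends to sets with the purifier because a cut and its complement have
equal weight and separate complementary sets of colors. -/
theorem isLeast_purifiedValue_entropy (H : Hypergraph V n) (K : Finset (Fin (n + 1))) :
    IsLeast (H.cutWeight '' {W | H.Separates K W}) (purifiedValue H.entropy K) := by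
  induction K using compl_induction with
  | h I =>
    rw [purifiedValue_withPurifier]
    by_cases hI : I.Nonempty
    · rw [value_nonempty _ hI]
      constructor
      · obtain ⟨W, hW, h⟩ := Finset.exists_mem_eq_inf' (H.cuts_nonempty I) H.cutWeight
        exact ⟨W, (H.mem_cuts).1 hW, h.symm⟩
      · rintro _ ⟨W, hW, rfl⟩
        exact Finset.inf'_le _ (H.mem_cuts.2 hW)
    · rw [Finset.not_nonempty_iff_eq_empty.1 hI, value_empty]
      refine ⟨⟨∅, fun v i _ => by simp [withPurifier], H.cutWeight_empty⟩, ?_⟩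
      rintro _ ⟨W, -, rfl⟩
      exact H.cutWeight_nonneg W
  | hc K ih =>
    rw [purifiedValue_compl]
    have : H.cutWeight '' {W | H.Separates Kᶜ W} = H.cutWeight '' {W | H.Separates K W} := by
      ext c
      constructor
      · rintro ⟨W, hW, rfl⟩
        exact ⟨Wᶜ, by simpa using hW.compl, H.cutWeight_compl W⟩
      · rintro ⟨W, hW, rfl⟩
        exact ⟨Wᶜ, hW.compl, H.cutWeight_compl W⟩
    rwa [this]

theorem entropy_eq_iff (H : Hypergraph V n) (S : EntropyVector n) :
    H.entropy = S ↔
      ∀ K, IsLeast (H.cutWeight '' {W | H.Separates K W}) (purifiedValue S K) := by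
  constructor
  · rintro rfl
    exact H.isLeast_purifiedValue_entropy
  · exact fun h => eq_of_purifiedValue_eq fun K => (H.isLeast_purifiedValue_entropy K).unique (h K)

/-- The weight of a cut, as a sum over all hyperedges of the indicator that the hyperedge is
cut. -/
theorem cutWeight_eq_sum (H : Hypergraph V n) (W : Finset V) :
    H.cutWeight W = ∑ e ∈ H.edges,
      if ∃ i j, decide (((e.equivFin.symm i : e) : V) ∈ W) ≠
        decide (((e.equivFin.symm j : e) : V) ∈ W) then H.weight e else 0 := by
  rw [cutWeight, Finset.sum_filter]
  refine Finset.sum_congr rfl fun e _ => ?_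
  congr 1
  rw [eq_iff_iff]
  constructor
  · rintro ⟨⟨u, hu⟩, ⟨v, hv⟩⟩
    simp only [Finset.mem_inter, Finset.mem_compl] at hu hv
    exact ⟨e.equivFin ⟨u, hu.1⟩, e.equivFin ⟨v, hv.1⟩, by simp [hu.2, hv.2]⟩
  · rintro ⟨i, j, hij⟩
    have hi := (e.equivFin.symm i).2
    have hj := (e.equivFin.symm j).2
    by_cases h1 : ((e.equivFin.symm i : e) : V) ∈ W
    · have h2 : ((e.equivFin.symm j : e) : V) ∉ W := fun h2 => hij (by simp [h1, h2])
      exact ⟨⟨_, Finset.mem_inter.2 ⟨hi, h1⟩⟩, ⟨_, Finset.mem_inter.2 ⟨hj, Finset.mem_compl.2 h2⟩⟩⟩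
    · have h2 : ((e.equivFin.symm j : e) : V) ∈ W := by
        by_contra h2
        exact hij (by simp [h1, h2])
      exact ⟨⟨_, Finset.mem_inter.2 ⟨hj, h2⟩⟩, ⟨_, Finset.mem_inter.2 ⟨hi, Finset.mem_compl.2 h1⟩⟩⟩

/-- An inequality with a contraction map is valid for hypergraphs. -/
theorem holds_entropy (H : Hypergraph V n) {q : EntropyInequality n}
    {f : (Fin q.L → Bool) → (Fin q.R → Bool)} (hf : q.IsContractionMap f) :
    q.Holds H.entropy := by
  have hex := fun l => (H.isLeast_purifiedValue_entropy (withPurifier (q.I l))).1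
  choose W hW hWv using hex
  simp only [purifiedValue_withPurifier] at hWv
  -- The string of a vertex records its sides of the minimal cuts for the left-hand subsystems. A
  -- boundary vertex colored `i` gets the occurrence string of `i`, so the cuts `W'` read off from
  -- `f` are admissible for the right-hand subsystems.
  let x : V → Fin q.L → Bool := fun v l => decide (v ∈ W l)
  let W' : Fin q.R → Finset V := fun r => Finset.univ.filter fun v => f (x v) r = true
  have hW' : ∀ r, H.Separates (withPurifier (q.J r)) (W' r) := by
    intro r v i hv
    have hx : x v = occurrence q.I i := by
      funext l
      simp only [x, occurrence, hW l v i hv]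
    simp [W', hx, hf.1, occurrence]
  have hle : ∀ r, value H.entropy (q.J r) ≤ H.cutWeight (W' r) := by
    intro r
    have := (H.isLeast_purifiedValue_entropy (withPurifier (q.J r))).2 ⟨_, hW' r, rfl⟩
    rwa [purifiedValue_withPurifier] at this
  have hdec : ∀ r v, decide (v ∈ W' r) = f (x v) r := by
    intro r v
    simp [W']
  calc ∑ r, q.β r * value H.entropy (q.J r)
      ≤ ∑ r, q.β r * H.cutWeight (W' r) :=
        Finset.sum_le_sum fun r _ => mul_le_mul_of_nonneg_left (hle r) (q.β_pos r).le
    _ = ∑ e ∈ H.edges, H.weight e *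
          weightedIndicator q.β fun i => f (x ((e.equivFin.symm i : e) : V)) := by
        simp only [cutWeight_eq_sum, hdec, weightedIndicator, Finset.mul_sum]
        rw [Finset.sum_comm]
        refine Finset.sum_congr rfl fun e _ => Finset.sum_congr rfl fun r _ => ?_
        split_ifs
        · exact mul_comm _ _
        · simp
    _ ≤ ∑ e ∈ H.edges, H.weight e *
          weightedIndicator q.α fun i => x ((e.equivFin.symm i : e) : V) :=
        Finset.sum_le_sum fun e he => mul_le_mul_of_nonneg_left
          (hf.2 _ (H.two_le_card e he) _) (H.weight_nonneg e he)
    _ = ∑ l, q.α l * H.cutWeight (W l) := by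
        simp only [cutWeight_eq_sum, weightedIndicator, Finset.mul_sum]
        rw [Finset.sum_comm]
        refine Finset.sum_congr rfl fun l _ => Finset.sum_congr rfl fun e _ => ?_
        simp only [x]
        split_ifs
        · exact mul_comm _ _
        · simp
    _ = ∑ l, q.α l * value H.entropy (q.I l) := by simp only [hWv]

/-- Permute the colors of the boundary vertices. -/
@[simps] def recolor (σ : Equiv.Perm (Fin (n + 1))) (H : Hypergraph V n) : Hypergraph V n where
  edges := H.edges
  two_le_card := H.two_le_card
  weight := H.weight
  weight_nonneg := H.weight_nonneg
  color := fun v => (H.color v).map σ.symm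

/-- A vertex colored i is recolored with the preimage of i, which lies in K exactly when i lies in
the image of K; hence the inverse permutation in `recolor`. -/
theorem entropy_recolor (σ : Equiv.Perm (Fin (n + 1))) (H : Hypergraph V n) :
    (H.recolor σ).entropy = relabel σ H.entropy := by
  rw [entropy_eq_iff]
  intro K
  rw [purifiedValue_relabel]
  have h := H.isLeast_purifiedValue_entropy (K.map σ.toEmbedding)
  have : {W | (H.recolor σ).Separates K W} = {W | H.Separates (K.map σ.toEmbedding) W} := by
    ext W
    simp only [Separates, recolor_color, Set.mem_ofPred_eq, Option.map_eq_some_iff,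
      Finset.mem_map_equiv]
    constructor
    · exact fun h v i hv => h v _ ⟨i, hv, rfl⟩
    · rintro h v _ ⟨i, hv, rfl⟩
      exact h v i hv
  rwa [this]

theorem bulkCard_recolor (σ : Equiv.Perm (Fin (n + 1))) (H : Hypergraph V n) :
    (H.recolor σ).bulkCard = H.bulkCard := by
  simp [bulkCard]

/-- Rescale the weights. -/
@[simps] def scale (t : ℝ) (ht : 0 ≤ t) (H : Hypergraph V n) : Hypergraph V n where
  edges := H.edges
  two_le_card := H.two_le_card
  weight := fun e => t * H.weight e
  weight_nonneg := fun e he => mul_nonneg ht (H.weight_nonneg e he)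
  color := H.color

theorem entropy_scale (t : ℝ) (ht : 0 ≤ t) (H : Hypergraph V n) :
    (H.scale t ht).entropy = t • H.entropy := by
  rw [entropy_eq_iff]
  intro K
  rw [purifiedValue_smul]
  obtain ⟨⟨W, hW, hv⟩, hle⟩ := H.isLeast_purifiedValue_entropy K
  have hcut : ∀ W, (H.scale t ht).cutWeight W = t * H.cutWeight W := fun W => by
    simp [cutWeight, Finset.mul_sum]
  refine ⟨⟨W, hW, by rw [hcut, hv]⟩, ?_⟩
  rintro _ ⟨W', hW', rfl⟩
  rw [hcut]
  exact mul_le_mul_of_nonneg_left (hle ⟨W', hW', rfl⟩) ht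

theorem bulkCard_scale (t : ℝ) (ht : 0 ≤ t) (H : Hypergraph V n) :
    (H.scale t ht).bulkCard = H.bulkCard := rfl

section Sum

variable {V' : Type} [Fintype V'] [DecidableEq V']

/-- The disjoint union of two hypergraphs. -/
@[simps] def sum (H : Hypergraph V n) (H' : Hypergraph V' n) : Hypergraph (V ⊕ V') n where
  edges := H.edges.image (fun e => e.disjSum ∅) ∪ H'.edges.image (fun e => Finset.disjSum ∅ e)
  two_le_card := by
    intro e he
    simp only [Finset.mem_union, Finset.mem_image] at he
    obtain ⟨e, he, rfl⟩ | ⟨e, he, rfl⟩ := he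
    · simpa using H.two_le_card e he
    · simpa using H'.two_le_card e he
  -- Hyperedges are nonempty, so an empty right part identifies those from the first hypergraph.
  weight := fun e => if e.toRight = ∅ then H.weight e.toLeft else H'.weight e.toRight
  weight_nonneg := by
    intro e he
    simp only [Finset.mem_union, Finset.mem_image] at he
    obtain ⟨e, he, rfl⟩ | ⟨e, he, rfl⟩ := he
    · rw [Finset.toRight_disjSum, Finset.toLeft_disjSum, if_pos rfl]
      exact H.weight_nonneg e he
    · have : e ≠ ∅ := fun h => by simpa [h] using H'.two_le_card e he
      rw [Finset.toRight_disjSum, if_neg this]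
      exact H'.weight_nonneg e he
  color := Sum.elim H.color H'.color

theorem cutWeight_sum (H : Hypergraph V n) (H' : Hypergraph V' n) (W : Finset (V ⊕ V')) :
    (H.sum H').cutWeight W = H.cutWeight W.toLeft + H'.cutWeight W.toRight := by
  have hdisj : Disjoint (H.edges.image fun e => e.disjSum (∅ : Finset V'))
      (H'.edges.image fun e => Finset.disjSum (∅ : Finset V) e) := by
    rw [Finset.disjoint_left]
    intro e he he'
    obtain ⟨e₁, he₁, rfl⟩ := Finset.mem_image.1 he
    obtain ⟨e₂, he₂, h⟩ := Finset.mem_image.1 he'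
    have : e₁ = ∅ := by
      simpa only [Finset.toLeft_disjSum] using (congrArg Finset.toLeft h).symm
    simpa [this] using H.two_le_card e₁ he₁
  have hl : ∀ e : Finset V,
      ((e.disjSum (∅ : Finset V') ∩ W).Nonempty ↔ (e ∩ W.toLeft).Nonempty) ∧
      ((e.disjSum (∅ : Finset V') ∩ Wᶜ).Nonempty ↔ (e ∩ W.toLeftᶜ).Nonempty) := by
    intro e
    simp [Finset.Nonempty]
  have hr : ∀ e : Finset V',
      ((Finset.disjSum (∅ : Finset V) e ∩ W).Nonempty ↔ (e ∩ W.toRight).Nonempty) ∧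
      ((Finset.disjSum (∅ : Finset V) e ∩ Wᶜ).Nonempty ↔ (e ∩ W.toRightᶜ).Nonempty) := by
    intro e
    simp [Finset.Nonempty]
  simp only [cutWeight, Finset.sum_filter, sum_edges]
  rw [Finset.sum_union hdisj, Finset.sum_image, Finset.sum_image]
  · congr 1
    · refine Finset.sum_congr rfl fun e _ => ?_
      simp only [(hl e).1, (hl e).2, sum_weight, Finset.toRight_disjSum, Finset.toLeft_disjSum,
        if_true]
    · refine Finset.sum_congr rfl fun e he => ?_
      have : e ≠ ∅ := fun h => by simpa [h] using H'.two_le_card e he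
      simp only [(hr e).1, (hr e).2, sum_weight, Finset.toRight_disjSum, this, if_false]
  · intro a _ b _ h
    simpa only [Finset.toRight_disjSum] using congrArg Finset.toRight h
  · intro a _ b _ h
    simpa only [Finset.toLeft_disjSum] using congrArg Finset.toLeft h

theorem entropy_sum (H : Hypergraph V n) (H' : Hypergraph V' n) :
    (H.sum H').entropy = H.entropy + H'.entropy := by
  rw [entropy_eq_iff]
  intro K
  rw [purifiedValue_add]
  obtain ⟨⟨W, hW, hv⟩, hle⟩ := H.isLeast_purifiedValue_entropy K
  obtain ⟨⟨W', hW', hv'⟩, hle'⟩ := H'.isLeast_purifiedValue_entropy K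
  refine ⟨⟨W.disjSum W', ?_, by rw [cutWeight_sum]; simp [hv, hv']⟩, ?_⟩
  · rintro (v | v) i h
    · simpa using hW v i h
    · simpa using hW' v i h
  · rintro _ ⟨U, hU, rfl⟩
    rw [cutWeight_sum]
    exact add_le_add
      (hle ⟨_, fun v i h => by simpa using hU (Sum.inl v) i h, rfl⟩)
      (hle' ⟨_, fun v i h => by simpa using hU (Sum.inr v) i h, rfl⟩)

end Sum

end Hypergraph

/-! ### The hypergraph cone is a convex cone inside the Ingleton cone -/

section HypergraphCone

variable {n : ℕ}

theorem hypergraphCone_add {S T : EntropyVector n} (hS : S ∈ hypergraphCone n)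
    (hT : T ∈ hypergraphCone n) : S + T ∈ hypergraphCone n := by
  obtain ⟨V, _, _, H, rfl⟩ := hS
  obtain ⟨V', _, _, H', rfl⟩ := hT
  exact ⟨V ⊕ V', inferInstance, inferInstance, H.sum H', H.entropy_sum H'⟩

theorem hypergraphCone_smul {S : EntropyVector n} (hS : S ∈ hypergraphCone n) {t : ℝ}
    (ht : 0 ≤ t) : t • S ∈ hypergraphCone n := by
  obtain ⟨V, _, _, H, rfl⟩ := hS
  exact ⟨V, inferInstance, inferInstance, H.scale t ht, H.entropy_scale t ht⟩

theorem orbitHolds_of_mem_hypergraphCone {q : EntropyInequality n}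
    (hq : ∃ f, q.IsContractionMap f) {S : EntropyVector n} (hS : S ∈ hypergraphCone n) :
    q.OrbitHolds S := by
  obtain ⟨f, hf⟩ := hq
  obtain ⟨V, _, _, H, rfl⟩ := hS
  intro σ
  rw [← H.entropy_recolor]
  exact Hypergraph.holds_entropy _ hf

theorem hypergraphCone_subset_ingletonCone : hypergraphCone 4 ⊆ ingletonCone := fun _ hS =>
  ⟨orbitHolds_of_mem_hypergraphCone exists_contractionMap_SA hS,
    orbitHolds_of_mem_hypergraphCone exists_contractionMap_SSA hS,
    orbitHolds_of_mem_hypergraphCone exists_contractionMap_Ingleton hS⟩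

theorem hull_subset {s C : Set (EntropyVector n)} (hs : s ⊆ C) (hne : C.Nonempty)
    (hadd : ∀ S ∈ C, ∀ T ∈ C, S + T ∈ C) (hsmul : ∀ t : ℝ, 0 ≤ t → ∀ S ∈ C, t • S ∈ C) :
    (PointedCone.hull ℝ s : Set (EntropyVector n)) ⊆ C := by
  intro S hS
  refine Submodule.span_induction (p := fun S _ => S ∈ C) (fun S h => hs h) ?_
    (fun S T _ _ h h' => hadd S h T h') (fun t S _ h => hsmul t.1 t.2 S h) hS
  obtain ⟨S, h⟩ := hne
  simpa using hsmul 0 le_rfl S h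

end HypergraphCone

/-! ### Hypergraphs for the extreme rays -/

/-- The hyperedges of the hypergraphs for the base rays; the boundary vertices are the parties,
and `none` is the bulk vertex. -/
def baseEdges : Fin 7 → Finset (Finset (Option (Fin 5))) :=
  ![{{some 0, some 1}}, {{some 1, some 2, some 3, some 4}},
    {{some 0, some 1, some 2, some 3, some 4}},
    {{some 0, some 1, some 2, none}, {some 0, some 1, some 3, none}, {some 4, none}},
    {{some 0, none}, {some 1, none}, {some 2, none}, {some 3, none}, {some 4, none}},
    {{some 1, none}, {some 2, none}, {some 3, none}, {some 4, none}},
    {{some 2, some 3, some 4, none}, {some 0, none}, {some 1, none}}]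

/-- The weights of the hyperedges of the hypergraphs for the base rays. -/
def baseWeight (k : Fin 7) (e : Finset (Option (Fin 5))) : ℕ :=
  if (k = 4 ∧ some 0 ∈ e) ∨ (k = 6 ∧ some 2 ∈ e) then 2 else 1

/-- The hypergraphs for the base rays. -/
def baseHypergraph (k : Fin 7) : Hypergraph (Option (Fin 5)) 4 where
  edges := baseEdges k
  two_le_card := by revert k; decide +kernel
  weight := fun e => baseWeight k e
  weight_nonneg := fun _ _ => Nat.cast_nonneg _
  color := id

/-- The weight of the cut that contains the parties in `K`, and the bulk vertex if `b`. -/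
def baseCut (k : Fin 7) (b : Bool) (K : Finset (Fin 5)) : ℕ :=
  let W := if b then Finset.insertNone K else K.map Function.Embedding.some
  ∑ e ∈ (baseEdges k).filter (fun e => (e ∩ W).Nonempty ∧ (e ∩ Wᶜ).Nonempty), baseWeight k e

/-- With the boundary vertices fixed, only the side of the bulk vertex is free, so the minimum runs
over two cuts. Some of these hypergraphs have fewer symmetries than their entropy vectors. -/
theorem baseCut_spec : ∀ (k : Fin 7) (K : Finset (Fin 5)),
    min (baseCut k false K) (baseCut k true K) =
      digit (baseRay k) (canonMask (maskOfSet K)) := by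
  decide +kernel

theorem entropy_baseHypergraph (k : Fin 7) :
    (baseHypergraph k).entropy = vectorOf (baseRay k) := by
  rw [Hypergraph.entropy_eq_iff]
  intro K
  rw [purifiedValue_vectorOf (digit_baseRay k), ← baseCut_spec]
  let W : Bool → Finset (Option (Fin 5)) := fun b =>
    if b then Finset.insertNone K else K.map Function.Embedding.some
  have hW : ∀ b, (baseHypergraph k).Separates K (W b) := by
    rintro (_ | _) v i rfl <;> simp [W]
  have hcut : ∀ b, (baseHypergraph k).cutWeight (W b) = baseCut k b K := by
    intro b
    simp [Hypergraph.cutWeight, baseCut, baseHypergraph, W]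
  constructor
  · rcases min_choice (baseCut k false K) (baseCut k true K) with h | h <;> rw [h]
    exacts [⟨_, hW _, hcut _⟩, ⟨_, hW _, hcut _⟩]
  · rintro _ ⟨U, hU, rfl⟩
    have : ∃ b, U = W b := by
      refine ⟨decide (none ∈ U), ?_⟩
      ext v
      rcases v with _ | i
      · by_cases h : none ∈ U <;> simp [W, h]
      · rw [hU (some i) i rfl, hW _ (some i) i rfl]
    obtain ⟨b, rfl⟩ := this
    rw [hcut]
    cases b
    · exact Nat.cast_le.2 (min_le_left _ _)
    · exact Nat.cast_le.2 (min_le_right _ _)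

theorem bulkCard_baseHypergraph (k : Fin 7) : (baseHypergraph k).bulkCard ≤ 1 := by
  rw [Hypergraph.bulkCard, Finset.card_le_one]
  intro a ha b hb
  exact (Finset.mem_filter.1 ha).2.trans (Finset.mem_filter.1 hb).2.symm

theorem exists_hypergraph_smul_ray (k) {t : ℝ} (ht : 0 ≤ t) :
    ∃ (V : Type) (_ : Fintype V) (_ : DecidableEq V) (H : Hypergraph V 4),
      H.entropy = t • ray k ∧ H.bulkCard ≤ 1 := by
  refine ⟨_, inferInstance, inferInstance, ((baseHypergraph k.1).recolor k.2).scale t ht, ?_, ?_⟩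
  · rw [Hypergraph.entropy_scale, Hypergraph.entropy_recolor, entropy_baseHypergraph, ray]
  · rw [Hypergraph.bulkCard_scale, Hypergraph.bulkCard_recolor]
    exact bulkCard_baseHypergraph k.1

theorem hypergraphCone_eq_ingletonCone : hypergraphCone 4 = ingletonCone := by
  refine hypergraphCone_subset_ingletonCone.antisymm (ingletonCone_subset_hull.trans ?_)
  have hray : ∀ k, ∀ t : ℝ, 0 ≤ t → t • ray k ∈ hypergraphCone 4 := by
    intro k t ht
    obtain ⟨V, i₁, i₂, H, h, -⟩ := exists_hypergraph_smul_ray k ht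
    exact ⟨V, i₁, i₂, H, h⟩
  refine hull_subset ?_ ⟨_, hray (0, 1) 0 le_rfl⟩ (fun _ h _ h' => hypergraphCone_add h h')
    fun t ht _ h => hypergraphCone_smul h ht
  rintro _ ⟨k, rfl⟩
  simpa using hray k 1 zero_le_one

/-! ### Modular functions on lattices -/

section Modular

variable {α : Type*} [Lattice α] {v : α → ℝ}

/-- The meet of a ⊔ b and b ⊔ c is above b; modularity and monotonicity do the rest. -/
theorem modular_ssa (hmono : Monotone v) (hmod : ∀ a b, v (a ⊔ b) + v (a ⊓ b) = v a + v b)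
    (a b c : α) : v (a ⊔ b ⊔ c) + v b ≤ v (a ⊔ b) + v (b ⊔ c) := by
  rw [← hmod (a ⊔ b) (b ⊔ c)]
  have h : a ⊔ b ⊔ (b ⊔ c) = a ⊔ b ⊔ c := by
    rw [← sup_assoc, sup_assoc a b b, sup_idem]
  rw [h]
  gcongr
  exact hmono (le_inf le_sup_right le_sup_left)

/-- The meet a ⊓ b serves as common information of a and b: its value is I(a:b), and conditionally
on x it is bounded by I(a:b|x). The claim reduces to v(z) ≤ v(z|c) + v(z|d) + I(c:d) for z = a ⊓ b,
which follows from modularity of v at z ⊔ c and z ⊔ d. -/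
theorem modular_ingleton (hmono : Monotone v)
    (hmod : ∀ a b, v (a ⊔ b) + v (a ⊓ b) = v a + v b) (a b c d : α) :
    v a + v b + v (c ⊔ d) + v (a ⊔ b ⊔ c) + v (a ⊔ b ⊔ d) ≤
      v (a ⊔ b) + v (a ⊔ c) + v (a ⊔ d) + v (b ⊔ c) + v (b ⊔ d) := by
  have key : ∀ x, v (a ⊓ b ⊔ x) + v (a ⊔ b ⊔ x) ≤ v (a ⊔ x) + v (b ⊔ x) := by
    intro x
    rw [← hmod (a ⊔ x) (b ⊔ x), ← sup_sup_distrib_right, add_comm]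
    gcongr
    exact hmono (sup_le (le_inf (inf_le_left.trans le_sup_left) (inf_le_right.trans le_sup_left))
      (le_inf le_sup_right le_sup_right))
  have h1 := hmod (a ⊓ b ⊔ c) (a ⊓ b ⊔ d)
  have h2 : v (a ⊓ b) ≤ v ((a ⊓ b ⊔ c) ⊓ (a ⊓ b ⊔ d)) :=
    hmono (le_inf le_sup_left le_sup_left)
  have h3 : v (c ⊔ d) ≤ v ((a ⊓ b ⊔ c) ⊔ (a ⊓ b ⊔ d)) :=
    hmono (sup_le_sup le_sup_right le_sup_right)
  linarith [key c, key d, hmod a b]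

variable [OrderBot α]

theorem modular_sa (hmono : Monotone v) (hmod : ∀ a b, v (a ⊔ b) + v (a ⊓ b) = v a + v b)
    (h0 : v ⊥ = 0) (a b : α) : v (a ⊔ b) ≤ v a + v b := by
  have := hmono (bot_le : ⊥ ≤ a ⊓ b)
  linarith [hmod a b]

/-- An entropy vector that differs from a modular rank function by additive terms for the parties
satisfies SA, SSA and Ingleton. -/
theorem mem_ingletonCone_of_modular (hmono : Monotone v)
    (hmod : ∀ a b, v (a ⊔ b) + v (a ⊓ b) = v a + v b) (h0 : v ⊥ = 0) {S : EntropyVector 4}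
    (U : Fin 5 → α) (w : Fin 5 → ℝ)
    (hS : ∀ K, purifiedValue S K = v (K.sup U) - ∑ i ∈ K, w i) : S ∈ ingletonCone := by
  rw [mem_ingletonCone_iff]
  intro i j k l hij hik hil hjk hjl hkl
  have h1 := modular_sa hmono hmod h0 (U i) (U j)
  have h2 := modular_ssa hmono hmod (U i) (U j) (U k)
  have h3 := modular_ingleton hmono hmod (U i) (U j) (U k) (U l)
  simp only [hS, Finset.sup_insert, Finset.sup_singleton, ← sup_assoc]
  have e2 : ∀ {i j : Fin 5}, i ≠ j → ∑ x ∈ ({i, j} : Finset (Fin 5)), w x = w i + w j :=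
    fun h => Finset.sum_pair h
  have e3 : ∀ {i j k : Fin 5}, i ≠ j → i ≠ k → j ≠ k →
      ∑ x ∈ ({i, j, k} : Finset (Fin 5)), w x = w i + (w j + w k) := fun h h' h'' => by
    rw [Finset.sum_insert (by simp [h, h']), Finset.sum_pair h'']
  rw [e2 hij, e2 hik, e2 hil, e2 hjk, e2 hjl, e2 hkl, e3 hij hik hjk, e3 hij hil hjl]
  simp only [Finset.sum_singleton]
  refine ⟨?_, ?_, ?_⟩ <;> linarith

end Modular

/-! ### Linear rank inequalities -/

namespace EntropyInequality

variable {n : ℕ}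

/-- The coefficients of an inequality, as a vector in entropy space. -/
def coeff (q : EntropyInequality n) : EntropyVector n := fun I =>
  (∑ l, if q.I l = I.1 then q.α l else 0) - ∑ r, if q.J r = I.1 then q.β r else 0

theorem sum_ite_eq_value (S : EntropyVector n) (K : Finset (Fin n)) (a : ℝ) :
    ∑ I : {I : Finset (Fin n) // I.Nonempty}, (if K = I.1 then a else 0) * S I =
      a * value S K := by
  by_cases hK : K.Nonempty
  · rw [value_nonempty _ hK, Finset.sum_eq_single ⟨K, hK⟩]
    · simp
    · intro I _ hI
      rw [if_neg fun h => hI (Subtype.ext h.symm), zero_mul]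
    · simp
  · rw [Finset.sum_eq_zero]
    · rw [Finset.not_nonempty_iff_eq_empty.1 hK, value_empty, mul_zero]
    · intro I _
      rw [if_neg fun h => hK (by rw [h]; exact I.2), zero_mul]

theorem sum_coeff_mul (q : EntropyInequality n) (S : EntropyVector n) :
    ∑ I, q.coeff I * S I =
      ∑ l, q.α l * value S (q.I l) - ∑ r, q.β r * value S (q.J r) := by
  simp only [coeff, sub_mul, Finset.sum_sub_distrib, Finset.sum_mul]
  congr 1 <;> (rw [Finset.sum_comm]; simp only [sum_ite_eq_value])

theorem holds_iff_sum_coeff_mul (q : EntropyInequality n) (S : EntropyVector n) :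
    q.Holds S ↔ 0 ≤ ∑ I, q.coeff I * S I := by
  rw [sum_coeff_mul, sub_nonneg, Holds]

/-- Balance at i is the equality of the two sides of the inequality at the vector that is 1 on the
sets containing i and 0 elsewhere. -/
theorem isBalanced_coeff (q : EntropyInequality n)
    (h : ∀ i, ∑ l, (if i ∈ q.I l then q.α l else 0) = ∑ r, if i ∈ q.J r then q.β r else 0) :
    IsBalanced q.coeff := by
  intro i
  have hval : ∀ K : Finset (Fin n),
      value (fun I => if i ∈ I.1 then 1 else 0) K = if i ∈ K then 1 else 0 := by
    intro K
    by_cases hK : K.Nonempty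
    · rw [value_nonempty _ hK]
    · simp [Finset.not_nonempty_iff_eq_empty.1 hK]
  have := q.sum_coeff_mul fun I => if i ∈ I.1 then 1 else 0
  simp only [hval, mul_ite, mul_one, mul_zero, h i, sub_self] at this
  exact this

end EntropyInequality

/-! ### Dimension as a modular function on subspaces -/

section Rank

variable {n : ℕ} {K E : Type} [Field K] [AddCommGroup E] [Module K E]

/-- The dimension of a subspace, as a real number. -/
noncomputable def realRank (W : Submodule K E) : ℝ := Module.finrank K W

theorem realRank_bot : realRank (⊥ : Submodule K E) = 0 := by simp [realRank]

theorem value_rankVector (U : Fin n → Submodule K E) (I : Finset (Fin n)) :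
    value (rankVector U) I = realRank (I.sup U) := by
  by_cases hI : I.Nonempty
  · rw [value_nonempty _ hI, rankVector, realRank, Finset.sup_eq_iSup]
  · rw [Finset.not_nonempty_iff_eq_empty.1 hI, value_empty, Finset.sup_empty, realRank_bot]

variable [FiniteDimensional K E]

theorem monotone_realRank : Monotone (realRank : Submodule K E → ℝ) :=
  fun _ _ h => Nat.cast_le.2 (Submodule.finrank_mono h)

theorem modular_realRank (W W' : Submodule K E) :
    realRank (W ⊔ W') + realRank (W ⊓ W') = realRank W + realRank W' := by
  unfold realRank
  exact_mod_cast Submodule.finrank_sup_add_finrank_inf_eq W W'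

end Rank

theorem isLinearRankInequality_SSA : IsLinearRankInequality SSA.coeff := by
  intro K E _ _ _ _ U
  rw [← EntropyInequality.holds_iff_sum_coeff_mul, SSA_holds_iff]
  simpa [value_rankVector, sup_assoc] using
    modular_ssa monotone_realRank modular_realRank (U 0) (U 1) (U 2)

theorem isLinearRankInequality_Ingleton : IsLinearRankInequality Ingleton.coeff := by
  intro K E _ _ _ _ U
  rw [← EntropyInequality.holds_iff_sum_coeff_mul, Ingleton_holds_iff]
  simpa [value_rankVector, sup_assoc] using
    modular_ingleton monotone_realRank modular_realRank (U 0) (U 1) (U 2) (U 3)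

theorem isBalanced_SSA : IsBalanced SSA.coeff := by
  refine EntropyInequality.isBalanced_coeff _ fun i => ?_
  change (∑ l : Fin 2, if i ∈ (![{0, 1}, {1, 2}] : Fin 2 → Finset (Fin 4)) l then (1 : ℝ) else 0) =
    ∑ r : Fin 2, if i ∈ (![{0, 1, 2}, {1}] : Fin 2 → Finset (Fin 4)) r then (1 : ℝ) else 0
  simp only [Finset.sum_boole, Nat.cast_inj]
  revert i; decide

theorem isBalanced_Ingleton : IsBalanced Ingleton.coeff := by
  refine EntropyInequality.isBalanced_coeff _ fun i => ?_
  change (∑ l : Fin 5, if i ∈ (![{0, 1}, {0, 2}, {0, 3}, {1, 2}, {1, 3}] :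
      Fin 5 → Finset (Fin 4)) l then (1 : ℝ) else 0) =
    ∑ r : Fin 5, if i ∈ (![{0}, {1}, {2, 3}, {0, 1, 2}, {0, 1, 3}] :
      Fin 5 → Finset (Fin 4)) r then (1 : ℝ) else 0
  simp only [Finset.sum_boole, Nat.cast_inj]
  revert i; decide

theorem quantumLinearRankCone_subset_ingletonCone : quantumLinearRankCone 4 ⊆ ingletonCone := by
  rintro S ⟨hSA, -, hQ⟩
  refine ⟨?_, fun σ => ?_, fun σ => ?_⟩
  · intro σ
    rw [SA_holds_iff]
    simp only [value_relabel, withPurifier]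
    have := hSA {σ 0} {σ 1} (by simp)
    simpa [Finset.map_insert] using this
  · rw [EntropyInequality.holds_iff_sum_coeff_mul]
    exact hQ _ isLinearRankInequality_SSA isBalanced_SSA σ
  · rw [EntropyInequality.holds_iff_sum_coeff_mul]
    exact hQ _ isLinearRankInequality_Ingleton isBalanced_Ingleton σ

/-! ### Membership in the quantum linear rank cone -/

section QLR

variable {n : ℕ}

theorem quantumLinearRankCone_add {S T : EntropyVector n} (hS : S ∈ quantumLinearRankCone n)
    (hT : T ∈ quantumLinearRankCone n) : S + T ∈ quantumLinearRankCone n := by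
  refine ⟨fun I J h => ?_, fun I J K h h' h'' => ?_, fun Q hQ hQ' σ => ?_⟩
  · simp only [purifiedValue_add]
    linarith [hS.1 I J h, hT.1 I J h]
  · simp only [purifiedValue_add]
    linarith [hS.2.1 I J K h h' h'', hT.2.1 I J K h h' h'']
  · simp only [relabel_add, Pi.add_apply, mul_add, Finset.sum_add_distrib]
    exact add_nonneg (hS.2.2 Q hQ hQ' σ) (hT.2.2 Q hQ hQ' σ)

theorem quantumLinearRankCone_smul {S : EntropyVector n} (hS : S ∈ quantumLinearRankCone n)
    {t : ℝ} (ht : 0 ≤ t) : t • S ∈ quantumLinearRankCone n := by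
  refine ⟨fun I J h => ?_, fun I J K h h' h'' => ?_, fun Q hQ hQ' σ => ?_⟩
  · simp only [purifiedValue_smul, ← mul_add]
    exact mul_le_mul_of_nonneg_left (hS.1 I J h) ht
  · simp only [purifiedValue_smul, ← mul_add]
    exact mul_le_mul_of_nonneg_left (hS.2.1 I J K h h' h'') ht
  · simp only [relabel_smul, Pi.smul_apply, smul_eq_mul, mul_left_comm _ t, ← Finset.mul_sum]
    exact mul_nonneg ht (hS.2.2 Q hQ hQ' σ)

theorem zero_mem_quantumLinearRankCone : (0 : EntropyVector n) ∈ quantumLinearRankCone n := by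
  have h0 : ∀ K, purifiedValue (0 : EntropyVector n) K = 0 := fun K => by
    simpa using purifiedValue_smul 0 (0 : EntropyVector n) K
  refine ⟨fun I J _ => by simp [h0], fun I J K _ _ _ => by simp [h0], fun Q _ _ σ => ?_⟩
  simp [relabel, h0]

/-- An entropy vector that differs from a rank vector, of subspaces attached to all the parties of
the purified system, by additive terms for the parties is in the quantum linear rank cone. -/
theorem mem_quantumLinearRankCone_of_finrank {K E : Type} [Field K] [AddCommGroup E] [Module K E]
    [FiniteDimensional K E] {S : EntropyVector n} (U : Fin (n + 1) → Submodule K E)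
    (w : Fin (n + 1) → ℝ)
    (hS : ∀ I, purifiedValue S I = realRank (I.sup U) - ∑ i ∈ I, w i) :
    S ∈ quantumLinearRankCone n := by
  have hSA : ∀ I J : Finset (Fin (n + 1)), Disjoint I J →
      purifiedValue S (I ∪ J) ≤ purifiedValue S I + purifiedValue S J := by
    intro I J h
    have := modular_sa monotone_realRank modular_realRank realRank_bot (I.sup U) (J.sup U)
    rw [hS, hS, hS, Finset.sum_union h, Finset.sup_union]
    linarith
  have hSSA : ∀ I J M : Finset (Fin (n + 1)), Disjoint I J → Disjoint J M → Disjoint I M →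
      purifiedValue S (I ∪ J ∪ M) + purifiedValue S J ≤
        purifiedValue S (I ∪ J) + purifiedValue S (J ∪ M) := by
    intro I J M h h' h''
    have := modular_ssa monotone_realRank modular_realRank (I.sup U) (J.sup U) (M.sup U)
    rw [hS, hS, hS, hS, Finset.sum_union h, Finset.sum_union h',
      Finset.sum_union (Finset.disjoint_union_left.2 ⟨h'', h'⟩), Finset.sum_union h]
    simp only [Finset.sup_union]
    linarith
  refine ⟨hSA, fun I J M h h' h'' => ?_, fun Q hQ hQ' σ => ?_⟩
  -- Weak monotonicity is the purified form of SSA: replace I by the complement of I ∪ J ∪ M,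
  -- condition on M, and take complements.
  · have hd : Disjoint (I ∪ J ∪ M)ᶜ M := by
      rw [Finset.disjoint_left]
      intro x hx hx'
      simp [hx'] at hx
    have hd' : Disjoint (I ∪ J ∪ M)ᶜ J := by
      rw [Finset.disjoint_left]
      intro x hx hx'
      simp [hx'] at hx
    have := hSSA (I ∪ J ∪ M)ᶜ M J hd h'.symm hd'
    have e1 : (I ∪ J ∪ M)ᶜ ∪ M = (I ∪ J)ᶜ := by
      ext x
      have : x ∈ _ → x ∉ _ := fun hx => Finset.disjoint_left.1 h' hx
      have : x ∈ _ → x ∉ _ := fun hx => Finset.disjoint_left.1 h'' hx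
      simp only [Finset.mem_union, Finset.mem_compl]
      tauto
    have e2 : (I ∪ J)ᶜ ∪ J = Iᶜ := by
      ext x
      have : x ∈ _ → x ∉ _ := fun hx => Finset.disjoint_left.1 h hx
      simp only [Finset.mem_union, Finset.mem_compl]
      tauto
    rw [e1, e2, purifiedValue_compl, purifiedValue_compl, Finset.union_comm M J] at this
    exact this
  · have hval : ∀ I : {I : Finset (Fin n) // I.Nonempty}, relabel σ S I =
        rankVector (fun i => U (σ i.castSucc)) I - ∑ i, if i ∈ I.1 then w (σ i.castSucc) else 0 := by
      intro I
      rw [relabel, hS, ← value_coe (rankVector _), value_rankVector, withPurifier,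
        Finset.sup_map, Finset.sup_map, Finset.sum_map, Finset.sum_map, ← Finset.sum_filter]
      congr 1
      refine Finset.sum_congr ?_ fun _ _ => rfl
      ext i; simp
    -- The term of each party i carries the factor given by the sum of Q over the sets containing i,
    -- which vanishes by balance.
    have hbal : ∑ I : {I : Finset (Fin n) // I.Nonempty},
        Q I * ∑ i, (if i ∈ I.1 then w (σ i.castSucc) else 0) = 0 := by
      simp only [Finset.mul_sum]
      rw [Finset.sum_comm]
      refine Finset.sum_eq_zero fun i _ => ?_
      have := congrArg (· * w (σ i.castSucc)) (hQ' i)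
      simp only [Finset.sum_mul, zero_mul] at this
      refine Eq.trans (Finset.sum_congr rfl fun I _ => ?_) this
      split_ifs
      · rfl
      · rw [mul_zero, zero_mul]
    simp only [hval, mul_sub, Finset.sum_sub_distrib, hbal, sub_zero]
    exact hQ K E _

end QLR

/-! ### Stabilizer states -/

section Character

variable {d : ℕ} [NeZero d] {κ : Type*} [Fintype κ]

/-- The character `exp(2πi b⋅x / d)`. -/
noncomputable def dotChar (b x : κ → ZMod d) : ℂ := ZMod.stdAddChar (b ⬝ᵥ x)

theorem dotChar_add_left (b b' x : κ → ZMod d) :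
    dotChar (b + b') x = dotChar b x * dotChar b' x := by
  rw [dotChar, add_dotProduct, AddChar.map_add_eq_mul]; rfl

theorem dotChar_add_right (b x x' : κ → ZMod d) :
    dotChar b (x + x') = dotChar b x * dotChar b x' := by
  rw [dotChar, dotProduct_add, AddChar.map_add_eq_mul]; rfl

@[simp] theorem dotChar_zero_left (x : κ → ZMod d) : dotChar 0 x = 1 := by simp [dotChar]

@[simp] theorem norm_dotChar (b x : κ → ZMod d) : ‖dotChar b x‖ = 1 := AddChar.norm_apply _ _

theorem dotChar_ne_zero (b x : κ → ZMod d) : dotChar b x ≠ 0 :=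
  norm_ne_zero_iff.1 (by rw [norm_dotChar]; exact one_ne_zero)

theorem dotChar_eq_prod (b x : κ → ZMod d) :
    dotChar b x = ∏ q, ZMod.stdAddChar (b q * x q) := by
  rw [dotChar, dotProduct]
  induction (Finset.univ : Finset κ) using Finset.cons_induction with
  | empty => simp
  | cons q s hq ih => rw [Finset.sum_cons, Finset.prod_cons, AddChar.map_add_eq_mul, ih]

theorem sum_dotChar [DecidableEq κ] (b : κ → ZMod d) :
    ∑ x, dotChar b x = if b = 0 then (d : ℂ) ^ Fintype.card κ else 0 := by
  simp only [dotChar_eq_prod]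
  rw [← Fintype.piFinset_univ, ← Finset.prod_univ_sum (fun _ => Finset.univ)
    (fun q t => (ZMod.stdAddChar (b q * t) : ℂ))]
  have h : ∀ q, ∑ t, (ZMod.stdAddChar (b q * t) : ℂ) = if b q = 0 then (d : ℂ) else 0 := by
    intro q
    simp only [mul_comm (b q)]
    rw [AddChar.sum_mulShift _ (ZMod.isPrimitive_stdAddChar d), ZMod.card]
    split_ifs <;> simp
  simp only [h]
  rw [Finset.prod_ite_zero]
  simp [funext_iff]

theorem pauliString_apply {ι : Type} [Fintype ι] [DecidableEq ι] (a b x y : ι → ZMod d) :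
    pauliString a b x y = if x = y + a then dotChar b y else 0 := by
  simp only [pauliString, pauli, Matrix.of_apply]
  rw [Finset.prod_ite_zero, dotChar_eq_prod]
  simp [funext_iff]

/-- Turns the eigenvector equation into a rule for translations, so that later arguments need no
matrix products. -/
theorem smul_pauliString_mulVec_eq_iff {ι : Type} [Fintype ι] [DecidableEq ι] (c : ℂ)
    (a b : ι → ZMod d) (φ : (ι → ZMod d) → ℂ) :
    (c • pauliString a b).mulVec φ = φ ↔ ∀ x, φ (x + a) = c * dotChar b x * φ x := by
  have h : ∀ x, (c • pauliString a b).mulVec φ (x + a) = c * dotChar b x * φ x := by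
    intro x
    rw [Matrix.smul_mulVec, Pi.smul_apply, Matrix.mulVec, dotProduct, Finset.sum_eq_single x]
    · rw [pauliString_apply, if_pos rfl, smul_eq_mul, mul_assoc]
    · intro y _ hy
      rw [pauliString_apply, if_neg fun h => hy (add_right_cancel h).symm, zero_mul]
    · simp
  constructor
  · intro h' x
    rw [← h, h']
  · intro h'
    funext x
    have := h (x - a)
    rw [← h', sub_add_cancel] at this
    exact this

end Character

/-! ### Sums of Pauli operators over a group -/

section PauliSum

variable {d : ℕ} [NeZero d] {κ : Type*} [Fintype κ] [DecidableEq κ] {H : Type*} [AddCommGroup H]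
  [Fintype H]

/-- The sum of the Pauli operators of a family that is indexed by a group. -/
noncomputable def pauliSum (α β : H →+ (κ → ZMod d)) (c : H → ℂ) :
    Matrix (κ → ZMod d) (κ → ZMod d) ℂ :=
  Matrix.of fun x x' => ∑ g, if x = x' + α g then c g * dotChar (β g) x' else 0

variable {α β : H →+ (κ → ZMod d)} {c : H → ℂ}

/-- The cocycle condition says that the operators multiply as in the group, so multiplying the sum
by one of them merely permutes the summands. -/
theorem pauliSum_add_left (hc : ∀ g h, c (g + h) = c g * c h * dotChar (β h) (α g)) (h : H)
    (x x' : κ → ZMod d) :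
    pauliSum α β c (x + α h) x' = c h * dotChar (β h) x * pauliSum α β c x x' := by
  simp only [pauliSum, Matrix.of_apply, Finset.mul_sum]
  rw [← Equiv.sum_comp (Equiv.addRight h)]
  refine Finset.sum_congr rfl fun g _ => ?_
  simp only [Equiv.coe_addRight, map_add, ← add_assoc, add_left_inj, hc, mul_ite, mul_zero]
  split_ifs with hx
  · rw [hx, dotChar_add_left, dotChar_add_right]
    ring
  · rfl

/-- Every operator of the family fixes the sum, so the sum times itself is the group order times the
sum. -/
theorem pauliSum_mul_self (hc : ∀ g h, c (g + h) = c g * c h * dotChar (β h) (α g)) :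
    pauliSum α β c * pauliSum α β c = (Fintype.card H : ℂ) • pauliSum α β c := by
  ext x x'
  have : ∀ g, ∑ y, (if x = y + α g then c g * dotChar (β g) y else 0) * pauliSum α β c y x' =
      pauliSum α β c x x' := by
    intro g
    rw [Finset.sum_eq_single (x - α g)]
    · rw [if_pos (sub_add_cancel _ _).symm, ← pauliSum_add_left hc, sub_add_cancel]
    · intro y _ hy
      rw [if_neg fun h => hy (by rw [h, add_sub_cancel_right]), zero_mul]
    · simp
  rw [Matrix.mul_apply]
  conv_lhs =>
    enter [2, y, 1]
    rw [pauliSum, Matrix.of_apply]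
  simp only [Finset.sum_mul]
  rw [Finset.sum_comm, Finset.sum_congr rfl fun g _ => this g]
  simp

end PauliSum

/-! ### The stabilizer group of a state and the projector onto it -/

section StabilizerGroup

variable {d : ℕ} [NeZero d] {ι : Type} [Fintype ι] [DecidableEq ι]

/-- The Pauli operators, up to phases, that stabilize a state. -/
def stabilizerGroup (ψ : (ι → ZMod d) → ℂ) : AddSubgroup ((ι → ZMod d) × (ι → ZMod d)) where
  carrier := {g | ∃ c : ℂ, c ≠ 0 ∧ ∀ x, ψ (x + g.1) = c * dotChar g.2 x * ψ x}
  zero_mem' := ⟨1, one_ne_zero, by simp⟩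
  add_mem' := by
    rintro g h ⟨c, hc, hg⟩ ⟨c', hc', hh⟩
    refine ⟨c * c' * dotChar h.2 g.1, mul_ne_zero (mul_ne_zero hc hc') (dotChar_ne_zero _ _),
      fun x => ?_⟩
    rw [Prod.fst_add, ← add_assoc, hh, hg, Prod.snd_add, dotChar_add_left, dotChar_add_right]
    ring
  neg_mem' := by
    rintro g ⟨c, hc, hg⟩
    refine ⟨c⁻¹ * dotChar g.2 g.1, mul_ne_zero (inv_ne_zero hc) (dotChar_ne_zero _ _),
      fun x => ?_⟩
    have h := hg (x - g.1)
    have h' : dotChar g.2 x = dotChar g.2 (x - g.1) * dotChar g.2 g.1 := by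
      rw [← dotChar_add_right, sub_add_cancel]
    have h'' : dotChar (-g.2) x * dotChar g.2 x = 1 := by
      rw [← dotChar_add_left, neg_add_cancel, dotChar_zero_left]
    rw [sub_add_cancel] at h
    rw [Prod.fst_neg, ← sub_eq_add_neg, h, Prod.snd_neg]
    calc ψ (x - g.1) = (c⁻¹ * c) * (dotChar (-g.2) x * dotChar g.2 x) * ψ (x - g.1) := by
          rw [inv_mul_cancel₀ hc, h'', one_mul, one_mul]
      _ = _ := by rw [h']; ring

noncomputable instance (ψ : (ι → ZMod d) → ℂ) : Fintype (stabilizerGroup ψ) := Fintype.ofFinite _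

/-- The phase with which a Pauli operator stabilizes a state. -/
noncomputable def stabilizerPhase (ψ : (ι → ZMod d) → ℂ) (g : stabilizerGroup ψ) : ℂ :=
  g.2.choose

theorem stabilizerPhase_spec (ψ : (ι → ZMod d) → ℂ) (g : stabilizerGroup ψ) (x : ι → ZMod d) :
    ψ (x + g.1.1) = stabilizerPhase ψ g * dotChar g.1.2 x * ψ x :=
  g.2.choose_spec.2 x

theorem eq_stabilizerPhase {ψ : (ι → ZMod d) → ℂ} (hψ : ψ ≠ 0) (g : stabilizerGroup ψ) {c : ℂ}
    (h : ∀ x, ψ (x + g.1.1) = c * dotChar g.1.2 x * ψ x) : c = stabilizerPhase ψ g := by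
  obtain ⟨x, hx⟩ := Function.ne_iff.1 hψ
  have := (h x).symm.trans (stabilizerPhase_spec ψ g x)
  exact mul_right_cancel₀ (dotChar_ne_zero _ _) (mul_right_cancel₀ hx this)

/-- The extra character comes from moving the Z-part of one Pauli operator past the X-part of the
other; this is the cocycle condition required by `pauliSum`. -/
theorem stabilizerPhase_add {ψ : (ι → ZMod d) → ℂ} (hψ : ψ ≠ 0) (g h : stabilizerGroup ψ) :
    stabilizerPhase ψ (g + h) =
      stabilizerPhase ψ g * stabilizerPhase ψ h * dotChar h.1.2 g.1.1 := by
  refine (eq_stabilizerPhase hψ _ fun x => ?_).symm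
  rw [AddSubgroup.coe_add, Prod.fst_add, ← add_assoc, stabilizerPhase_spec ψ h,
    stabilizerPhase_spec ψ g, Prod.snd_add, dotChar_add_left, dotChar_add_right]
  ring

/-- Translation permutes the absolute values of the amplitudes up to the factor |c|, so comparing
their sums gives |c| = 1. -/
theorem norm_stabilizerPhase {ψ : (ι → ZMod d) → ℂ} (hψ : ψ ≠ 0) (g : stabilizerGroup ψ) :
    ‖stabilizerPhase ψ g‖ = 1 := by
  have h : ∑ x, ‖ψ x‖ = ‖stabilizerPhase ψ g‖ * ∑ x, ‖ψ x‖ := by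
    conv_lhs => rw [← Equiv.sum_comp (Equiv.addRight g.1.1)]
    simp only [Equiv.coe_addRight, stabilizerPhase_spec, norm_mul, norm_dotChar, mul_one,
      Finset.mul_sum]
  have hpos : ∑ x, ‖ψ x‖ ≠ 0 := by
    intro h0
    refine hψ (funext fun x => ?_)
    simpa using (Finset.sum_eq_zero_iff_of_nonneg fun _ _ => norm_nonneg _).1 h0 x
  exact mul_right_cancel₀ hpos (by rw [← h, one_mul])

/-- The `X`-part of the stabilizer group. -/
def stabilizerX (ψ : (ι → ZMod d) → ℂ) : stabilizerGroup ψ →+ (ι → ZMod d) :=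
  (AddMonoidHom.fst _ _).comp (stabilizerGroup ψ).subtype

/-- The `Z`-part of the stabilizer group. -/
def stabilizerZ (ψ : (ι → ZMod d) → ℂ) : stabilizerGroup ψ →+ (ι → ZMod d) :=
  (AddMonoidHom.snd _ _).comp (stabilizerGroup ψ).subtype

/-- The sum of the Pauli operators that stabilize a state. -/
noncomputable def stabilizerSum (ψ : (ι → ZMod d) → ℂ) :
    Matrix (ι → ZMod d) (ι → ZMod d) ℂ :=
  pauliSum (stabilizerX ψ) (stabilizerZ ψ) (stabilizerPhase ψ)

namespace IsStabilizerState

variable {ψ : (ι → ZMod d) → ℂ}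

theorem ne_zero (hψ : IsStabilizerState ψ) : ψ ≠ 0 := by
  rintro rfl
  simpa using hψ.1

theorem sum_conj_mul_self (hψ : IsStabilizerState ψ) :
    ∑ x, (starRingEnd ℂ) (ψ x) * ψ x = 1 := by
  simp only [Complex.conj_mul', ← Complex.ofReal_pow, ← Complex.ofReal_sum, hψ.1,
    Complex.ofReal_one]

/-- Each column of the sum is fixed by all operators in the defining set G, hence is a multiple of ψ
by uniqueness. -/
theorem stabilizerSum_isFixed (hψ : IsStabilizerState ψ) (x' : ι → ZMod d) :
    ∃ z : ℂ, ∀ x, stabilizerSum ψ x x' = z * ψ x := by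
  have h0 := hψ.ne_zero
  obtain ⟨-, G, hG, hfix⟩ := hψ
  have hself : ∀ M ∈ G, M.mulVec ψ = ψ := (hfix ψ).2 ⟨1, (one_smul _ _).symm⟩
  have key : ∀ M ∈ G, M.mulVec (fun x => stabilizerSum ψ x x') = fun x => stabilizerSum ψ x x' := by
    intro M hM
    obtain ⟨c, a, b, hc, rfl⟩ := hG M hM
    have hs := (smul_pauliString_mulVec_eq_iff c a b ψ).1 (hself _ hM)
    let g : stabilizerGroup ψ := ⟨(a, b), c, norm_ne_zero_iff.1 (by rw [hc]; exact one_ne_zero), hs⟩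
    rw [smul_pauliString_mulVec_eq_iff, eq_stabilizerPhase h0 g hs]
    exact fun x => pauliSum_add_left (α := stabilizerX ψ) (β := stabilizerZ ψ)
      (stabilizerPhase_add h0) g x x'
  obtain ⟨z, hz⟩ := (hfix _).1 key
  exact ⟨z, fun x => congrFun hz x⟩

/-- The projector on a stabilizer state is the average of its stabilizer group. -/
theorem stabilizerSum_eq (hψ : IsStabilizerState ψ) (x x' : ι → ZMod d) :
    stabilizerSum ψ x x' =
      Fintype.card (stabilizerGroup ψ) * (ψ x * (starRingEnd ℂ) (ψ x')) := by
  have h0 := hψ.ne_zero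
  obtain ⟨z, hz⟩ := hψ.stabilizerSum_isFixed x'
  -- Pair the column with the conjugate of ψ: every stabilizing operator contributes the conjugate
  -- of ψ x', because its phase and character have modulus one.
  have hz' : z = Fintype.card (stabilizerGroup ψ) * (starRingEnd ℂ) (ψ x') := by
    have h1 : ∑ x, (starRingEnd ℂ) (ψ x) * stabilizerSum ψ x x' = z := by
      simp only [hz, mul_left_comm _ z, ← Finset.mul_sum, hψ.sum_conj_mul_self, mul_one]
    have : ∀ g : stabilizerGroup ψ, ∑ x, (starRingEnd ℂ) (ψ x) *
        (if x = x' + stabilizerX ψ g then stabilizerPhase ψ g * dotChar (stabilizerZ ψ g) x'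
          else 0) = (starRingEnd ℂ) (ψ x') := by
      intro g
      simp only [mul_ite, mul_zero, Finset.sum_ite_eq', Finset.mem_univ, if_true]
      have hg : ψ (x' + stabilizerX ψ g) = _ := stabilizerPhase_spec ψ g x'
      rw [hg, map_mul, mul_right_comm]
      change (starRingEnd ℂ) _ * (stabilizerPhase ψ g * dotChar g.1.2 x') * _ = _
      rw [Complex.conj_mul', norm_mul, norm_stabilizerPhase h0, norm_dotChar]
      simp
    rw [← h1]
    simp only [stabilizerSum, pauliSum, Matrix.of_apply, Finset.mul_sum]
    rw [Finset.sum_comm, Finset.sum_congr rfl fun g _ => this g]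
    simp
  rw [hz, hz']
  ring

end IsStabilizerState

end StabilizerGroup

/-! ### Entropies of stabilizer states -/

section Glue

variable {d : ℕ} {ι : Type} [Fintype ι] [DecidableEq ι] (s : Finset ι)

@[simp] theorem glue_apply_mem (x : {q // q ∈ s} → ZMod d) (y : {q // q ∉ s} → ZMod d)
    (q : {q // q ∈ s}) : glue s x y q = x q := dif_pos q.2

@[simp] theorem glue_apply_notMem (x : {q // q ∈ s} → ZMod d) (y : {q // q ∉ s} → ZMod d)
    (q : {q // q ∉ s}) : glue s x y q = y q := dif_neg q.2

theorem eq_iff_restrict_eq {f g : ι → ZMod d} :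
    f = g ↔ (∀ q : {q // q ∈ s}, f q = g q) ∧ ∀ q : {q // q ∉ s}, f q = g q := by
  refine ⟨by rintro rfl; simp, fun h => funext fun q => ?_⟩
  by_cases hq : q ∈ s
  exacts [h.1 ⟨q, hq⟩, h.2 ⟨q, hq⟩]

theorem sum_mem_add_sum_notMem {M : Type*} [AddCommMonoid M] (f : ι → M) :
    ∑ q : {q // q ∈ s}, f q + ∑ q : {q // q ∉ s}, f q = ∑ q, f q := by
  convert Fintype.sum_subtype_add_sum_subtype (· ∈ s) f

theorem sum_glue [NeZero d] (f : (ι → ZMod d) → ℂ) : ∑ x, ∑ y, f (glue s x y) = ∑ z, f z := by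
  rw [← Fintype.sum_prod_type' (f := fun x y => f (glue s x y))]
  exact (Equiv.piEquivPiSubtypeProd (· ∈ s) fun _ => ZMod d).symm.sum_comp f

theorem dotChar_glue [NeZero d] (b : ι → ZMod d) (x : {q // q ∈ s} → ZMod d)
    (y : {q // q ∉ s} → ZMod d) :
    dotChar b (glue s x y) = dotChar (fun q : {q // q ∈ s} => b q) x *
      dotChar (fun q : {q // q ∉ s} => b q) y := by
  rw [dotChar, dotChar, dotChar, ← AddChar.map_add_eq_mul]
  congr 1
  simp only [dotProduct]
  rw [← sum_mem_add_sum_notMem s]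
  simp only [glue_apply_mem, glue_apply_notMem]

/-- In this form the purity is symmetric under exchanging the roles of the qudits inside and outside
of `s`, which gives equal purities for a set and its complement. -/
theorem trace_reducedDensity_sq [NeZero d] (ψ : (ι → ZMod d) → ℂ) :
    (reducedDensity ψ s * reducedDensity ψ s).trace =
      ∑ z, ∑ w, ψ z * (starRingEnd ℂ) (ψ (s.piecewise w z)) *
        (ψ w * (starRingEnd ℂ) (ψ (s.piecewise z w))) := by
  have hpw : ∀ x x' y y', s.piecewise (glue s x' y') (glue s x y) = (glue s x' y : ι → ZMod d) := by
    intro x x' y y'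
    rw [eq_iff_restrict_eq s]
    constructor <;> intro q
    · rw [Finset.piecewise_eq_of_mem _ _ _ q.2]; simp
    · rw [Finset.piecewise_eq_of_notMem _ _ _ q.2]; simp
  rw [← sum_glue s]
  simp only [Matrix.trace, Matrix.diag, Matrix.mul_apply, reducedDensity, Matrix.of_apply]
  refine Finset.sum_congr rfl fun x _ => ?_
  have : ∀ y, ∑ w, ψ (glue s x y) * (starRingEnd ℂ) (ψ (s.piecewise w (glue s x y))) *
        (ψ w * (starRingEnd ℂ) (ψ (s.piecewise (glue s x y) w))) =
      ∑ x', ∑ y', ψ (glue s x y) * (starRingEnd ℂ) (ψ (glue s x' y)) *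
        (ψ (glue s x' y') * (starRingEnd ℂ) (ψ (glue s x y'))) := by
    intro y
    rw [← sum_glue s]
    simp only [hpw]
  simp only [this, Finset.sum_mul_sum]
  exact Finset.sum_comm

theorem trace_reducedDensity_sq_compl [NeZero d] (ψ : (ι → ZMod d) → ℂ) :
    (reducedDensity ψ sᶜ * reducedDensity ψ sᶜ).trace =
      (reducedDensity ψ s * reducedDensity ψ s).trace := by
  simp only [trace_reducedDensity_sq, Finset.piecewise_compl]
  refine Finset.sum_congr rfl fun z _ => Finset.sum_congr rfl fun w _ => ?_
  ring

end Glue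

section Spectrum

/-- The entropy of a density matrix with a flat spectrum. -/
theorem sum_negMulLog_eigenvalues {n : Type*} [Fintype n] [DecidableEq n] {ρ : Matrix n n ℂ}
    (h : ρ.IsHermitian) {c : ℝ} (hsq : ρ * ρ = (c : ℂ) • ρ) (htr : ρ.trace = 1) :
    ∑ j, Real.negMulLog (h.eigenvalues j) = -Real.log c := by
  have hsum : ∑ j, h.eigenvalues j = 1 := by
    have := h.trace_eq_sum_eigenvalues
    rw [htr] at this
    simpa using (congrArg Complex.re this).symm
  -- An eigenvalue e satisfies e² = ce, so it is 0 or c; then λ log λ = λ log c for every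
  -- eigenvalue, and the eigenvalues sum to 1.
  have hev : ∀ j, h.eigenvalues j = 0 ∨ h.eigenvalues j = c := by
    intro j
    set e := h.eigenvalues j with he
    have h1 := h.mulVec_eigenvectorBasis j
    have h2 : (ρ * ρ).mulVec (h.eigenvectorBasis j).ofLp =
        (e * e) • (h.eigenvectorBasis j).ofLp := by
      rw [← Matrix.mulVec_mulVec, h1, Matrix.mulVec_smul, h1, smul_smul]
    rw [hsq, Matrix.smul_mulVec, h1] at h2
    have hne : (h.eigenvectorBasis j).ofLp ≠ 0 := by
      intro h0
      have := h.eigenvectorBasis.orthonormal.ne_zero j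
      exact this (WithLp.ofLp_injective 2 h0)
    obtain ⟨i, hi⟩ := Function.ne_iff.1 hne
    have h3 := congrFun h2 i
    simp only [Pi.smul_apply, Complex.real_smul, smul_eq_mul, ← mul_assoc] at h3
    have h4 := mul_right_cancel₀ hi h3
    have h5 : c * e = e * e := by exact_mod_cast h4
    by_cases he0 : e = 0
    · exact Or.inl he0
    · exact Or.inr (mul_right_cancel₀ he0 h5).symm
  have : ∀ j, Real.negMulLog (h.eigenvalues j) = h.eigenvalues j * -Real.log c := by
    intro j
    rcases hev j with h0 | h0 <;> rw [h0] <;> simp [Real.negMulLog]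
  simp only [this, ← Finset.sum_mul, hsum, one_mul]

end Spectrum

/-! ### Reduced states of stabilizer states -/

section LocalGroup

variable {d : ℕ} [NeZero d] {ι : Type} [Fintype ι] [DecidableEq ι] (ψ : (ι → ZMod d) → ℂ)

/-- The elements of the stabilizer group that are trivial on the qudits in `t`. -/
def trivialOn (t : Finset ι) : AddSubgroup (stabilizerGroup ψ) where
  carrier := {g | ∀ q ∈ t, stabilizerX ψ g q = 0 ∧ stabilizerZ ψ g q = 0}
  zero_mem' := by simp
  add_mem' := by
    intro g h hg hh q hq
    simp [(hg q hq).1, (hg q hq).2, (hh q hq).1, (hh q hq).2]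
  neg_mem' := by
    intro g hg q hq
    simp [(hg q hq).1, (hg q hq).2]

theorem mem_trivialOn {t : Finset ι} {g : stabilizerGroup ψ} :
    g ∈ trivialOn ψ t ↔ ∀ q ∈ t, stabilizerX ψ g q = 0 ∧ stabilizerZ ψ g q = 0 := Iff.rfl

noncomputable instance (t : Finset ι) : Fintype (trivialOn ψ t) := Fintype.ofFinite _

variable (s : Finset ι)

/-- Restriction of vectors to the qudits in `s`. -/
def restrictTo : (ι → ZMod d) →+ ({q // q ∈ s} → ZMod d) where
  toFun f q := f q
  map_zero' := rfl
  map_add' _ _ := rfl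

/-- The sum of the Pauli operators that stabilize a state and act on the qudits in `s`. -/
noncomputable def localSum : Matrix ({q // q ∈ s} → ZMod d) ({q // q ∈ s} → ZMod d) ℂ :=
  pauliSum (((restrictTo s).comp (stabilizerX ψ)).comp (trivialOn ψ sᶜ).subtype)
    (((restrictTo s).comp (stabilizerZ ψ)).comp (trivialOn ψ sᶜ).subtype)
    (fun g => stabilizerPhase ψ g)

variable {ψ}

/-- The cocycle of the phases pairs X- and Z-parts over all qudits; for elements trivial outside `s`
only the qudits in `s` contribute, so the restricted family satisfies the same cocycle condition. -/
theorem localSum_mul_self (h0 : ψ ≠ 0) :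
    localSum ψ s * localSum ψ s = (Fintype.card (trivialOn ψ sᶜ) : ℂ) • localSum ψ s := by
  refine pauliSum_mul_self fun g h => ?_
  change stabilizerPhase ψ (g.1 + h.1) = _
  rw [stabilizerPhase_add h0]
  congr 1
  change dotChar (stabilizerZ ψ h.1) (stabilizerX ψ g.1) =
    dotChar (restrictTo s (stabilizerZ ψ h.1)) (restrictTo s (stabilizerX ψ g.1))
  rw [dotChar, dotChar]
  congr 1
  simp only [dotProduct]
  rw [← sum_mem_add_sum_notMem s]
  have : ∑ q : {q // q ∉ s}, stabilizerZ ψ h.1 q * stabilizerX ψ g.1 q = 0 :=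
    Finset.sum_eq_zero fun q _ => by
      rw [(h.2 q (Finset.mem_compl.2 q.2)).2, zero_mul]
  rw [this, add_zero]
  rfl

namespace IsStabilizerState

/-- Take the partial trace of the averaged stabilizer group: a Pauli operator survives only if it is
trivial on the traced-out qudits, and each of those qudits then contributes a factor d. -/
theorem reducedDensity_eq (hψ : IsStabilizerState ψ) :
    reducedDensity ψ s = ((d : ℂ) ^ Fintype.card {q // q ∉ s} / Fintype.card (stabilizerGroup ψ)) •
      localSum ψ s := by
  classical
  ext x x'
  have hL : (Fintype.card (stabilizerGroup ψ) : ℂ) ≠ 0 :=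
    Nat.cast_ne_zero.2 Fintype.card_ne_zero
  rw [Matrix.smul_apply, smul_eq_mul, div_mul_eq_mul_div, eq_div_iff hL, mul_comm]
  simp only [reducedDensity, Matrix.of_apply, Finset.mul_sum, ← hψ.stabilizerSum_eq]
  simp only [stabilizerSum, pauliSum, Matrix.of_apply, localSum]
  rw [Finset.sum_comm]
  have key : ∀ g : stabilizerGroup ψ,
      ∑ y, (if glue s x y = glue s x' y + stabilizerX ψ g then
          stabilizerPhase ψ g * dotChar (stabilizerZ ψ g) (glue s x' y) else 0) =
        if g ∈ trivialOn ψ sᶜ then (d : ℂ) ^ Fintype.card {q // q ∉ s} *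
          (if x = x' + restrictTo s (stabilizerX ψ g) then
            stabilizerPhase ψ g * dotChar (restrictTo s (stabilizerZ ψ g)) x' else 0)
        else 0 := by
    intro g
    have hiff : ∀ y, glue s x y = glue s x' y + stabilizerX ψ g ↔
        x = x' + restrictTo s (stabilizerX ψ g) ∧
          ∀ q : {q // q ∉ s}, stabilizerX ψ g q = 0 := by
      intro y
      rw [eq_iff_restrict_eq s]
      simp [funext_iff, restrictTo]
    have hmem : g ∈ trivialOn ψ sᶜ ↔ (∀ q : {q // q ∉ s}, stabilizerX ψ g q = 0) ∧
        (fun q : {q // q ∉ s} => stabilizerZ ψ g q) = 0 := by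
      simp only [mem_trivialOn, Finset.mem_compl, funext_iff, Pi.zero_apply, Subtype.forall]
      exact ⟨fun h => ⟨fun q hq => (h q hq).1, fun q hq => (h q hq).2⟩,
        fun h q hq => ⟨h.1 q hq, h.2 q hq⟩⟩
    simp only [hiff, hmem]
    by_cases hx : x = x' + restrictTo s (stabilizerX ψ g)
    · by_cases hX : ∀ q : {q // q ∉ s}, stabilizerX ψ g q = 0
      · simp only [hx, hX, dotChar_glue, implies_true, and_self, if_true, true_and,
          ← mul_assoc, ← Finset.mul_sum, sum_dotChar]
        split_ifs
        · rw [mul_comm, ← mul_assoc]; rfl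
        · rw [mul_zero]
      · rw [if_neg fun h => hX h.1]
        exact Finset.sum_eq_zero fun y _ => if_neg fun h => hX h.2
    · simp [hx]
  rw [Finset.sum_congr rfl fun g _ => key g, ← Finset.sum_filter,
    Finset.sum_subtype (p := (· ∈ trivialOn ψ sᶜ)) _ (by simp), Finset.mul_sum]
  rfl

/-- The nonzero eigenvalue of a reduced density matrix of a stabilizer state. -/
theorem reducedDensity_sq (hψ : IsStabilizerState ψ) :
    reducedDensity ψ s * reducedDensity ψ s =
      (((d : ℝ) ^ Fintype.card {q // q ∉ s} * Fintype.card (trivialOn ψ sᶜ) /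
        Fintype.card (stabilizerGroup ψ) : ℝ) : ℂ) • reducedDensity ψ s := by
  rw [hψ.reducedDensity_eq, Matrix.smul_mul, Matrix.mul_smul, localSum_mul_self s hψ.ne_zero]
  simp only [smul_smul]
  congr 1
  push_cast
  ring

theorem trace_reducedDensity (hψ : IsStabilizerState ψ) : (reducedDensity ψ s).trace = 1 := by
  simp only [Matrix.trace, Matrix.diag, reducedDensity, Matrix.of_apply]
  rw [sum_glue s fun z => ψ z * (starRingEnd ℂ) (ψ z)]
  simp only [mul_comm (ψ _), hψ.sum_conj_mul_self]

theorem vonNeumannEntropy_eq (hψ : IsStabilizerState ψ) :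
    vonNeumannEntropy ψ s = Real.log (Fintype.card (stabilizerGroup ψ)) -
      Real.log (Fintype.card (trivialOn ψ sᶜ)) - sᶜ.card * Real.log d := by
  rw [vonNeumannEntropy, sum_negMulLog_eigenvalues _ (hψ.reducedDensity_sq s)
    (hψ.trace_reducedDensity s)]
  have h1 : (Fintype.card (stabilizerGroup ψ) : ℝ) ≠ 0 := Nat.cast_ne_zero.2 Fintype.card_ne_zero
  have h2 : (Fintype.card (trivialOn ψ sᶜ) : ℝ) ≠ 0 := Nat.cast_ne_zero.2 Fintype.card_ne_zero
  have h3 : (d : ℝ) ≠ 0 := Nat.cast_ne_zero.2 (NeZero.ne d)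
  have h4 : Fintype.card {q // q ∉ s} = sᶜ.card := by
    rw [← Fintype.card_coe]
    exact Fintype.card_congr (Equiv.subtypeEquivRight (by simp))
  rw [Real.log_div (mul_ne_zero (pow_ne_zero _ h3) h2) h1, Real.log_mul (pow_ne_zero _ h3) h2,
    Real.log_pow, h4]
  ring

/-- Both spectra are flat, so each entropy is determined by the purity, and the two purities agree.
-/
theorem vonNeumannEntropy_compl (hψ : IsStabilizerState ψ) :
    vonNeumannEntropy ψ sᶜ = vonNeumannEntropy ψ s := by
  have h := trace_reducedDensity_sq_compl s ψ
  rw [hψ.reducedDensity_sq, hψ.reducedDensity_sq, Matrix.trace_smul, Matrix.trace_smul,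
    hψ.trace_reducedDensity, hψ.trace_reducedDensity, smul_eq_mul, smul_eq_mul, mul_one, mul_one,
    Complex.ofReal_inj] at h
  rw [vonNeumannEntropy, vonNeumannEntropy,
    sum_negMulLog_eigenvalues _ (hψ.reducedDensity_sq s) (hψ.trace_reducedDensity s),
    sum_negMulLog_eigenvalues _ (hψ.reducedDensity_sq sᶜ) (hψ.trace_reducedDensity sᶜ), h]

end IsStabilizerState

end LocalGroup

/-! ### Stabilizer cones -/

section StabilizerVectors

variable {n m : ℕ}

/-- The qudits that are held by the parties in `K`. -/
def quditsOf (owner : Fin m → Fin (n + 1)) (K : Finset (Fin (n + 1))) : Finset (Fin m) :=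
  Finset.univ.filter fun q => owner q ∈ K

@[simp] theorem mem_quditsOf {owner : Fin m → Fin (n + 1)} {K : Finset (Fin (n + 1))} {q : Fin m} :
    q ∈ quditsOf owner K ↔ owner q ∈ K := by simp [quditsOf]

theorem quditsOf_compl (owner : Fin m → Fin (n + 1)) (K : Finset (Fin (n + 1))) :
    quditsOf owner Kᶜ = (quditsOf owner K)ᶜ := by ext; simp

theorem card_quditsOf (owner : Fin m → Fin (n + 1)) (K : Finset (Fin (n + 1))) :
    (quditsOf owner K).card = ∑ i ∈ K, (quditsOf owner {i}).card := by
  have : quditsOf owner K = K.biUnion fun i => quditsOf owner {i} := by ext; simp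
  rw [this, Finset.card_biUnion]
  intro i _ j _ hij
  rw [Function.onFun, Finset.disjoint_left]
  intro q hi hj
  simp only [mem_quditsOf, Finset.mem_singleton] at hi hj
  exact hij (hi.symm.trans hj)

variable {d : ℕ} [NeZero d]

theorem trivialOn_quditsOf (ψ : (Fin m → ZMod d) → ℂ) (owner : Fin m → Fin (n + 1))
    (K : Finset (Fin (n + 1))) :
    trivialOn ψ (quditsOf owner K) = K.inf fun i => trivialOn ψ (quditsOf owner {i}) := by
  ext g
  simp only [Finset.inf_eq_iInf, AddSubgroup.mem_iInf, mem_trivialOn, mem_quditsOf,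
    Finset.mem_singleton]
  exact ⟨fun h i hi q hq => h q (hq ▸ hi), fun h q hq => h _ hq q rfl⟩

variable {S : EntropyVector n} {owner : Fin m → Fin (n + 1)} {ψ : (Fin m → ZMod d) → ℂ}

theorem IsStabilizerState.purifiedValue_eq (hψ : IsStabilizerState ψ)
    (hS : ∀ I, S I = vonNeumannEntropy ψ (quditsOf owner (withPurifier I.1)))
    (K : Finset (Fin (n + 1))) : purifiedValue S K = vonNeumannEntropy ψ (quditsOf owner K) := by
  refine purifiedValue_eq_of_value (p := fun K => vonNeumannEntropy ψ (quditsOf owner K)) ?_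
    (fun K => ?_) hS K
  · rw [← hψ.vonNeumannEntropy_compl, hψ.vonNeumannEntropy_eq, compl_compl]
    have : trivialOn ψ (quditsOf owner ∅) = ⊤ := by
      rw [trivialOn_quditsOf, Finset.inf_empty]
    rw [← Nat.card_eq_fintype_card, ← Nat.card_eq_fintype_card, this, AddSubgroup.card_top]
    simp [quditsOf]
  · rw [quditsOf_compl, hψ.vonNeumannEntropy_compl]

/-- The entropy formula is applied to the complement, so that the subgroup trivial on K appears; it
is the intersection of the subgroups for the single parties, and the remaining term is additive. -/
theorem IsStabilizerState.purifiedValue_eq_log (hψ : IsStabilizerState ψ)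
    (hS : ∀ I, S I = vonNeumannEntropy ψ (quditsOf owner (withPurifier I.1)))
    (K : Finset (Fin (n + 1))) :
    purifiedValue S K = Real.log (Nat.card (stabilizerGroup ψ)) -
      Real.log (Nat.card (K.inf fun i => trivialOn ψ (quditsOf owner {i}) : AddSubgroup _)) -
      ∑ i ∈ K, (quditsOf owner {i}).card * Real.log d := by
  rw [hψ.purifiedValue_eq hS, ← hψ.vonNeumannEntropy_compl, hψ.vonNeumannEntropy_eq, compl_compl,
    ← Nat.card_eq_fintype_card, ← Nat.card_eq_fintype_card, trivialOn_quditsOf, card_quditsOf,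
    ← Finset.sum_mul]
  push_cast
  rfl

theorem stabilizerEntropyVectors_relabel (hS : S ∈ stabilizerEntropyVectors d n)
    (σ : Equiv.Perm (Fin (n + 1))) : relabel σ S ∈ stabilizerEntropyVectors d n := by
  obtain ⟨m, owner, ψ, hψ, hS⟩ := hS
  refine ⟨m, fun q => σ.symm (owner q), ψ, hψ, fun I => ?_⟩
  rw [relabel, hψ.purifiedValue_eq hS]
  congr 1
  ext q
  simp [Finset.mem_map_equiv]

end StabilizerVectors

/-! ### Log-index as a modular function on subgroups -/

section LogCard

variable {L : Type*} [AddCommGroup L] [Finite L]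

/-- Second isomorphism theorem, in terms of relative indices. -/
theorem card_sup_mul_card_inf (A B : AddSubgroup L) :
    Nat.card (A ⊔ B : AddSubgroup L) * Nat.card (A ⊓ B : AddSubgroup L) =
      Nat.card A * Nat.card B := by
  have h1 := AddSubgroup.relIndex_mul_relIndex ⊥ B (A ⊔ B) bot_le le_sup_right
  have h2 := AddSubgroup.relIndex_mul_relIndex ⊥ (A ⊓ B) A bot_le inf_le_left
  rw [AddSubgroup.relIndex_sup_right] at h1
  rw [AddSubgroup.inf_relIndex_left] at h2
  simp only [AddSubgroup.relIndex_bot_left] at h1 h2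
  rw [← h1, ← h2]
  ring

/-- The logarithm of the index of a subgroup. -/
noncomputable def logIndex (A : (AddSubgroup L)ᵒᵈ) : ℝ :=
  Real.log (Nat.card L) - Real.log (Nat.card (OrderDual.ofDual A : AddSubgroup L))

theorem monotone_logIndex : Monotone (logIndex : (AddSubgroup L)ᵒᵈ → ℝ) := by
  intro A B h
  have : Nat.card (OrderDual.ofDual B : AddSubgroup L) ≤
      Nat.card (OrderDual.ofDual A : AddSubgroup L) :=
    AddSubgroup.card_le_of_le h
  have := Real.log_le_log (Nat.cast_pos.2 Nat.card_pos) ((Nat.cast_le (α := ℝ)).2 this)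
  exact sub_le_sub_left this _

theorem modular_logIndex (A B : (AddSubgroup L)ᵒᵈ) :
    logIndex (A ⊔ B) + logIndex (A ⊓ B) = logIndex A + logIndex B := by
  have h := card_sup_mul_card_inf (OrderDual.ofDual A) (OrderDual.ofDual B)
  have hne : ∀ C : AddSubgroup L, (Nat.card C : ℝ) ≠ 0 := fun C =>
    Nat.cast_ne_zero.2 Nat.card_pos.ne'
  have := congrArg (fun k : ℕ => Real.log k) h
  simp only [Nat.cast_mul] at this
  rw [Real.log_mul (hne _) (hne _), Real.log_mul (hne _) (hne _)] at this
  simp only [logIndex, ofDual_sup, ofDual_inf]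
  linarith

theorem logIndex_bot : logIndex (⊥ : (AddSubgroup L)ᵒᵈ) = 0 := by
  simp [logIndex]

end LogCard

/-- In the order dual, intersections of subgroups become joins. Only finite abelian groups are
involved, so composite local dimensions need no separate treatment. -/
theorem stabilizerEntropyVectors_subset_ingletonCone (d : ℕ) [NeZero d] :
    stabilizerEntropyVectors d 4 ⊆ ingletonCone := by
  rintro S ⟨m, owner, ψ, hψ, hS⟩
  refine mem_ingletonCone_of_modular monotone_logIndex modular_logIndex logIndex_bot
    (fun i => OrderDual.toDual (trivialOn ψ (quditsOf owner {i})))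
    (fun i => (quditsOf owner {i}).card * Real.log d) fun K => ?_
  rw [hψ.purifiedValue_eq_log hS]
  rfl

theorem quditStabilizerCone_subset_ingletonCone : quditStabilizerCone 4 ⊆ ingletonCone := by
  refine hull_subset (Set.iUnion_subset fun d => stabilizerEntropyVectors_subset_ingletonCone _)
    ⟨_, ray_mem_ingletonCone (0, 1)⟩ (fun _ h _ h' => ingletonCone_add h h')
    fun t ht _ h => ingletonCone_smul h ht

theorem qubitStabilizerCone_subset_quditStabilizerCone (n : ℕ) :
    qubitStabilizerCone n ⊆ quditStabilizerCone n :=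
  Submodule.span_mono (Set.subset_iUnion (fun d => stabilizerEntropyVectors (d + 2) n) 0)

/-! ### Qubit stabilizer entropies as dimensions -/

section Qubit

theorem log_card_eq_finrank {E : Type*} [AddCommGroup E] [Module (ZMod 2) E] [Finite E] :
    Real.log (Nat.card E) = Module.finrank (ZMod 2) E * Real.log 2 := by
  rw [Module.natCard_eq_pow_finrank (K := ZMod 2), Nat.card_zmod, Nat.cast_pow, Real.log_pow,
    Nat.cast_ofNat]

theorem dualAnnihilator_finset_inf {K E ι : Type*} [Field K] [AddCommGroup E] [Module K E]
    [FiniteDimensional K E] (s : Finset ι) (W : ι → Submodule K E) :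
    (s.inf W).dualAnnihilator = s.sup fun i => (W i).dualAnnihilator := by
  classical
  induction s using Finset.induction_on with
  | empty => simp
  | insert i s hi ih => rw [Finset.inf_insert, Finset.sup_insert, ← ih,
      Subspace.dualAnnihilator_inf_eq]

/-- The logarithm of the index of a subgroup of a vector space over the field with two elements
is the rank of its annihilator. -/
theorem logIndex_eq_realRank {L : Type} [AddCommGroup L] [Module (ZMod 2) L] [Finite L]
    {ι : Type*} (s : Finset ι) (N : ι → AddSubgroup L) :
    Real.log (Nat.card L) - Real.log (Nat.card (s.inf N : AddSubgroup L)) =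
      Real.log 2 * realRank
        (s.sup fun i => (AddSubgroup.toZModSubmodule 2 (N i)).dualAnnihilator) := by
  rw [← dualAnnihilator_finset_inf]
  have h : AddSubgroup.toZModSubmodule 2 (s.inf N) =
      s.inf fun i => AddSubgroup.toZModSubmodule 2 (N i) := by
    rw [map_finset_inf]; rfl
  rw [← h, realRank]
  have hfin := Subspace.finrank_add_finrank_dualAnnihilator_eq
    (AddSubgroup.toZModSubmodule 2 (s.inf N))
  have h1 := log_card_eq_finrank (E := L)
  have h2 : Real.log (Nat.card (s.inf N : AddSubgroup L)) = _ :=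
    log_card_eq_finrank (E := AddSubgroup.toZModSubmodule 2 (s.inf N))
  rw [h1, h2, ← hfin]
  push_cast
  ring

/-- For d = 2 the stabilizer group has exponent two and is a vector space. The annihilators of the
subspaces trivial on single parties have sums whose dimensions are the log-indices in units of log
2. -/
theorem stabilizerEntropyVectors_subset_quantumLinearRankCone (n : ℕ) :
    stabilizerEntropyVectors 2 n ⊆ quantumLinearRankCone n := by
  rintro S ⟨m, owner, ψ, hψ, hS⟩
  let _ : Module (ZMod 2) (stabilizerGroup ψ) := AddCommGroup.zmodModule fun g => by
    rw [two_nsmul]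
    ext q <;> exact CharTwo.add_self_eq_zero _
  have hlog : Real.log 2 ≠ 0 := (Real.log_pos one_lt_two).ne'
  have hS' := hψ.purifiedValue_eq_log hS
  rw [show S = Real.log 2 • (Real.log 2)⁻¹ • S by rw [smul_inv_smul₀ hlog]]
  refine quantumLinearRankCone_smul ?_ (Real.log_pos one_lt_two).le
  refine mem_quantumLinearRankCone_of_finrank
    (fun i => (AddSubgroup.toZModSubmodule 2 (trivialOn ψ (quditsOf owner {i}))).dualAnnihilator)
    (fun i => (quditsOf owner {i}).card) fun K => ?_
  rw [purifiedValue_smul, hS', logIndex_eq_realRank, ← Finset.sum_mul, Nat.cast_ofNat]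
  field_simp

theorem qubitStabilizerCone_subset_quantumLinearRankCone (n : ℕ) :
    qubitStabilizerCone n ⊆ quantumLinearRankCone n :=
  hull_subset (stabilizerEntropyVectors_subset_quantumLinearRankCone n)
    ⟨0, zero_mem_quantumLinearRankCone⟩ (fun _ h _ h' => quantumLinearRankCone_add h h')
    fun _ ht _ h => quantumLinearRankCone_smul h ht

end Qubit

/-! ### Graph states -/

section GraphState

variable {m : ℕ} (A : Matrix (Fin m) (Fin m) (ZMod 2))

/-- The quadratic form of a graph with the given adjacency matrix: the number of edges between
the vertices of a set, modulo two. -/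
def graphForm (x : Fin m → ZMod 2) : ZMod 2 := ∑ i, ∑ j, if i < j then A i j * (x i * x j) else 0

/-- The graph state of the graph with the given adjacency matrix. -/
noncomputable def graphState (x : Fin m → ZMod 2) : ℂ :=
  ((Real.sqrt 2 : ℂ) ^ m)⁻¹ * ZMod.stdAddChar (graphForm A x)

variable {A}

/-- Polarization: the bilinear form associated with the quadratic form is given by the symmetric
matrix A with zero diagonal. -/
theorem graphForm_add (hsymm : A.transpose = A) (hdiag : ∀ i, A i i = 0) (x a : Fin m → ZMod 2) :
    graphForm A (x + a) = graphForm A a + A.mulVec a ⬝ᵥ x + graphForm A x := by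
  have hA : ∀ i j, A i j = A j i := fun i j => (congrFun (congrFun hsymm i) j).symm
  have h : A.mulVec a ⬝ᵥ x = ∑ i, ∑ j, (if i < j then A i j * (x i * a j + a i * x j) else 0) := by
    have h1 : ∑ i, ∑ j, (if i < j then A i j * (a i * x j) else 0) =
        ∑ i, ∑ j, if j < i then A i j * (x i * a j) else 0 := by
      rw [Finset.sum_comm]
      refine Finset.sum_congr rfl fun i _ => Finset.sum_congr rfl fun j _ => ?_
      rw [hA j i, mul_comm (a j)]
    have h2 : ∀ i j, (if i < j then A i j * (x i * a j + a i * x j) else 0) =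
        (if i < j then A i j * (x i * a j) else 0) + if i < j then A i j * (a i * x j) else 0 := by
      intro i j
      split_ifs <;> ring
    simp only [h2, Finset.sum_add_distrib, h1]
    simp only [← Finset.sum_add_distrib, dotProduct, Matrix.mulVec, Finset.sum_mul]
    refine Finset.sum_congr rfl fun i _ => Finset.sum_congr rfl fun j _ => ?_
    rcases lt_trichotomy i j with hij | rfl | hij
    · rw [if_pos hij, if_neg hij.asymm]; ring
    · simp [hdiag]
    · rw [if_pos hij, if_neg hij.asymm]; ring
  rw [h]
  simp only [graphForm, ← Finset.sum_add_distrib]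
  refine Finset.sum_congr rfl fun i _ => Finset.sum_congr rfl fun j _ => ?_
  split_ifs
  · simp only [Pi.add_apply]; ring
  · simp

theorem graphForm_zero : graphForm A 0 = 0 := by simp [graphForm]

theorem graphState_zero_ne_zero : graphState A 0 ≠ 0 := by
  simp [graphState, graphForm_zero]

theorem graphState_add (hsymm : A.transpose = A) (hdiag : ∀ i, A i i = 0) (x a : Fin m → ZMod 2) :
    graphState A (x + a) =
      ZMod.stdAddChar (graphForm A a) * dotChar (A.mulVec a) x * graphState A x := by
  rw [graphState, graphForm_add hsymm hdiag, AddChar.map_add_eq_mul, AddChar.map_add_eq_mul,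
    graphState, dotChar]
  ring

/-- The operators X^a Z^(Aa), with phases, stabilize the graph state. Applied at the label 0, the
one for a determines the amplitude at a, so a common fixed vector is determined by its amplitude at
0. -/
theorem graphState_isStabilizerState (hsymm : A.transpose = A) (hdiag : ∀ i, A i i = 0) :
    IsStabilizerState (graphState A) := by
  refine ⟨?_, {M | ∃ a, M = (ZMod.stdAddChar (graphForm A a) : ℂ) • pauliString a (A.mulVec a)},
    ?_, fun φ => ⟨fun h => ?_, ?_⟩⟩
  · have : ∀ x, ‖graphState A x‖ ^ 2 = ((2 : ℝ) ^ m)⁻¹ := by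
      intro x
      rw [graphState, norm_mul, AddChar.norm_apply, mul_one, norm_inv, norm_pow, Complex.norm_real,
        inv_pow, ← pow_mul, mul_comm m, pow_mul, Real.norm_eq_abs, sq_abs, Real.sq_sqrt zero_le_two]
    simp only [this, Finset.sum_const, Finset.card_univ, Fintype.card_fun, ZMod.card,
      Fintype.card_fin, nsmul_eq_mul]
    push_cast
    exact mul_inv_cancel₀ (by positivity)
  · rintro _ ⟨a, rfl⟩
    exact ⟨_, a, _, AddChar.norm_apply _ _, rfl⟩
  · refine ⟨φ 0 * (graphState A 0)⁻¹, funext fun a => ?_⟩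
    have h1 := (smul_pauliString_mulVec_eq_iff _ _ _ _).1 (h _ ⟨a, rfl⟩) 0
    have h2 := graphState_add hsymm hdiag 0 a
    rw [zero_add] at h1 h2
    rw [Pi.smul_apply, smul_eq_mul, h1, h2]
    field_simp [graphState_zero_ne_zero (A := A)]
  · rintro ⟨z, rfl⟩ _ ⟨a, rfl⟩
    rw [smul_pauliString_mulVec_eq_iff]
    intro x
    rw [Pi.smul_apply, Pi.smul_apply, graphState_add hsymm hdiag, smul_eq_mul, smul_eq_mul]
    ring

/-- Compare the phases of two operators with the same X-part: at x = 0 the scalars agree, and at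
unit vectors the characters agree, which by injectivity fixes the Z-part coordinate by coordinate.
-/
theorem mem_stabilizerGroup_graphState (hsymm : A.transpose = A) (hdiag : ∀ i, A i i = 0)
    (g : (Fin m → ZMod 2) × (Fin m → ZMod 2)) :
    g ∈ stabilizerGroup (graphState A) ↔ g.2 = A.mulVec g.1 := by
  constructor
  · rintro ⟨c, -, hc⟩
    have hne : ∀ x, graphState A x ≠ 0 := fun x => by
      simpa [graphState] using norm_ne_zero_iff.1 (by simp)
    have h1 : ∀ x, ZMod.stdAddChar (graphForm A g.1) * dotChar (A.mulVec g.1) x =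
        c * dotChar g.2 x := fun x =>
      mul_right_cancel₀ (hne x) ((graphState_add hsymm hdiag x g.1).symm.trans (hc x))
    have h0 := h1 0
    simp only [dotChar, dotProduct_zero, AddChar.map_zero_eq_one, mul_one] at h0
    funext q
    have h2 := h1 (Pi.single q 1)
    rw [h0, mul_right_inj' (by rw [← h0]; exact norm_ne_zero_iff.1 (by simp)), dotChar, dotChar,
      dotProduct_single_one, dotProduct_single_one] at h2
    exact (ZMod.injective_stdAddChar h2).symm
  · intro h
    refine ⟨ZMod.stdAddChar (graphForm A g.1), norm_ne_zero_iff.1 (by simp), fun x => ?_⟩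
    rw [h, graphState_add hsymm hdiag]

/-- The Pauli operators in the stabilizer group of a graph state, up to phases, correspond to the
sets of vertices. -/
def stabilizerGroupGraphStateEquiv (hsymm : A.transpose = A) (hdiag : ∀ i, A i i = 0) :
    stabilizerGroup (graphState A) ≃ (Fin m → ZMod 2) where
  toFun g := g.1.1
  invFun a := ⟨(a, A.mulVec a), (mem_stabilizerGroup_graphState hsymm hdiag _).2 rfl⟩
  left_inv g := Subtype.ext (Prod.ext rfl
    ((mem_stabilizerGroup_graphState hsymm hdiag _).1 g.2).symm)
  right_inv _ := rfl

theorem vonNeumannEntropy_graphState (hsymm : A.transpose = A) (hdiag : ∀ i, A i i = 0)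
    (s : Finset (Fin m)) :
    vonNeumannEntropy (graphState A) s = s.card * Real.log 2 - Real.log (Finset.univ.filter
      fun a : Fin m → ZMod 2 => ∀ q ∈ sᶜ, a q = 0 ∧ A.mulVec a q = 0).card := by
  rw [(graphState_isStabilizerState hsymm hdiag).vonNeumannEntropy_eq]
  have h1 : Fintype.card (stabilizerGroup (graphState A)) = 2 ^ m := by
    rw [Fintype.card_congr (stabilizerGroupGraphStateEquiv hsymm hdiag)]
    simp
  have h2 : Fintype.card (trivialOn (graphState A) sᶜ) = (Finset.univ.filter
      fun a : Fin m → ZMod 2 => ∀ q ∈ sᶜ, a q = 0 ∧ A.mulVec a q = 0).card := by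
    rw [← Fintype.card_subtype]
    refine Fintype.card_congr ((stabilizerGroupGraphStateEquiv hsymm hdiag).subtypeEquiv
      fun g => ?_)
    have h := (mem_stabilizerGroup_graphState hsymm hdiag _).1 g.2
    change (∀ q ∈ sᶜ, g.1.1 q = 0 ∧ g.1.2 q = 0) ↔ ∀ q ∈ sᶜ, g.1.1 q = 0 ∧ A.mulVec g.1.1 q = 0
    rw [h]
  have h3 : (sᶜ.card : ℝ) = m - s.card := by
    rw [Finset.card_compl, Fintype.card_fin, Nat.cast_sub (by simpa using s.card_le_univ)]
  rw [h1, h2, h3, Nat.cast_pow, Real.log_pow, Nat.cast_ofNat]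
  ring

end GraphState

/-! ### Graph-state entropies by computation with bit masks -/

section BitVectors

variable {m : ℕ}

/-- The bit of a number at a given place, modulo two. -/
def bit (y q : ℕ) : ZMod 2 := if y.testBit q then 1 else 0

theorem bit_eq_zero {y q : ℕ} : bit y q = 0 ↔ y.testBit q = false := by
  unfold bit; split_ifs with h <;> simp [h]

theorem bit_xor (y z q : ℕ) : bit (y ^^^ z) q = bit y q + bit z q := by
  unfold bit
  rw [Nat.testBit_xor]
  cases y.testBit q <;> cases z.testBit q <;> decide

theorem bit_zero (q : ℕ) : bit 0 q = 0 := by simp [bit]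

/-- The matrix over the field with two elements whose rows are given by the bits of numbers. -/
def bitMatrix (rows : Fin m → ℕ) : Matrix (Fin m) (Fin m) (ZMod 2) :=
  Matrix.of fun i j => bit (rows i) j

/-- The vector-matrix product, in terms of numbers. -/
def bitMul (rows : Fin m → ℕ) (y : ℕ) : ℕ :=
  (List.finRange m).foldr
    (fun (j : Fin m) z => Nat.xor (bif Nat.testBit y j then rows j else 0) z) 0

theorem bit_bitMul (rows : Fin m → ℕ) (y q : ℕ) :
    bit (bitMul rows y) q = ∑ j : Fin m, bit y j * bit (rows j) q := by
  rw [← List.sum_ofFn, List.ofFn_eq_map, bitMul]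
  induction List.finRange m with
  | nil => exact bit_zero q
  | cons j l ih =>
    rw [List.map_cons, List.sum_cons, ← ih, List.foldr_cons]
    refine (bit_xor _ _ _).trans (congrArg (· + _) ?_)
    rw [bit]
    unfold bit
    cases y.testBit j <;> simp

theorem image_bits : (Finset.range (2 ^ m)).image (fun y (q : Fin m) => bit y q) = Finset.univ ∧
    Set.InjOn (fun y (q : Fin m) => bit y q) (Finset.range (2 ^ m) : Set ℕ) := by
  have hinj : Set.InjOn (fun y (q : Fin m) => bit y q) (Finset.range (2 ^ m) : Set ℕ) := by
    intro y hy z hz h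
    simp only [Finset.coe_range, Set.mem_Iio] at hy hz
    refine Nat.eq_of_testBit_eq fun q => ?_
    by_cases hq : q < m
    · have := congrFun h ⟨q, hq⟩
      simp only [bit] at this
      cases h1 : y.testBit q <;> cases h2 : z.testBit q <;> simp [h1, h2] at this ⊢
    · have hle : 2 ^ m ≤ 2 ^ q := Nat.pow_le_pow_right two_pos (not_lt.1 hq)
      rw [Nat.testBit_lt_two_pow (hy.trans_le hle), Nat.testBit_lt_two_pow (hz.trans_le hle)]
  refine ⟨Finset.eq_univ_of_card _ ?_, hinj⟩
  rw [Finset.card_image_of_injOn hinj]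
  simp

/-- The qudits that are not held by the parties in `I`, as a bit mask. -/
def outsideMask (owner : Fin m → Fin 5) (I : Finset (Fin 4)) : ℕ :=
  maskOf (((List.finRange m).filter fun q => owner q ∉ withPurifier I).map Fin.val)

theorem testBit_outsideMask (owner : Fin m → Fin 5) (I : Finset (Fin 4)) (q : ℕ) :
    (outsideMask owner I).testBit q = true ↔
      ∃ h : q < m, (⟨q, h⟩ : Fin m) ∈ (quditsOf owner (withPurifier I))ᶜ := by
  rw [outsideMask, testBit_maskOf]
  simp only [List.mem_map, List.mem_filter, List.mem_finRange, true_and, decide_eq_true_eq,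
    Finset.mem_compl, mem_quditsOf]
  exact ⟨fun ⟨a, h, e⟩ => e ▸ ⟨a.2, h⟩, fun ⟨h, h'⟩ => ⟨⟨q, h⟩, h', rfl⟩⟩

/-- Replaces vectors over the field with two elements by numbers below 2^m, so that the kernel can
count with bitwise operations. -/
theorem card_filter_bits {rows : Fin m → ℕ} (hsymm : (bitMatrix rows).transpose = bitMatrix rows)
    (owner : Fin m → Fin 5) (I : Finset (Fin 4)) :
    (Finset.univ.filter fun a : Fin m → ZMod 2 => ∀ q ∈ (quditsOf owner (withPurifier I))ᶜ,
      a q = 0 ∧ (bitMatrix rows).mulVec a q = 0).card =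
    ((Finset.range (2 ^ m)).filter fun y => Nat.beq (Nat.land (Nat.lor y (bitMul rows y))
      (outsideMask owner I)) 0 = true).card := by
  rw [← image_bits.1, Finset.filter_image, Finset.card_image_of_injOn
    (image_bits.2.mono (Finset.coe_subset.2 (Finset.filter_subset _ _)))]
  congr 1
  refine Finset.filter_congr fun y hy => ?_
  have hmul : ∀ q : Fin m, (bitMatrix rows).mulVec (fun q => bit y q) q = bit (bitMul rows y) q := by
    intro q
    rw [← hsymm, bit_bitMul]
    simp [Matrix.mulVec, dotProduct, bitMatrix, mul_comm]
  simp only [hmul, bit_eq_zero, Nat.beq_eq]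
  change _ ↔ (y ||| bitMul rows y) &&& outsideMask owner I = 0
  constructor
  · intro h
    refine Nat.eq_of_testBit_eq fun q => ?_
    rw [Nat.testBit_and, Nat.testBit_or, Nat.zero_testBit, Bool.and_eq_false_iff,
      Bool.or_eq_false_iff, or_iff_not_imp_right, Bool.not_eq_false, testBit_outsideMask]
    rintro ⟨hq, h'⟩
    exact h _ h'
  · intro h q hq
    have := congrArg (Nat.testBit · q) h
    rw [Nat.testBit_and, Nat.testBit_or, Nat.zero_testBit, Bool.and_eq_false_iff,
      Bool.or_eq_false_iff, or_iff_not_imp_right, Bool.not_eq_false, testBit_outsideMask] at this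
    exact this ⟨q.2, hq⟩

/-- The entropies of a graph state are `c * log 2` times the given digits. -/
def HasGraphState (v c : ℕ) (owner : Fin m → Fin 5) (rows : Fin m → ℕ) : Prop :=
  (∀ i j : Fin m, (rows i).testBit j = (rows j).testBit i) ∧
  (∀ i : Fin m, (rows i).testBit i = false) ∧
  ∀ I : Finset (Fin 4), ((Finset.range (2 ^ m)).filter fun y =>
      Nat.beq (Nat.land (Nat.lor y (bitMul rows y)) (outsideMask owner I)) 0 = true).card *
        2 ^ (c * digit v (maskOfSet (withPurifier I))) = 2 ^ (quditsOf owner (withPurifier I)).card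

instance (v c : ℕ) (owner : Fin m → Fin 5) (rows : Fin m → ℕ) :
    Decidable (HasGraphState v c owner rows) := by
  unfold HasGraphState; infer_instance

theorem HasGraphState.mem_stabilizerEntropyVectors {v c : ℕ} {owner : Fin m → Fin 5}
    {rows : Fin m → ℕ} (h : HasGraphState v c owner rows) :
    (c * Real.log 2) • vectorOf v ∈ stabilizerEntropyVectors 2 4 := by
  have hsymm : (bitMatrix rows).transpose = bitMatrix rows := by
    ext i j
    simp [bitMatrix, bit, h.1 i j]
  have hdiag : ∀ i, bitMatrix rows i i = 0 := fun i => bit_eq_zero.2 (h.2.1 i)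
  refine ⟨m, owner, graphState (bitMatrix rows), graphState_isStabilizerState hsymm hdiag,
    fun I => ?_⟩
  change _ = vonNeumannEntropy _ (quditsOf owner (withPurifier I.1))
  rw [vonNeumannEntropy_graphState hsymm hdiag, card_filter_bits hsymm]
  have := congrArg (fun k : ℕ => Real.log k) (h.2.2 I.1)
  simp only [Nat.cast_mul, Nat.cast_pow, Nat.cast_ofNat] at this
  rw [Real.log_mul _ (by positivity), Real.log_pow, Real.log_pow] at this
  · simp only [vectorOf, Pi.smul_apply, smul_eq_mul]
    rw [← this]
    push_cast
    ring
  · intro h0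
    have := h.2.2 I.1
    rw [Nat.cast_eq_zero.1 h0, zero_mul] at this
    exact absurd this.symm (by positivity)

end BitVectors

/-! ### Graph states for the extreme rays -/

section RayStates

theorem hasGraphState_baseRay_zero :
    HasGraphState (baseRay 0) 1 ![0, 1] ![2, 1] := by
  decide +kernel

theorem hasGraphState_baseRay_one :
    HasGraphState (baseRay 1) 1 ![1, 2, 3, 4] ![14, 1, 1, 1] := by
  decide +kernel

theorem hasGraphState_baseRay_two :
    HasGraphState (baseRay 2) 1 ![0, 1, 2, 3, 4] ![30, 1, 1, 1, 1] := by
  decide +kernel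

/-- The graph is a tree on seven vertices; parties 0 and 1 hold two qubits each. -/
theorem hasGraphState_baseRay_three :
    HasGraphState (baseRay 3) 1 ![2, 0, 0, 1, 1, 3, 4] ![24, 8, 16, 35, 69, 8, 16] := by
  decide +kernel

/-- The graph is a six-cycle; party 0 holds two opposite vertices, matching the leg of weight two in
the star. -/
theorem hasGraphState_baseRay_four :
    HasGraphState (baseRay 4) 1 ![4, 1, 2, 3, 0, 0] ![20, 40, 33, 18, 9, 6] := by
  decide +kernel

/-- The graph is an eight-cycle in which each of four parties holds two qubits; this realizes twice
the star vector, hence the factor 2. -/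
theorem hasGraphState_baseRay_five :
    HasGraphState (baseRay 5) 2 ![1, 1, 2, 2, 3, 3, 4, 4] ![132, 80, 17, 96, 6, 136, 10, 33] := by
  decide +kernel

/-- The graph is a tree: the path 0, 6, 7, 1 with two further leaves at each end. -/
theorem hasGraphState_baseRay_six :
    HasGraphState (baseRay 6) 1 ![2, 2, 3, 3, 4, 4, 0, 1] ![84, 168, 1, 2, 1, 2, 129, 66] := by
  decide +kernel

theorem exists_smul_baseRay_mem (k : Fin 7) :
    ∃ c : ℕ, c ≠ 0 ∧ (c * Real.log 2) • vectorOf (baseRay k) ∈ stabilizerEntropyVectors 2 4 := by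
  fin_cases k
  · exact ⟨1, by decide, hasGraphState_baseRay_zero.mem_stabilizerEntropyVectors⟩
  · exact ⟨1, by decide, hasGraphState_baseRay_one.mem_stabilizerEntropyVectors⟩
  · exact ⟨1, by decide, hasGraphState_baseRay_two.mem_stabilizerEntropyVectors⟩
  · exact ⟨1, by decide, hasGraphState_baseRay_three.mem_stabilizerEntropyVectors⟩
  · exact ⟨1, by decide, hasGraphState_baseRay_four.mem_stabilizerEntropyVectors⟩
  · exact ⟨2, by decide, hasGraphState_baseRay_five.mem_stabilizerEntropyVectors⟩
  · exact ⟨1, by decide, hasGraphState_baseRay_six.mem_stabilizerEntropyVectors⟩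

theorem ray_mem_qubitStabilizerCone (k) : ray k ∈ qubitStabilizerCone 4 := by
  obtain ⟨c, hc, h⟩ := exists_smul_baseRay_mem k.1
  have hpos : 0 < c * Real.log 2 :=
    mul_pos (Nat.cast_pos.2 (Nat.pos_of_ne_zero hc)) (Real.log_pos one_lt_two)
  have h' := stabilizerEntropyVectors_relabel h k.2
  rw [relabel_smul] at h'
  have := Submodule.smul_mem (PointedCone.hull ℝ (stabilizerEntropyVectors 2 4))
    (⟨(c * Real.log 2)⁻¹, inv_nonneg.2 hpos.le⟩ : {c : ℝ // 0 ≤ c}) (Submodule.subset_span h')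
  change (c * Real.log 2)⁻¹ • (c * Real.log 2) • ray k ∈ qubitStabilizerCone 4 at this
  rwa [inv_smul_smul₀ hpos.ne'] at this

theorem ingletonCone_subset_qubitStabilizerCone : ingletonCone ⊆ qubitStabilizerCone 4 :=
  ingletonCone_subset_hull.trans (Submodule.span_le.2 (by
    rintro _ ⟨k, rfl⟩
    exact ray_mem_qubitStabilizerCone k))

end RayStates

end EntropyCone

/-! ### Assembly of the cyclic inclusions -/

open EntropyCone in
theorem mainTheorem4 :
    -- the hypergraph cone is cut out by the orbits of SA, SSA and Ingleton
    hypergraphCone 4 = ingletonCone ∧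
    -- it coincides with the quantum linear rank cone and with the stabilizer cone
    hypergraphCone 4 = quantumLinearRankCone 4 ∧
    hypergraphCone 4 = qubitStabilizerCone 4 ∧
    hypergraphCone 4 = quditStabilizerCone 4 ∧
    -- each of the three inequalities has a contraction map valid for every rank
    (∃ f, SA.IsContractionMap f) ∧
    (∃ f, SSA.IsContractionMap f) ∧
    (∃ f, Ingleton.IsContractionMap f) ∧
    -- every extreme ray is realized by a hypergraph, with at most one bulk vertex
    (∀ S, IsExtremeRay ingletonCone S →
      ∃ (V : Type) (_ : Fintype V) (_ : DecidableEq V) (H : Hypergraph V 4),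
        H.entropy = S ∧ H.bulkCard ≤ 1) := by
  have h1 : ingletonCone = qubitStabilizerCone 4 :=
    ingletonCone_subset_qubitStabilizerCone.antisymm
      ((qubitStabilizerCone_subset_quditStabilizerCone 4).trans
        quditStabilizerCone_subset_ingletonCone)
  have h2 : ingletonCone = quditStabilizerCone 4 :=
    (ingletonCone_subset_qubitStabilizerCone.trans
      (qubitStabilizerCone_subset_quditStabilizerCone 4)).antisymm
        quditStabilizerCone_subset_ingletonCone
  have h3 : ingletonCone = quantumLinearRankCone 4 :=
    (ingletonCone_subset_qubitStabilizerCone.trans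
      (qubitStabilizerCone_subset_quantumLinearRankCone 4)).antisymm
        quantumLinearRankCone_subset_ingletonCone
  refine ⟨hypergraphCone_eq_ingletonCone, hypergraphCone_eq_ingletonCone.trans h3,
    hypergraphCone_eq_ingletonCone.trans h1, hypergraphCone_eq_ingletonCone.trans h2,
    exists_contractionMap_SA, exists_contractionMap_SSA, exists_contractionMap_Ingleton,
    fun S hS => ?_⟩
  obtain ⟨k, t, ht, rfl⟩ := hS.exists_eq_smul_ray
  exact exists_hypergraph_smul_ray k ht
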